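/- Let $\mathbb T=\mathbb R/2\pi\mathbb Z$, and let $X$ be the space of real-valued functions on $\mathbb T\times\mathbb R$ (with coordinates $(x,y)$) with finite norm $$\|f\|_X^2=\|f\|_{L^2}^2+\|y f\|_{L^2}^2 .$$ For $\nu>0$ let $$\mathcal L=-y^2\partial_x+2\partial_x\Delta^{-1}+\nu\Delta ,$$ regarded as an unbounded operator on $X$ whose domain consists of all $\omega\in X$ for which the distribution $\mathcal L\omega$ belongs to $X$. Here $\partial_x\Delta^{-1}\omega=\partial_x\psi$, where $\psi\in L^2(\mathbb T\times\mathbb R)$ is the function with $\int_{\mathbb T}\psi(x,y)\,dx=0$ for a.e. $y$ that solves, in the sense of distributions, $\Delta\psi=\omega-\frac1{2\pi}\int_{\mathbb T}\omega(x,\cdot)\,dx$. There exist constants $\varepsilon_0\ge\frac1{20}$ and $C_0\in(1,10)$, independent of $\nu$, such that the following holds for every $0<\nu<1$. The operator $\mathcal L$ is the generator of a unique strongly continuous semigroup $(e^{\mathcal L t})_{t\ge0}$ on $X$, and if $\omega^{in}\in X$ satisfies $$\int_{\mathbb T}\omega^{in}(x,y)\,dx=0\qquad\text{for almost every }y\in\mathbb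 R,$$ then $$\|e^{\mathcal L t}\omega^{in}\|_X\le C_0\,e^{-\varepsilon_0\lambda_\nu t}\,\|\omega^{in}\|_X\qquad\text{for all }t\ge0,\qquad\text{where}\quad \lambda_\nu=\frac{\nu^{1/2}}{1+|\log\nu|}.$$ -/

import Mathlib

open MeasureTheory Filter Topology
open scoped NNReal ENNReal

noncomputable section

/-! ### Strongly continuous semigroups and their generators -/

/-- A strongly continuous one-parameter semigroup of bounded linear operators on `E`. -/
structure C0Semigroup (E : Type*) [NormedAddCommGroup E] [NormedSpace ℝ E] where
  /-- the operator at time `t ≥ 0` -/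
  op : ℝ≥0 → E →L[ℝ] E
  op_zero : op 0 = ContinuousLinearMap.id ℝ E
  op_add : ∀ s t, op (s + t) = (op s).comp (op t)
  tendsto_op : ∀ x, Tendsto (fun t => op t x) (𝓝 0) (𝓝 x)

/-- `S.GeneratorGraph x f`: the vector `x` lies in the domain of the infinitesimal generator `A`
of `S`, and `A x = f`, that is, `(S(h) x - x) / h → f` as `h ↓ 0`. -/
def C0Semigroup.GeneratorGraph {E : Type*} [NormedAddCommGroup E] [NormedSpace ℝ E]
    (S : C0Semigroup E) (x f : E) : Prop :=
  Tendsto (fun h : ℝ≥0 => (h : ℝ)⁻¹ • (S.op h x - x)) (𝓝[>] 0) (𝓝 f)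

namespace Poiseuille

instance : Fact (0 < 2 * Real.pi) := ⟨Real.two_pi_pos⟩

/-- The circle `ℝ / 2πℤ`; its `volume` is Lebesgue measure, of total mass `2π`. -/
abbrev Torus : Type := AddCircle (2 * Real.pi)

/-- The domain `𝕋 × ℝ`, with points `p = (x, y)` and with the measure `dx dy`. -/
abbrev Dom : Type := Torus × ℝ

/-- The measure `(1 + y²) dx dy` on `𝕋 × ℝ`. -/
def weightedMeasure : Measure Dom :=
  (volume : Measure Dom).withDensity fun p => ENNReal.ofReal (1 + p.2 ^ 2)

/-- The space `X` of real functions on `𝕋 × ℝ` with `‖f‖_X² = ‖f‖_{L²}² + ‖y f‖_{L²}² < ∞`,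
realised as `L²((1 + y²) dx dy)`. -/
abbrev X : Type := Lp ℝ 2 weightedMeasure

/-- The norm of `X` is `‖f‖_X² = ‖f‖_{L²}² + ‖y f‖_{L²}²`. -/
theorem norm_sq_X (f : X) :
    MemLp f 2 (volume : Measure Dom) ∧ MemLp (fun p : Dom => p.2 * f p) 2 volume ∧
      ‖f‖ ^ 2 = (∫ p : Dom, f p ^ 2) + ∫ p : Dom, (p.2 * f p) ^ 2 := by
  have hmeas : Measurable fun p : Dom => ENNReal.ofReal (1 + p.2 ^ 2) := by fun_prop
  have hpos : ∀ p : Dom, (0 : ℝ) < 1 + p.2 ^ 2 := fun p => by positivity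
  have hac : (volume : Measure Dom) ≪ weightedMeasure :=
    withDensity_absolutelyContinuous' hmeas.aemeasurable
      (Eventually.of_forall fun p => by simpa using hpos p)
  have hf := Lp.memLp f
  have hfm : AEStronglyMeasurable f (volume : Measure Dom) := hf.1.mono_ac hac
  have hint : Integrable (fun p => f p ^ 2) weightedMeasure := hf.integrable_sq
  have hint' : Integrable (fun p : Dom => (1 + p.2 ^ 2) * f p ^ 2) volume := by
    have := (integrable_withDensity_iff_integrable_smul' hmeas
      (Eventually.of_forall fun p => ENNReal.ofReal_lt_top)).1 hint
    refine this.congr (Eventually.of_forall fun p => ?_)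
    simp [ENNReal.toReal_ofReal (hpos p).le]
  have h1 : Integrable (fun p : Dom => f p ^ 2) volume := by
    refine hint'.mono (hfm.pow 2) (Eventually.of_forall fun p => ?_)
    rw [Real.norm_of_nonneg (by positivity), Real.norm_of_nonneg (by positivity)]
    nlinarith [mul_nonneg (sq_nonneg p.2) (sq_nonneg (f p))]
  have hym : AEStronglyMeasurable (fun p : Dom => p.2 * f p) volume :=
    (measurable_snd.aestronglyMeasurable).mul hfm
  have h2 : Integrable (fun p : Dom => (p.2 * f p) ^ 2) volume := by
    refine hint'.mono (hym.pow 2) (Eventually.of_forall fun p => ?_)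
    rw [Real.norm_of_nonneg (by positivity), Real.norm_of_nonneg (by positivity)]
    nlinarith [sq_nonneg (f p)]
  refine ⟨(memLp_two_iff_integrable_sq hfm).2 h1, (memLp_two_iff_integrable_sq hym).2 h2, ?_⟩
  have hn : ‖f‖ ^ 2 = ∫ p, f p ^ 2 ∂weightedMeasure := by
    rw [← real_inner_self_eq_norm_sq, L2.inner_def]
    simp [pow_two]
  refine hn.trans ((integral_withDensity_eq_integral_toReal_smul hmeas
    (Eventually.of_forall fun p => ENNReal.ofReal_lt_top) fun p => f p ^ 2).trans ?_)
  rw [← integral_add h1 h2]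
  refine integral_congr_ae (Eventually.of_forall fun p => ?_)
  simp only [ENNReal.toReal_ofReal (hpos p).le, smul_eq_mul]
  ring

/-- The partial derivative in the periodic variable `x`. -/
def dx (φ : Dom → ℝ) (p : Dom) : ℝ := deriv (fun s : ℝ => φ (p.1 + (s : Torus), p.2)) 0

/-- The partial derivative in the variable `y`. -/
def dy (φ : Dom → ℝ) (p : Dom) : ℝ := deriv (fun s : ℝ => φ (p.1, p.2 + s)) 0

/-- The Laplacian `∂ₓₓ + ∂ᵧᵧ` of a smooth function. -/
def laplace (φ : Dom → ℝ) (p : Dom) : ℝ := dx (dx φ) p + dy (dy φ) p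

/-- Test functions: smooth functions with compact support on `𝕋 × ℝ` (smoothness is smoothness of
the `2π`-periodic lift to `ℝ × ℝ`). -/
def IsTest (φ : Dom → ℝ) : Prop :=
  ContDiff ℝ (⊤ : ℕ∞) (fun p : ℝ × ℝ => φ ((p.1 : Torus), p.2)) ∧ HasCompactSupport φ

/-- The average in `x`, that is, the zeroth Fourier coefficient in `x`. -/
def xMean (f : Dom → ℝ) (y : ℝ) : ℝ := (2 * Real.pi)⁻¹ * ∫ x : Torus, f (x, y)

/-- `ψ = Δ⁻¹ ω` on the nonzero `x`-frequencies: `ψ ∈ L²` has zero `x`-average for almost every `y`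
and `Δψ` is, in the sense of distributions, `ω` minus its `x`-average. The `x`-average of the
stream function, which `∂ₓ` annihilates, is normalised to be zero. -/
def IsStreamFunction (ψ : Lp ℝ 2 (volume : Measure Dom)) (ω : X) : Prop :=
  (∀ᵐ y : ℝ, ∫ x : Torus, ψ (x, y) = 0) ∧
    ∀ φ : Dom → ℝ, IsTest φ →
      ∫ p : Dom, ψ p * laplace φ p = ∫ p : Dom, (ω p - xMean ω p.2) * φ p

/-- The graph of `𝓛 = -y² ∂ₓ + 2 ∂ₓ Δ⁻¹ + ν Δ` as an unbounded operator on `X`, with its natural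
domain: `ω ∈ X` is in the domain when the distribution `-y² ∂ₓ ω + 2 ∂ₓ Δ⁻¹ ω + ν Δ ω` is
(represented by) an element `f` of `X`, and then `𝓛 ω = f`. -/
def LinearizedGraph (ν : ℝ) (ω f : X) : Prop :=
  ∃ ψ : Lp ℝ 2 (volume : Measure Dom), IsStreamFunction ψ ω ∧
    ∀ φ : Dom → ℝ, IsTest φ →
      ∫ p : Dom, f p * φ p =
        (∫ p : Dom, ω p * (p.2 ^ 2 * dx φ p)) - 2 * (∫ p : Dom, ψ p * dx φ p)
          + ν * ∫ p : Dom, ω p * laplace φ p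

/-- `S` is the semigroup `e^{𝓛 t}`: the infinitesimal generator of `S` is `𝓛`, with equality of
domains. -/
def IsLinearizedSemigroup (ν : ℝ) (S : C0Semigroup X) : Prop :=
  ∀ ω f : X, S.GeneratorGraph ω f ↔ LinearizedGraph ν ω f

/-- The rate `λ_ν = ν^{1/2} / (1 + |log ν|)`. -/
def rate (ν : ℝ) : ℝ := Real.sqrt ν / (1 + |Real.log ν|)

end Poiseuille

end

/-!
The semigroup exists by the Lumer–Phillips theorem, and its decay is inherited from that of the
implicit Euler scheme `(1 - 𝓛 / l)⁻ᵐ`, so that no regularity in time has to be discussed.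

*Generation.* By Fourier expansion in `x` (`mode`, `isWeakSecondDeriv_mode`) distributional equations
on `𝕋 × ℝ` become ordinary differential equations `u'' = (a + i q(y)) u - R` on the line. The energy
estimate for these in a weighted space (`weighted_resolvent`) does not see the imaginary potential `q`.
With the weight `1 + y²` it shows that `-y² ∂ₓ + ν Δ` is quasi-dissipative on `X`
(`inner_sub_nonlocal_le`); with the dual weight `(1 + y²)⁻¹` it shows that the adjoint resolvent
equation has no nontrivial solution (`eq_zero_of_orthogonal`), so that the resolvent is onto. The same
estimate with the dual weight and a duality argument give the stream function, and show that
`2 ∂ₓ Δ⁻¹` is bounded on `X` (`norm_toX_fluct_le`, `exists_stream`, `nonlocal`). Together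
these make `𝓛` quasi-m-dissipative (`isQuasiMDissipative_graph`); the general theory is
`C0Semigroup.IsQuasiMDissipative.exists_semigroup` and `C0Semigroup.eq_of_generatorGraph`.

*Decay.* The inviscid part of `𝓛` is `-∂ₓ A` with `A = y² + 2 (-Δ)⁻¹` symmetric. Hence, for each frequency
`k ≠ 0`, both `‖ω‖²` and `⟨A ω, ω⟩` are conserved up to dissipation, and their sum is equivalent to the
square of the norm of `X`, with constants `1` and `3`. Following the hypocoercivity method, the functional
`‖ω‖² + α ‖∂ᵧω‖² - 2β Im ⟨yω, ∂ᵧω⟩ + γ ⟨A ω, ω⟩` with `α ∼ √ν / k²`, `β ∼ 1 / k`, `γ ∼ 1 / √ν` (`hypo`)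
decays at the rate `√ν / 7`: the commutator of `∂ᵧ` with the transport term makes the cross term
produce `‖yω‖²`, which the dissipation alone does not control (`ModeRelations.hypo_step`). As the data have no
derivative in `y`, the functional is only used from the first step on at which the energy dissipation
provides one (`modeNorm_le`). This yields both `‖ω(t)‖² ≤ 3 ‖ω(0)‖²` and
`‖ω(t)‖² ≤ 15 ν^{-1/2} e^{-√ν t / 7} ‖ω(0)‖²`. The geometric mean of the two with exponent
`θ = 0.7 / (1 + |log ν|)` on the second turns `ν^{-1/2}` into a constant, and leaves the rate
`√ν θ / 14 = λ_ν / 20` for the norm (`norm_iterate_le`, `tendsto_decay_rate`).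
-/

/-! ### Semigroups generated by dissipative relations -/

namespace C0Semigroup

section Abstract

variable {H : Type*} [NormedAddCommGroup H] [InnerProductSpace ℝ H]

/-- The exponential `exp (l (J - 1))`, which for `J = (1 - L / l)⁻¹` is the semigroup generated by
the Yosida approximation `l (J - 1)` of `L`. -/
noncomputable def yosidaExp (J : H →L[ℝ] H) (l t : ℝ) : H →L[ℝ] H :=
  NormedSpace.exp (t • (l • (J - 1)))

theorem yosidaExp_eq [CompleteSpace H] (J : H →L[ℝ] H) (l t : ℝ) :
    yosidaExp J l t = Real.exp (-(t * l)) • NormedSpace.exp ((t * l) • J) := by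
  have h1 : t • (l • (J - 1)) = (t * l) • J + (-(t * l)) • (1 : H →L[ℝ] H) := by
    rw [smul_smul, smul_sub, neg_smul, sub_eq_add_neg]
  have hc : Commute ((t * l) • J) ((-(t * l)) • (1 : H →L[ℝ] H)) :=
    (Commute.one_right _).smul_right _
  let _ : NormedAlgebra ℚ (H →L[ℝ] H) := NormedAlgebra.restrictScalars ℚ ℝ _
  have h2 : NormedSpace.exp ((-(t * l)) • (1 : H →L[ℝ] H))
      = Real.exp (-(t * l)) • (1 : H →L[ℝ] H) := by
    rw [← Algebra.algebraMap_eq_smul_one, ← Algebra.algebraMap_eq_smul_one, Real.exp_eq_exp_ℝ]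
    exact (NormedSpace.algebraMap_exp_comm _).symm
  rw [yosidaExp, h1, NormedSpace.exp_add_of_commute hc, h2, mul_smul_comm, mul_one]

/-- Geometric decay of the powers of `J` along `v` gives exponential decay of
`exp (t l (J - 1)) v`. -/
theorem norm_yosidaExp_apply_le [CompleteSpace H] {J : H →L[ℝ] H} {l t M ρ : ℝ} (hl : 0 ≤ l) (ht : 0 ≤ t) {v : H}
    (h : ∀ m : ℕ, ‖(J ^ m) v‖ ≤ M * ρ ^ m) :
    ‖yosidaExp J l t v‖ ≤ M * Real.exp (t * (l * (ρ - 1))) := by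
  have hs : HasSum (fun n : ℕ => ((n.factorial : ℝ))⁻¹ • ((t * l) • J) ^ n)
      (NormedSpace.exp ((t * l) • J)) := by
    exact NormedSpace.exp_series_hasSum_exp' (𝕂 := ℝ) ((t * l) • J)
  have hs' : HasSum (fun n : ℕ => ((n.factorial : ℝ))⁻¹ • (t * l) ^ n • (J ^ n) v)
      (NormedSpace.exp ((t * l) • J) v) := by
    have := hs.mapL (ContinuousLinearMap.apply ℝ H v)
    refine this.congr_fun ?_
    intro n
    simp [smul_pow]
  have hr : HasSum (fun n : ℕ => M * (((n.factorial : ℝ))⁻¹ • (t * l * ρ) ^ n))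
      (M * Real.exp (t * l * ρ)) := by
    rw [Real.exp_eq_exp_ℝ]
    exact (NormedSpace.exp_series_hasSum_exp' (𝕂 := ℝ) (t * l * ρ)).mul_left M
  have hb : ‖NormedSpace.exp ((t * l) • J) v‖ ≤ M * Real.exp (t * l * ρ) := by
    refine hs'.norm_le_of_bounded hr fun n => ?_
    rw [norm_smul, norm_smul, Real.norm_of_nonneg (by positivity),
      Real.norm_of_nonneg (by positivity), smul_eq_mul]
    calc ((n.factorial : ℝ))⁻¹ * ((t * l) ^ n * ‖(J ^ n) v‖)
        ≤ ((n.factorial : ℝ))⁻¹ * ((t * l) ^ n * (M * ρ ^ n)) := by gcongr; exact h n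
      _ = _ := by rw [mul_pow]; ring
  rw [yosidaExp_eq, smul_apply, norm_smul, Real.norm_of_nonneg (by positivity)]
  calc _ ≤ Real.exp (-(t * l)) * (M * Real.exp (t * l * ρ)) := by gcongr
    _ = M * (Real.exp (-(t * l)) * Real.exp (t * l * ρ)) := by ring
    _ = _ := by rw [← Real.exp_add]; ring_nf

/-- Two Yosida approximations with commuting resolvents differ by at most the difference of
their generators. -/
theorem norm_yosidaExp_sub_le [CompleteSpace H] {J K : H →L[ℝ] H} {l m t C : ℝ} (hJK : Commute J K) (ht : 0 ≤ t)
    (hC : ∀ s, 0 ≤ s → s ≤ t → ∀ v, ‖yosidaExp J l s (yosidaExp K m (t - s) v)‖ ≤ C * ‖v‖)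
    (x : H) :
    ‖yosidaExp J l t x - yosidaExp K m t x‖ ≤
      C * ‖l • (J x - x) - m • (K x - x)‖ * t := by
  set A : H →L[ℝ] H := l • (J - 1) with hA
  set B : H →L[ℝ] H := m • (K - 1) with hB
  have hAB : Commute A B := by
    refine ((Commute.sub_left ?_ ?_).smul_left _).smul_right _
    · exact hJK.sub_right (Commute.one_right _)
    · exact Commute.one_left _
  set F : ℝ → H →L[ℝ] H := fun s => NormedSpace.exp (s • A) * NormedSpace.exp ((t - s) • B) with hF
  have hder : ∀ s, HasDerivAt F (F s * (A - B)) s := fun s => by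
    have h1 := hasDerivAt_exp_smul_const (𝕂 := ℝ) A s
    have h2 : HasDerivAt (fun s : ℝ => NormedSpace.exp ((t - s) • B))
        (-(NormedSpace.exp ((t - s) • B) * B)) s := by
      have := (hasDerivAt_exp_smul_const (𝕂 := ℝ) B (t - s)).scomp s
        ((hasDerivAt_id s).const_sub t)
      simpa [Function.comp_def] using this
    have h3 := h1.mul h2
    refine h3.congr_deriv ?_
    have hc : Commute A (NormedSpace.exp ((t - s) • B)) := (hAB.smul_right _).exp_right
    simp only [hF]
    rw [mul_sub, mul_assoc, mul_assoc, mul_assoc, hc.eq, mul_neg]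
    abel
  have hder' : ∀ s ∈ Set.Icc 0 t, HasDerivWithinAt (fun s => F s x) (F s ((A - B) x))
      (Set.Icc 0 t) s := fun s _ => by
    have := (hder s).clm_apply (hasDerivAt_const s x)
    simpa using this.hasDerivWithinAt
  have hb := norm_image_sub_le_of_norm_deriv_le_segment' (C := C * ‖(A - B) x‖) hder'
    (fun s hs => hC s hs.1 hs.2.le _) t ⟨ht, le_rfl⟩
  simpa [hF, hA, hB, yosidaExp] using hb

theorem yosidaExp_add [CompleteSpace H] (J : H →L[ℝ] H) (l s t : ℝ) (x : H) :
    yosidaExp J l (s + t) x = yosidaExp J l s (yosidaExp J l t x) := by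
  let _ : NormedAlgebra ℚ (H →L[ℝ] H) := NormedAlgebra.restrictScalars ℚ ℝ _
  rw [yosidaExp, add_smul, NormedSpace.exp_add_of_commute
    (((Commute.refl _).smul_left _).smul_right _)]
  rfl

theorem yosidaExp_zero (J : H →L[ℝ] H) (l : ℝ) : yosidaExp J l 0 = 1 := by
  simp [yosidaExp]

theorem tendsto_yosidaExp_slope [CompleteSpace H] (J : H →L[ℝ] H) (l : ℝ) (x : H) :
    Tendsto (fun h : ℝ => h⁻¹ • (yosidaExp J l h x - x)) (𝓝[>] 0) (𝓝 (l • (J x - x))) := by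
  have h1 := (hasDerivAt_exp_smul_const (𝕂 := ℝ) (l • (J - 1)) 0).clm_apply (hasDerivAt_const 0 x)
  have h2 := h1.hasDerivWithinAt (s := Set.Ioi 0)
  rw [hasDerivWithinAt_iff_tendsto_slope' (by simp)] at h2
  simpa [slope_fun_def, yosidaExp] using h2

/-- The hypotheses of the Lumer–Phillips theorem for a linear relation `G`: quasi-dissipativity,
the range condition for all large `l`, and density of the domain. -/
structure IsQuasiMDissipative (G : Submodule ℝ (H × H)) (β : ℝ) : Prop where
  nonneg : 0 ≤ β
  inner_le : ∀ p ∈ G, inner ℝ p.2 p.1 ≤ β * ‖p.1‖ ^ 2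
  range : ∀ l > β, ∀ v : H, ∃ p ∈ G, l • p.1 - p.2 = v
  dense : Dense {x : H | ∃ f, (x, f) ∈ G}

namespace IsQuasiMDissipative

variable {G : Submodule ℝ (H × H)} {β : ℝ} (hG : IsQuasiMDissipative G β)

include hG

theorem norm_le {l : ℝ} {p : H × H} (hp : p ∈ G) :
    (l - β) * ‖p.1‖ ≤ ‖l • p.1 - p.2‖ := by
  have h1 := hG.inner_le p hp
  have h2 : inner ℝ (l • p.1 - p.2) p.1 = l * ‖p.1‖ ^ 2 - inner ℝ p.2 p.1 := by
    rw [inner_sub_left, inner_smul_left, real_inner_self_eq_norm_sq]; simp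
  have h3 := real_inner_le_norm (l • p.1 - p.2) p.1
  rcases eq_or_lt_of_le (norm_nonneg p.1) with h | h
  · rw [← h]; simp
  · refine le_of_mul_le_mul_right ?_ h
    nlinarith

theorem unique {l : ℝ} (hl : β < l) {p q : H × H} (hp : p ∈ G) (hq : q ∈ G)
    (h : l • p.1 - p.2 = l • q.1 - q.2) : p.1 = q.1 := by
  have := hG.norm_le (l := l) (G.sub_mem hp hq)
  have h0 : l • (p - q).1 - (p - q).2 = 0 := by
    simp only [Prod.fst_sub, Prod.snd_sub, smul_sub]
    rw [sub_sub_sub_comm, h, sub_self]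
  rw [h0, norm_zero] at this
  have h3 : ‖(p - q).1‖ ≤ 0 := by
    by_contra hc
    push Not at hc
    nlinarith [mul_pos (sub_pos.2 hl) hc]
  have := norm_le_zero_iff.1 h3
  simpa [sub_eq_zero] using this

/-- For `l > β` the operator `J = l (l - L)⁻¹ = (1 - L / l)⁻¹` exists. -/
theorem exists_resolvent {l : ℝ} (hl : β < l) :
    ∃ J : H →L[ℝ] H, ‖J‖ ≤ l / (l - β) ∧ (∀ v, (J v, l • (J v - v)) ∈ G) ∧
      ∀ x f, (x, f) ∈ G → l • (J x - x) = J f := by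
  have hl0 : 0 < l := lt_of_le_of_lt hG.nonneg hl
  choose p hp hpv using fun v : H => hG.range l hl (l • v)
  have key : ∀ v, ∀ q ∈ G, l • q.1 - q.2 = l • v → (p v).1 = q.1 := fun v q hq h =>
    hG.unique hl (hp v) hq ((hpv v).trans h.symm)
  let J0 : H →ₗ[ℝ] H :=
    { toFun := fun v => (p v).1
      map_add' := fun v w => by
        refine key _ (p v + p w) (G.add_mem (hp v) (hp w)) ?_
        have := congrArg₂ (· + ·) (hpv v) (hpv w)
        rw [smul_add, ← this]
        simp only [Prod.fst_add, Prod.snd_add, smul_add]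
        abel
      map_smul' := fun c v => by
        refine key _ (c • p v) (G.smul_mem c (hp v)) ?_
        have := congrArg (fun z => c • z) (hpv v)
        rw [smul_comm l c v, ← this]
        simp only [Prod.smul_fst, Prod.smul_snd, smul_sub]
        rw [smul_comm l c] }
  have hbd : ∀ v, ‖J0 v‖ ≤ l / (l - β) * ‖v‖ := fun v => by
    have := hG.norm_le (l := l) (hp v)
    rw [hpv v, norm_smul, Real.norm_of_nonneg hl0.le] at this
    rw [div_mul_eq_mul_div, le_div_iff₀ (sub_pos.2 hl), mul_comm]
    exact this
  have hJ : ∀ v, (J0 v, l • (J0 v - v)) ∈ G := fun v => by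
    have h2 : (p v).2 = l • ((p v).1 - v) := by
      rw [smul_sub, ← hpv v]; abel
    have := hp v
    rw [← Prod.mk.eta (p := p v), h2] at this
    exact this
  refine ⟨J0.mkContinuous _ hbd, LinearMap.mkContinuous_norm_le _
    (div_nonneg hl0.le (sub_pos.2 hl).le) _, hJ, fun x f hxf => ?_⟩
  have h1 : J0 (x - l⁻¹ • f) = x := by
    refine key _ (x, f) hxf ?_
    simp [smul_sub, smul_smul, hl0.ne']
  have h2 : l • (J0 x - x) = J0 f := by
    rw [map_sub, map_smul] at h1
    have : J0 x - x = l⁻¹ • J0 f := by rw [sub_eq_iff_eq_add, ← sub_eq_iff_eq_add', h1]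
    rw [this, smul_smul, mul_inv_cancel₀ hl0.ne', one_smul]
  exact h2

/-- Resolvents commute, because `K` maps the graph of `L` to itself. -/
theorem commute_resolvent {l m : ℝ} (hl : β < l) {J K : H →L[ℝ] H}
    (hJ : ∀ v, (J v, l • (J v - v)) ∈ G) (hK : ∀ v, (K v, m • (K v - v)) ∈ G)
    (hK' : ∀ x f, (x, f) ∈ G → m • (K x - x) = K f) : Commute J K := by
  ext v
  have h1 : (K (J v), K (l • (J v - v))) ∈ G := by
    rw [← hK' _ _ (hJ v)]; exact hK _
  have := hG.unique hl h1 (hJ (K v)) (by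
    simp only [map_smul, map_sub, smul_sub]
    abel)
  exact this.symm

/-- `(1 - L / l)⁻¹ → 1` strongly as `l → ∞`: on the domain the rate is `‖J L x‖ / l`, and the domain
is dense. -/
theorem tendsto_resolvent {J : ℕ → H →L[ℝ] H} {l : ℕ → ℝ} (hl : Tendsto l atTop atTop)
    (hJb : ∀ n, ‖J n‖ ≤ 2) (hJ : ∀ n x f, (x, f) ∈ G → l n • (J n x - x) = J n f) (x : H) :
    Tendsto (fun n => J n x) atTop (𝓝 x) := by
  have hdom : ∀ y f, (y, f) ∈ G → Tendsto (fun n => J n y) atTop (𝓝 y) := fun y f hy => by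
    rw [tendsto_iff_norm_sub_tendsto_zero]
    have h0 : Tendsto (fun n => (l n)⁻¹ * (2 * ‖f‖)) atTop (𝓝 0) := by
      simpa using hl.inv_tendsto_atTop.mul_const (2 * ‖f‖)
    refine tendsto_of_tendsto_of_tendsto_of_le_of_le' tendsto_const_nhds h0
      (Eventually.of_forall fun n => norm_nonneg _) ?_
    filter_upwards [hl.eventually_gt_atTop 0] with n hn
    have h1 : J n y - y = (l n)⁻¹ • J n f := by
      rw [← hJ n y f hy, smul_smul, inv_mul_cancel₀ hn.ne', one_smul]
    rw [h1, norm_smul, Real.norm_of_nonneg (inv_nonneg.2 hn.le)]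
    gcongr
    exact (J n).le_of_opNorm_le (hJb n) f
  rw [Metric.tendsto_atTop]
  intro ε hε
  obtain ⟨y, ⟨f, hy⟩, hxy⟩ := Metric.mem_closure_iff.1 (hG.dense x) (ε / 6) (by positivity)
  obtain ⟨N, hN⟩ := Metric.tendsto_atTop.1 (hdom y f hy) (ε / 3) (by positivity)
  refine ⟨N, fun n hn => ?_⟩
  have h1 : dist (J n x) (J n y) ≤ 2 * dist x y := by
    rw [dist_eq_norm, dist_eq_norm, ← map_sub]
    exact (J n).le_of_opNorm_le (hJb n) _
  have h2 := hN n hn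
  have h3 := dist_triangle4 (J n x) (J n y) y x
  rw [dist_comm y x] at h3
  linarith

/-- The semigroup generated by a quasi-m-dissipative relation, as the limit of the semigroups of
the Yosida approximations. -/
theorem exists_yosida_limit [CompleteSpace H] : ∃ (l : ℕ → ℝ) (J : ℕ → H →L[ℝ] H)
    (S : ℝ → H →L[ℝ] H), Tendsto l atTop atTop ∧ (∀ n, 0 < l n) ∧
    (∀ n v, (J n v, l n • (J n v - v)) ∈ G) ∧
    (∀ t, 0 ≤ t → ∀ x, Tendsto (fun n => yosidaExp (J n) (l n) t x) atTop (𝓝 (S t x))) ∧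
    (∀ t, 0 ≤ t → ∀ n x, ‖yosidaExp (J n) (l n) t x‖ ≤ Real.exp (2 * β * t) * ‖x‖) ∧
    (∀ x f, (x, f) ∈ G → Tendsto (fun n => l n • (J n x - x)) atTop (𝓝 f)) ∧
    ∀ x f, (x, f) ∈ G → ∀ t, 0 ≤ t → ∀ n,
      ‖yosidaExp (J n) (l n) t x - S t x‖ ≤
        Real.exp (2 * β * t) * ‖l n • (J n x - x) - f‖ * t := by
  have hβ := hG.nonneg
  set l : ℕ → ℝ := fun n => n + (2 * β + 1) with hl
  have hlt : Tendsto l atTop atTop := tendsto_atTop_add_const_right _ _ tendsto_natCast_atTop_atTop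
  have hl2 : ∀ n, 2 * β + 1 ≤ l n := fun n => by simp [hl]
  have hlβ : ∀ n, β < l n := fun n => by linarith [hl2 n]
  have hl0 : ∀ n, 0 < l n := fun n => by linarith [hl2 n]
  choose J hJb hJG hJ using fun n => hG.exists_resolvent (hlβ n)
  have hJ2 : ∀ n, ‖J n‖ ≤ 2 := fun n => (hJb n).trans <| by
    rw [div_le_iff₀ (sub_pos.2 (hlβ n))]
    linarith [hl2 n]
  have hexp : ∀ t, 0 ≤ t → ∀ n x, ‖yosidaExp (J n) (l n) t x‖ ≤ Real.exp (2 * β * t) * ‖x‖ := by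
    intro t ht n x
    have h1 : ‖yosidaExp (J n) (l n) t x‖ ≤
        ‖x‖ * Real.exp (t * (l n * (l n / (l n - β) - 1))) := by
      refine norm_yosidaExp_apply_le (hl0 n).le ht fun m => ?_
      calc ‖(J n ^ m) x‖ ≤ ‖J n ^ m‖ * ‖x‖ := ContinuousLinearMap.le_opNorm _ _
        _ ≤ ‖J n‖ ^ m * ‖x‖ := by
            gcongr
            rcases Nat.eq_zero_or_pos m with rfl | hm
            · rw [pow_zero, pow_zero]; exact ContinuousLinearMap.norm_id_le
            · exact norm_pow_le' _ hm
        _ ≤ (l n / (l n - β)) ^ m * ‖x‖ := by gcongr; exact hJb n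
        _ = _ := mul_comm _ _
    rw [mul_comm] at h1
    have hpos := sub_pos.2 (hlβ n)
    have h2 : l n * (l n / (l n - β) - 1) ≤ 2 * β := by
      rw [div_sub_one hpos.ne', ← mul_div_assoc, div_le_iff₀ hpos]
      nlinarith [hl2 n]
    refine h1.trans (mul_le_mul_of_nonneg_right (Real.exp_le_exp.2 ?_) (norm_nonneg _))
    rw [mul_comm (2 * β)]
    exact mul_le_mul_of_nonneg_left h2 ht
  have hJlim := fun x => hG.tendsto_resolvent hlt hJ2 hJ x
  have hA : ∀ x f, (x, f) ∈ G → Tendsto (fun n => l n • (J n x - x)) atTop (𝓝 f) :=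
    fun x f hx => by
      simp_rw [hJ _ x f hx]; exact hJlim f
  have hdiff : ∀ t, 0 ≤ t → ∀ n m x, ‖yosidaExp (J n) (l n) t x - yosidaExp (J m) (l m) t x‖ ≤
      Real.exp (2 * β * t) * ‖l n • (J n x - x) - l m • (J m x - x)‖ * t := by
    intro t ht n m x
    refine norm_yosidaExp_sub_le (hG.commute_resolvent (hlβ n) (hJG n) (hJG m) (hJ m)) ht ?_ x
    intro s hs hst v
    calc _ ≤ Real.exp (2 * β * s) * (Real.exp (2 * β * (t - s)) * ‖v‖) :=
          (hexp s hs n _).trans (by gcongr; exact hexp _ (by linarith) m v)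
      _ = Real.exp (2 * β * t) * ‖v‖ := by
          rw [← mul_assoc, ← Real.exp_add]; ring_nf
  have hcau : ∀ t, 0 ≤ t → ∀ x, CauchySeq fun n => yosidaExp (J n) (l n) t x := by
    intro t ht x
    rw [Metric.cauchySeq_iff']
    intro ε hε
    have hE := Real.exp_pos (2 * β * t)
    obtain ⟨y, ⟨f, hy⟩, hxy⟩ := Metric.mem_closure_iff.1 (hG.dense x)
      (ε / 3 / Real.exp (2 * β * t)) (by positivity)
    have h1 : CauchySeq fun n => l n • (J n y - y) := (hA y f hy).cauchySeq
    obtain ⟨N, hN⟩ := Metric.cauchySeq_iff'.1 h1 (ε / 3 / (Real.exp (2 * β * t) * (t + 1)))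
      (by positivity)
    refine ⟨N, fun n hn => ?_⟩
    have h2 : ∀ n, dist (yosidaExp (J n) (l n) t x) (yosidaExp (J n) (l n) t y) < ε / 3 := by
      intro n
      rw [dist_eq_norm, ← map_sub]
      refine (hexp t ht n _).trans_lt ?_
      rw [← dist_eq_norm, mul_comm]
      exact (lt_div_iff₀ hE).1 hxy
    have h3 : dist (yosidaExp (J n) (l n) t y) (yosidaExp (J N) (l N) t y) < ε / 3 := by
      rw [dist_eq_norm]
      refine (hdiff t ht n N y).trans_lt ?_
      have := hN n hn
      rw [dist_eq_norm, lt_div_iff₀ (by positivity)] at this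
      refine lt_of_le_of_lt ?_ this
      rw [mul_comm (Real.exp _), mul_assoc]
      gcongr
      linarith
    have h4 := dist_triangle4 (yosidaExp (J n) (l n) t x) (yosidaExp (J n) (l n) t y)
      (yosidaExp (J N) (l N) t y) (yosidaExp (J N) (l N) t x)
    have h5 := h2 N
    rw [dist_comm] at h5
    linarith [h2 n]
  have hlim : ∀ t : ℝ, ∃ S : H →L[ℝ] H, 0 ≤ t → ∀ x,
      Tendsto (fun n => yosidaExp (J n) (l n) t x) atTop (𝓝 (S x)) := by
    intro t
    by_cases ht : 0 ≤ t
    · choose g hg using fun x => cauchySeq_tendsto_of_complete (hcau t ht x)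
      exact ⟨continuousLinearMapOfTendsto _ (tendsto_pi_nhds.2 hg), fun _ => hg⟩
    · exact ⟨0, fun h => absurd h ht⟩
  choose S hS using hlim
  refine ⟨l, J, S, hlt, hl0, hJG, hS, hexp, hA, fun x f hx t ht n => ?_⟩
  have h1 : Tendsto (fun m => ‖yosidaExp (J n) (l n) t x - yosidaExp (J m) (l m) t x‖) atTop
      (𝓝 ‖yosidaExp (J n) (l n) t x - S t x‖) := ((hS t ht x).const_sub _).norm
  have h2 : Tendsto (fun m => Real.exp (2 * β * t) * ‖l n • (J n x - x) - l m • (J m x - x)‖ * t)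
      atTop (𝓝 (Real.exp (2 * β * t) * ‖l n • (J n x - x) - f‖ * t)) :=
    ((((hA x f hx).const_sub _).norm).const_mul _).mul_const _
  exact le_of_tendsto_of_tendsto' h1 h2 fun m => hdiff t ht n m x

/-- **Lumer–Phillips**: a quasi-m-dissipative relation generates a semigroup. Geometric decay of
the implicit Euler iterates `(1 - L / l)⁻ᵐ v` is inherited by the semigroup. -/
theorem exists_semigroup [CompleteSpace H] : ∃ S : C0Semigroup H,
    (∀ x f, S.GeneratorGraph x f ↔ (x, f) ∈ G) ∧
    ∀ (v : H) (M c : ℝ) (ρ : ℝ → ℝ), Tendsto (fun l => l * (ρ l - 1)) atTop (𝓝 (-c)) →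
      (∀ᶠ l in atTop, ∀ x : ℕ → H, x 0 = v → (∀ m, (x (m + 1), l • (x (m + 1) - x m)) ∈ G) →
        ∀ m, ‖x m‖ ≤ M * ρ l ^ m) →
      ∀ t : ℝ≥0, ‖S.op t v‖ ≤ M * Real.exp (-c * t) := by
  have hβ := hG.nonneg
  obtain ⟨l, J, S, hlt, hl0, hJG, hS, hexp, hA, hdiff⟩ := hG.exists_yosida_limit
  have hSb : ∀ t, 0 ≤ t → ∀ x, ‖S t x‖ ≤ Real.exp (2 * β * t) * ‖x‖ := fun t ht x =>
    le_of_tendsto (hS t ht x).norm (Eventually.of_forall fun n => hexp t ht n x)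
  have hcoe : Tendsto (fun h : ℝ≥0 => (h : ℝ)) (𝓝[>] 0) (𝓝[>] 0) := by
    refine tendsto_nhdsWithin_iff.2 ⟨?_, ?_⟩
    · exact (NNReal.continuous_coe.tendsto' 0 0 NNReal.coe_zero).mono_left nhdsWithin_le_nhds
    · filter_upwards [self_mem_nhdsWithin] with h hh using NNReal.coe_pos.2 hh
  have hgen : ∀ x f, (x, f) ∈ G →
      Tendsto (fun h : ℝ => h⁻¹ • (S h x - x)) (𝓝[>] 0) (𝓝 f) := by
    intro x f hx
    rw [Metric.tendsto_nhds]
    intro ε hε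
    have hE := Real.exp_pos (2 * β)
    obtain ⟨n, hn⟩ := ((Metric.tendsto_nhds.1 (hA x f hx)) (ε / 2 / (Real.exp (2 * β) + 1))
      (by positivity)).exists
    have h1 := (Metric.tendsto_nhds.1 (tendsto_yosidaExp_slope (J n) (l n) x)) (ε / 2)
      (by positivity)
    filter_upwards [h1, Ioc_mem_nhdsGT (zero_lt_one' ℝ)] with h hh hh1
    have h2 := hdiff x f hx h hh1.1.le n
    rw [dist_eq_norm, lt_div_iff₀ (by positivity)] at hn
    rw [dist_eq_norm] at hh
    have h3 : ‖h⁻¹ • (yosidaExp (J n) (l n) h x - S h x)‖ ≤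
        Real.exp (2 * β) * ‖l n • (J n x - x) - f‖ := by
      rw [norm_smul, Real.norm_of_nonneg (inv_nonneg.2 hh1.1.le), inv_mul_le_iff₀ hh1.1, mul_comm h]
      refine h2.trans ?_
      have := hh1.1.le
      have hE1 : Real.exp (2 * β * h) ≤ Real.exp (2 * β) :=
        Real.exp_le_exp.2 (by nlinarith [hh1.2])
      gcongr
    have h4 : h⁻¹ • (S h x - x) - f = (h⁻¹ • (yosidaExp (J n) (l n) h x - x)
        - l n • (J n x - x)) - h⁻¹ • (yosidaExp (J n) (l n) h x - S h x)
        + (l n • (J n x - x) - f) := by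
      simp only [smul_sub]; abel
    rw [dist_eq_norm, h4]
    refine (norm_add_le _ _).trans_lt ?_
    have h5 := norm_sub_le (h⁻¹ • (yosidaExp (J n) (l n) h x - x)
        - l n • (J n x - x)) (h⁻¹ • (yosidaExp (J n) (l n) h x - S h x))
    linarith
  have hcont : ∀ x, Tendsto (fun h : ℝ => S h x) (𝓝[≥] 0) (𝓝 x) := by
    have h0 : ∀ x, S 0 x = x := fun x => by
      refine tendsto_nhds_unique (hS 0 le_rfl x) ?_
      simp [yosidaExp_zero]
    have hdom : ∀ x f, (x, f) ∈ G → Tendsto (fun h : ℝ => S h x) (𝓝[>] 0) (𝓝 x) := by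
      intro x f hx
      have h1 : Tendsto (fun h : ℝ => h • (h⁻¹ • (S h x - x)) + x) (𝓝[>] 0) (𝓝 ((0 : ℝ) • f + x)) :=
        (((tendsto_id.mono_left nhdsWithin_le_nhds : Tendsto (fun h : ℝ => h) (𝓝[>] 0) (𝓝 0))).smul
          (hgen x f hx)).add_const x
      rw [zero_smul, zero_add] at h1
      refine h1.congr' ?_
      filter_upwards [self_mem_nhdsWithin] with h hh
      rw [smul_smul, mul_inv_cancel₀ (ne_of_gt hh), one_smul, sub_add_cancel]
    have hdom' : ∀ x f, (x, f) ∈ G → Tendsto (fun h : ℝ => S h x) (𝓝[≥] 0) (𝓝 x) := by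
      intro x f hx
      rw [← Set.Ioi_insert, nhdsWithin_insert, tendsto_sup]
      refine ⟨?_, hdom x f hx⟩
      have := pure_le_nhds (S 0 x)
      rw [h0] at this
      exact (tendsto_pure_pure (fun h : ℝ => S h x) 0).mono_right (by rw [h0]; exact this)
    intro x
    rw [Metric.tendsto_nhds]
    intro ε hε
    have hE := Real.exp_pos (2 * β)
    obtain ⟨y, ⟨f, hy⟩, hxy⟩ := Metric.mem_closure_iff.1 (hG.dense x)
      (ε / 2 / (Real.exp (2 * β) + 1)) (by positivity)
    have h1 := Metric.tendsto_nhds.1 (hdom' y f hy) (ε / 2) (by positivity)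
    filter_upwards [h1, Icc_mem_nhdsGE (zero_lt_one' ℝ)] with h hh hh1
    have h2 : dist (S h x) (S h y) ≤ Real.exp (2 * β) * dist x y := by
      rw [dist_eq_norm, dist_eq_norm, ← map_sub]
      have hE1 : Real.exp (2 * β * h) ≤ Real.exp (2 * β) :=
        Real.exp_le_exp.2 (by nlinarith [hh1.2])
      refine (hSb h hh1.1 _).trans ?_
      gcongr
    have h3 := dist_triangle4 (S h x) (S h y) y x
    rw [dist_comm y x] at h3
    rw [lt_div_iff₀ (by positivity)] at hxy
    linarith
  let T : C0Semigroup H :=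
    { op := fun t => S t
      op_zero := by
        ext x
        refine tendsto_nhds_unique (hS 0 le_rfl x) ?_
        simp [yosidaExp_zero]
      op_add := fun s t => by
        ext x
        refine tendsto_nhds_unique (hS _ (by positivity) x) ?_
        have h1 : Tendsto (fun n => yosidaExp (J n) (l n) s (S t x)) atTop (𝓝 (S s (S t x))) :=
          hS s s.2 _
        have h2 : Tendsto (fun n => yosidaExp (J n) (l n) s
            (yosidaExp (J n) (l n) t x - S t x)) atTop (𝓝 0) := by
          have h3 : Tendsto (fun n => Real.exp (2 * β * s) *
              ‖yosidaExp (J n) (l n) t x - S t x‖) atTop (𝓝 (Real.exp (2 * β * s) * 0)) :=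
            (tendsto_iff_norm_sub_tendsto_zero.1 (hS t t.2 x)).const_mul _
          rw [mul_zero] at h3
          exact squeeze_zero_norm (fun n => hexp s s.2 n _) h3
        have h4 := h2.add h1
        rw [zero_add] at h4
        refine h4.congr fun n => ?_
        rw [map_sub, sub_add_cancel, NNReal.coe_add, yosidaExp_add]
      tendsto_op := fun x => by
        refine (hcont x).comp (tendsto_nhdsWithin_iff.2 ⟨?_, Eventually.of_forall fun h => h.2⟩)
        exact NNReal.continuous_coe.tendsto' 0 0 NNReal.coe_zero }
  have hGT : ∀ x f, (x, f) ∈ G → T.GeneratorGraph x f := fun x f hx => (hgen x f hx).comp hcoe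
  refine ⟨T, fun x f => ⟨fun hx => ?_, hGT x f⟩, ?_⟩
  -- The generator is no larger than `G`: it is quasi-dissipative, so `2 β + 1` minus the generator is
  -- injective, while `2 β + 1` minus `G` is already onto.
  · obtain ⟨p, hp, hpv⟩ := hG.range (2 * β + 1) (by linarith) ((2 * β + 1) • x - f)
    have hz : T.GeneratorGraph (x - p.1) (f - p.2) := by
      have := Tendsto.sub hx (hGT p.1 p.2 hp)
      refine this.congr fun h => ?_
      rw [← smul_sub, map_sub]; congr 1; abel
    have hz2 : f - p.2 = (2 * β + 1) • (x - p.1) := by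
      rw [smul_sub, sub_eq_sub_iff_add_eq_add, ← sub_eq_zero]
      rw [← sub_eq_zero] at hpv
      rw [← hpv]; abel
    rw [hz2] at hz
    set z := x - p.1
    have h1 : Tendsto (fun h : ℝ≥0 => inner ℝ ((h : ℝ)⁻¹ • (T.op h z - z)) z) (𝓝[>] 0)
        (𝓝 (inner ℝ ((2 * β + 1) • z) z)) := Tendsto.inner hz tendsto_const_nhds
    have h2 : Tendsto (fun h : ℝ≥0 => 2 * β * Real.exp (2 * β * h) * ‖z‖ ^ 2) (𝓝[>] 0)
        (𝓝 (2 * β * Real.exp (2 * β * 0) * ‖z‖ ^ 2)) := by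
      have h3 : Continuous fun h : ℝ => 2 * β * Real.exp (2 * β * h) * ‖z‖ ^ 2 := by fun_prop
      exact (h3.tendsto 0).comp (hcoe.mono_right nhdsWithin_le_nhds)
    have h3 := le_of_tendsto_of_tendsto h1 h2 (by
      filter_upwards [self_mem_nhdsWithin] with h hh
      have hh' : (0 : ℝ) < h := NNReal.coe_pos.2 hh
      rw [inner_smul_left, inner_sub_left, real_inner_self_eq_norm_sq]
      simp only [conj_trivial]
      rw [inv_mul_le_iff₀ hh']
      have h4 := real_inner_le_norm (T.op h z) z
      have h5 : ‖T.op h z‖ ≤ Real.exp (2 * β * h) * ‖z‖ := hSb h h.2 z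
      have h6 := Real.add_one_le_exp (-(2 * β * h))
      have h7 : Real.exp (2 * β * h) * Real.exp (-(2 * β * h)) = 1 := by
        rw [← Real.exp_add]; simp
      have h8 := mul_le_mul_of_nonneg_left h6 (Real.exp_pos (2 * β * h)).le
      have h9 : inner ℝ (T.op h z) z ≤ Real.exp (2 * β * h) * ‖z‖ ^ 2 := by
        nlinarith [norm_nonneg z]
      have h10 : Real.exp (2 * β * h) - 1 ≤ h * (2 * β * Real.exp (2 * β * h)) := by linarith
      nlinarith [sq_nonneg ‖z‖, mul_le_mul_of_nonneg_right h10 (sq_nonneg ‖z‖)])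
    rw [inner_smul_left, real_inner_self_eq_norm_sq] at h3
    simp only [conj_trivial, mul_zero, Real.exp_zero, mul_one] at h3
    have h4 : ‖z‖ ^ 2 ≤ 0 := by linarith
    have h5 : z = 0 := by
      rw [← norm_eq_zero]; nlinarith [norm_nonneg z]
    have h6 : x = p.1 := sub_eq_zero.1 h5
    have h7 : f = p.2 := by rw [h5, smul_zero] at hz2; exact sub_eq_zero.1 hz2
    rw [h6, h7]; exact hp
  · intro v M c ρ hρ hev t
    have h1 : Tendsto (fun n => M * Real.exp (t * (l n * (ρ (l n) - 1)))) atTop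
        (𝓝 (M * Real.exp (t * -c))) :=
      ((Real.continuous_exp.tendsto _).comp ((hρ.comp hlt).const_mul (t : ℝ))).const_mul M
    rw [mul_comm (t : ℝ)] at h1
    refine le_of_tendsto_of_tendsto (hS t t.2 v).norm h1 ?_
    filter_upwards [hlt.eventually hev] with n hn
    refine norm_yosidaExp_apply_le (hl0 n).le t.2 fun m => ?_
    refine hn (fun m => (J n ^ m) v) (by simp) (fun m => ?_) m
    simp only [pow_succ']
    exact hJG n _

end IsQuasiMDissipative

/-! ### Uniqueness of the semigroup with a given generator -/

/-- Operators of a `C₀`-semigroup are bounded uniformly for small times. -/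
theorem exists_bound [CompleteSpace H] (S : C0Semigroup H) :
    ∃ δ > (0 : ℝ≥0), ∃ M : ℝ, ∀ t ≤ δ, ‖S.op t‖ ≤ M := by
  by_contra! hc
  have h1 : ∀ n : ℕ, ∃ t ≤ ((n : ℝ≥0) + 1)⁻¹, (n : ℝ) < ‖S.op t‖ := fun n =>
    hc _ (by positivity) n
  choose t ht hn using h1
  have ht0 : Tendsto t atTop (𝓝 0) := by
    rw [← NNReal.tendsto_coe]
    refine tendsto_of_tendsto_of_tendsto_of_le_of_le tendsto_const_nhds
      tendsto_one_div_add_atTop_nhds_zero_nat (fun n => (t n).2) (fun n => ?_)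
    simpa using NNReal.coe_le_coe.2 (ht n)
  obtain ⟨C, hC⟩ := banach_steinhaus (g := fun n => S.op (t n)) fun x => by
    obtain ⟨C, hC⟩ := ((S.tendsto_op x).comp ht0).norm.bddAbove_range
    exact ⟨C, fun n => hC ⟨n, rfl⟩⟩
  obtain ⟨n, hn'⟩ := exists_nat_gt C
  exact absurd (hC n) (not_le.2 (hn'.trans (hn n)))

/-- The group law extends the local bound to compact time intervals. -/
theorem exists_bound_Icc [CompleteSpace H] (S : C0Semigroup H) (T : ℝ≥0) :
    ∃ M : ℝ, ∀ t ≤ T, ‖S.op t‖ ≤ M := by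
  obtain ⟨δ, hδ, M, hM⟩ := S.exists_bound
  have h1 : ∀ n : ℕ, ∃ M' : ℝ, ∀ t ≤ n * δ, ‖S.op t‖ ≤ M' := by
    intro n
    induction n with
    | zero => exact ⟨M, fun t ht => hM t (ht.trans (by simp))⟩
    | succ n ih =>
      obtain ⟨M', hM'⟩ := ih
      refine ⟨max M' (M * M'), fun t ht => ?_⟩
      rcases le_total t (n * δ) with h | h
      · exact (hM' t h).trans (le_max_left _ _)
      · obtain ⟨s, rfl⟩ := exists_add_of_le h
        have hs : s ≤ δ := by
          rw [Nat.cast_add, Nat.cast_one, add_mul, one_mul] at ht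
          exact le_of_add_le_add_left ht
        rw [add_comm, S.op_add]
        refine (ContinuousLinearMap.opNorm_comp_le _ _).trans (le_trans ?_ (le_max_right _ _))
        exact mul_le_mul (hM s hs) (hM' _ le_rfl) (norm_nonneg _)
          ((norm_nonneg _).trans (hM s hs))
  obtain ⟨n, hn⟩ := exists_nat_ge (T / δ)
  obtain ⟨M', hM'⟩ := h1 n
  exact ⟨M', fun t ht => hM' t (ht.trans ((div_le_iff₀ hδ).1 hn))⟩

theorem continuous_op_apply [CompleteSpace H] (S : C0Semigroup H) (x : H) :
    Continuous fun t => S.op t x := by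
  rw [continuous_iff_continuousAt]
  intro t
  obtain ⟨M, hM⟩ := S.exists_bound_Icc (t + 1)
  rw [ContinuousAt, Metric.tendsto_nhds]
  intro ε hε
  have hM0 : 0 ≤ M := (norm_nonneg _).trans (hM 0 zero_le)
  have h1 : ∀ᶠ h in 𝓝 (0 : ℝ≥0), dist (S.op h x) x < ε / (M + 1) :=
    Metric.tendsto_nhds.1 (S.tendsto_op x) _ (by positivity)
  have h2 : Tendsto (fun s => max s t - min s t) (𝓝 t) (𝓝 0) := by
    have : Continuous fun s : ℝ≥0 => max s t - min s t := by fun_prop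
    exact this.tendsto' t 0 (by simp)
  filter_upwards [h2.eventually h1, eventually_lt_nhds (lt_add_one t)] with s hs hst
  have h3 : max s t = min s t + (max s t - min s t) :=
    (add_tsub_cancel_of_le min_le_max).symm
  have h4 : dist (S.op s x) (S.op t x) = dist (S.op (max s t) x) (S.op (min s t) x) := by
    rcases le_total s t with h | h
    · rw [max_eq_right h, min_eq_left h, dist_comm]
    · rw [max_eq_left h, min_eq_right h]
  rw [h4, h3, S.op_add, ContinuousLinearMap.comp_apply, dist_eq_norm, ← map_sub]
  refine ((S.op _).le_of_opNorm_le (hM _ ((min_le_right s t).trans (by simp))) _).trans_lt ?_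
  rw [dist_eq_norm, lt_div_iff₀ (by positivity)] at hs
  nlinarith [norm_nonneg (S.op (max s t - min s t) x - x)]

/-- Grönwall's inequality for `‖w‖²`, with one-sided derivatives. -/
theorem eq_zero_of_inner_deriv_right_le {w w' : ℝ → H} {β T : ℝ} (hw : Continuous w)
    (hd : ∀ s, 0 ≤ s → HasDerivWithinAt w (w' s) (Set.Ici s) s) (h0 : w 0 = 0)
    (hβ : ∀ s, 0 ≤ s → inner ℝ (w s) (w' s) ≤ β * ‖w s‖ ^ 2) (hT : 0 ≤ T) : w T = 0 := by
  have hc : ContinuousOn (fun s => ‖w s‖ ^ 2) (Set.Icc 0 T) := (hw.norm.pow 2).continuousOn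
  have hd' : ∀ s ∈ Set.Ico 0 T, HasDerivWithinAt (fun s => ‖w s‖ ^ 2)
      (2 * inner ℝ (w s) (w' s)) (Set.Ici s) s := fun s hs => (hd s hs.1).norm_sq
  have hr : ∀ s ∈ Set.Ico 0 T, ∀ r, 2 * inner ℝ (w s) (w' s) < r →
      ∃ᶠ z in 𝓝[>] s, (z - s)⁻¹ * (‖w z‖ ^ 2 - ‖w s‖ ^ 2) < r := fun s hs r hr =>
    HasDerivWithinAt.liminf_right_slope_le (hd' s hs) hr
  have hg := le_gronwallBound_of_liminf_deriv_right_le (δ := 0) (K := 2 * β) (ε := 0) hc hr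
    (by simp [h0]) (fun s hs => by have := hβ s hs.1; linarith) T ⟨hT, le_rfl⟩
  rw [gronwallBound_ε0, zero_mul] at hg
  rw [← norm_eq_zero]
  nlinarith [norm_nonneg (w T)]

/-- A semigroup whose generator is quasi-dissipative and densely defined is determined by the
generator: the difference of two orbits has a norm to which Grönwall's inequality applies. -/
theorem eq_of_generatorGraph [CompleteSpace H] {S T : C0Semigroup H} {G : Submodule ℝ (H × H)}
    {β : ℝ} (hG : IsQuasiMDissipative G β) (hS : ∀ x f, S.GeneratorGraph x f ↔ (x, f) ∈ G)
    (hT : ∀ x f, T.GeneratorGraph x f ↔ (x, f) ∈ G) : S = T := by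
  have hcoe : Tendsto Real.toNNReal (𝓝[>] 0) (𝓝[>] 0) := by
    refine tendsto_nhdsWithin_iff.2 ⟨?_, ?_⟩
    · exact (continuous_real_toNNReal.tendsto' 0 0 Real.toNNReal_zero).mono_left nhdsWithin_le_nhds
    · filter_upwards [self_mem_nhdsWithin] with h hh using Real.toNNReal_pos.2 hh
  have horb : ∀ (R : C0Semigroup H), (∀ x f, R.GeneratorGraph x f ↔ (x, f) ∈ G) → ∀ x f,
      (x, f) ∈ G → ∀ t : ℝ, 0 ≤ t → (R.op t.toNNReal x, R.op t.toNNReal f) ∈ G ∧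
        HasDerivWithinAt (fun s : ℝ => R.op s.toNNReal x) (R.op t.toNNReal f) (Set.Ici t) t := by
    intro R hR x f hx t ht
    have hx' : Tendsto (fun h : ℝ≥0 => (h : ℝ)⁻¹ • (R.op h x - x)) (𝓝[>] 0) (𝓝 f) :=
      (hR x f).2 hx
    have h1 := ((R.op t.toNNReal).continuous.tendsto f).comp hx'
    refine ⟨(hR _ _).1 (h1.congr fun h => ?_), ?_⟩
    · simp only [Function.comp_apply, map_smul, map_sub]
      rw [← ContinuousLinearMap.comp_apply, ← R.op_add, add_comm, R.op_add]; rfl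
    · rw [hasDerivWithinAt_iff_tendsto_slope]
      have h2 : Tendsto (fun s => s - t) (𝓝[Set.Ici t \ {t}] t) (𝓝[>] 0) := by
        refine tendsto_nhdsWithin_iff.2 ⟨?_, ?_⟩
        · exact ((continuous_id.sub continuous_const).tendsto' t 0 (sub_self t)).mono_left
            nhdsWithin_le_nhds
        · filter_upwards [self_mem_nhdsWithin] with s hs
          exact sub_pos.2 (lt_of_le_of_ne hs.1 (Ne.symm hs.2))
      refine ((h1.comp hcoe).comp h2).congr' ?_
      filter_upwards [self_mem_nhdsWithin] with s hs
      have hst : t < s := lt_of_le_of_ne hs.1 (Ne.symm hs.2)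
      have h3 : s.toNNReal = t.toNNReal + (s - t).toNNReal := by
        rw [← Real.toNNReal_add ht (sub_nonneg.2 hst.le), add_sub_cancel]
      simp only [Function.comp_apply, map_smul, map_sub, slope_def_module]
      rw [h3, R.op_add, Real.coe_toNNReal _ (sub_nonneg.2 hst.le)]; rfl
  have key : ∀ x f, (x, f) ∈ G → ∀ t : ℝ≥0, S.op t x = T.op t x := by
    intro x f hx t
    have h0 := eq_zero_of_inner_deriv_right_le (β := β) (T := t)
      (((S.continuous_op_apply x).comp continuous_real_toNNReal).sub
        ((T.continuous_op_apply x).comp continuous_real_toNNReal))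
      (fun s hs => (horb S hS x f hx s hs).2.sub (horb T hT x f hx s hs).2)
      (by simp [S.op_zero, T.op_zero])
      (fun s hs => by
        have := hG.inner_le _ (G.sub_mem (horb S hS x f hx s hs).1 (horb T hT x f hx s hs).1)
        rw [real_inner_comm]
        exact this) t.2
    simpa [sub_eq_zero] using h0
  have hop : S.op = T.op := by
    funext t
    refine ContinuousLinearMap.ext fun x => ?_
    have := Continuous.ext_on hG.dense (S.op t).continuous (T.op t).continuous
      fun x hx => key x _ hx.choose_spec t
    exact congrFun this x
  cases S; cases T; congr

end Abstract

end C0Semigroup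

/-! ### Primitives of locally integrable functions on the line -/

namespace Poiseuille

open ComplexConjugate

theorem intervalIntegrable_of_locallyIntegrable {f : ℝ → ℂ} (hf : LocallyIntegrable f volume)
    (a b : ℝ) : IntervalIntegrable f volume a b :=
  intervalIntegrable_iff.mpr <|
    (hf.integrableOn_isCompact isCompact_uIcc).mono_set Set.uIoc_subset_uIcc

theorem absolutelyContinuousOnInterval_primitive {f : ℝ → ℂ} (hf : LocallyIntegrable f volume)
    (a b : ℝ) : AbsolutelyContinuousOnInterval (fun x => ∫ v in a..x, f v) a b := by
  have hi := intervalIntegrable_of_locallyIntegrable hf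
  have hre : AbsolutelyContinuousOnInterval (fun x => ∫ v in a..x, (f v).re) a b :=
    IntervalIntegrable.absolutelyContinuousOnInterval_intervalIntegral
      ⟨(hi a b).1.re, (hi a b).2.re⟩ Set.left_mem_uIcc
  have him : AbsolutelyContinuousOnInterval (fun x => ∫ v in a..x, (f v).im) a b :=
    IntervalIntegrable.absolutelyContinuousOnInterval_intervalIntegral
      ⟨(hi a b).1.im, (hi a b).2.im⟩ Set.left_mem_uIcc
  have hc : ∀ c : ℂ, AbsolutelyContinuousOnInterval (fun _ : ℝ => c) a b := fun c =>
    (contDiff_const.contDiffOn (n := 1)).absolutelyContinuousOnInterval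
  have h := (hre.smul (hc 1)).add (him.smul (hc Complex.I))
  refine (congrArg (AbsolutelyContinuousOnInterval · a b) (funext fun x => ?_)).mpr h
  have h1 : ∫ v in a..x, (f v).re = (∫ v in a..x, f v).re :=
    intervalIntegral.intervalIntegral_re (𝕜 := ℂ) (hi a x)
  have h2 : ∫ v in a..x, (f v).im = (∫ v in a..x, f v).im :=
    Complex.imCLM.intervalIntegral_comp_comm (hi a x)
  simp only [Pi.add_apply, Pi.smul_apply', h1, h2, Complex.real_smul, mul_one]
  exact (Complex.re_add_im _).symm

/-- `F` is a primitive of the locally integrable function `F'`; equivalently `F` is locally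
absolutely continuous with derivative `F'`. -/
structure IsPrim (F F' : ℝ → ℂ) : Prop where
  locallyIntegrable : LocallyIntegrable F' volume
  sub_eq : ∀ a b, F b - F a = ∫ y in a..b, F' y

namespace IsPrim

variable {F F' G G' : ℝ → ℂ}

theorem eq_add (h : IsPrim F F') (a : ℝ) : F = fun b => F a + ∫ y in a..b, F' y := by
  funext b; rw [← h.sub_eq a b]; ring

theorem continuous (h : IsPrim F F') : Continuous F := by
  rw [h.eq_add 0]
  exact continuous_const.add (intervalIntegral.continuous_primitive
    (intervalIntegrable_of_locallyIntegrable h.locallyIntegrable) 0)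

theorem ae_hasDerivAt (h : IsPrim F F') : ∀ᵐ x, HasDerivAt F (F' x) x := by
  filter_upwards [LocallyIntegrable.ae_hasDerivAt_integral h.locallyIntegrable] with x hx
  rw [h.eq_add 0]
  exact (hx 0).const_add _

theorem absolutelyContinuous (h : IsPrim F F') (a b : ℝ) :
    AbsolutelyContinuousOnInterval F a b := by
  rw [h.eq_add a]
  exact AbsolutelyContinuousOnInterval.add
    ((contDiff_const.contDiffOn (n := 1)).absolutelyContinuousOnInterval)
    (absolutelyContinuousOnInterval_primitive h.locallyIntegrable a b)

theorem of_hasDerivAt (h : ∀ x, HasDerivAt F (F' x) x) (hc : Continuous F') : IsPrim F F' :=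
  ⟨hc.locallyIntegrable, fun _ _ =>
    (intervalIntegral.integral_eq_sub_of_hasDerivAt (fun x _ => h x)
      (hc.intervalIntegrable _ _)).symm⟩

theorem congr_ae (h : IsPrim F F') (hG : F' =ᵐ[volume] G') : IsPrim F G' :=
  ⟨h.locallyIntegrable.congr hG, fun a b => by
    rw [h.sub_eq a b]
    exact intervalIntegral.integral_congr_ae (hG.mono fun x hx _ => hx)⟩

theorem add (hF : IsPrim F F') (hG : IsPrim G G') :
    IsPrim (fun y => F y + G y) (fun y => F' y + G' y) :=
  ⟨hF.locallyIntegrable.add hG.locallyIntegrable, fun a b => by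
    rw [intervalIntegral.integral_add
      (intervalIntegrable_of_locallyIntegrable hF.locallyIntegrable a b)
      (intervalIntegrable_of_locallyIntegrable hG.locallyIntegrable a b), ← hF.sub_eq, ← hG.sub_eq]
    ring⟩

theorem const_mul (c : ℂ) (hF : IsPrim F F') :
    IsPrim (fun y => c * F y) (fun y => c * F' y) :=
  ⟨by simpa [Pi.smul_def] using hF.locallyIntegrable.smul c, fun a b => by
    rw [intervalIntegral.integral_const_mul, ← hF.sub_eq]; ring⟩

theorem sub (hF : IsPrim F F') (hG : IsPrim G G') :
    IsPrim (fun y => F y - G y) (fun y => F' y - G' y) := by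
  simpa [sub_eq_add_neg] using hF.add (hG.const_mul (-1))

theorem conjugate (hF : IsPrim F F') : IsPrim (fun y => conj (F y)) (fun y => conj (F' y)) := by
  refine ⟨hF.locallyIntegrable.mono
    (Complex.continuous_conj.comp_aestronglyMeasurable hF.locallyIntegrable.aestronglyMeasurable)
    (Eventually.of_forall fun x => by simp), fun a b => ?_⟩
  rw [← map_sub, hF.sub_eq a b]
  exact (Complex.conjCLE.toContinuousLinearMap.intervalIntegral_comp_comm
    (intervalIntegrable_of_locallyIntegrable hF.locallyIntegrable a b)).symm

/-- The product rule. It holds because a locally absolutely continuous function with derivative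
zero almost everywhere is constant. -/
theorem mul (hF : IsPrim F F') (hG : IsPrim G G') :
    IsPrim (fun y => F y * G y) (fun y => F' y * G y + F y * G' y) := by
  have hl : LocallyIntegrable (fun y => F' y * G y + F y * G' y) volume :=
    (hF.locallyIntegrable.mul_continuous hG.continuous).add
      (by simpa using hG.locallyIntegrable.continuous_smul hF.continuous)
  refine ⟨hl, fun a b => ?_⟩
  have hac : AbsolutelyContinuousOnInterval
      (fun x => F x * G x - ∫ y in a..x, (F' y * G y + F y * G' y)) a b :=
    ((hF.absolutelyContinuous a b).smul (hG.absolutelyContinuous a b)).sub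
      (absolutelyContinuousOnInterval_primitive hl a b)
  obtain ⟨C, hC⟩ := hac.const_of_ae_hasDerivAt_zero (by
    filter_upwards [hF.ae_hasDerivAt, hG.ae_hasDerivAt, LocallyIntegrable.ae_hasDerivAt_integral hl]
      with x h1 h2 h3 _
    exact ((h1.mul h2).sub (h3 a)).congr_deriv (sub_self _))
  have h1 := hC a Set.left_mem_uIcc
  have h2 := hC b Set.right_mem_uIcc
  simp only [intervalIntegral.integral_same, sub_zero] at h1
  rw [← h1] at h2
  rw [← sub_eq_zero] at h2 ⊢
  rw [← h2]; ring

/-- The derivative of an integrable function has integral zero, if it is integrable. -/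
theorem integral_eq_zero (h : IsPrim F F') (hF : Integrable F) (hF' : Integrable F') :
    ∫ y, F' y = 0 := by
  have h1 : Tendsto F atTop (𝓝 (F 0 + ∫ y in Set.Ioi 0, F' y)) := by
    rw [h.eq_add 0]
    simpa using (intervalIntegral_tendsto_integral_Ioi 0 hF'.integrableOn tendsto_id).const_add
      (F 0)
  have h2 : Tendsto F atBot (𝓝 (F 0 - ∫ y in Set.Iic 0, F' y)) := by
    rw [h.eq_add 0]
    have := (intervalIntegral_tendsto_integral_Iic 0 hF'.integrableOn tendsto_id).const_sub (F 0)
    simpa [intervalIntegral.integral_symm _ (0 : ℝ), sub_eq_add_neg] using this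
  have h3 := IntegrableAtFilter.eq_zero_of_tendsto (hF.integrableAtFilter atTop)
    (fun s hs => by
      obtain ⟨b, hb⟩ := mem_atTop_sets.1 hs
      exact top_le_iff.1 ((Real.volume_Ici (a := b)) ▸ measure_mono hb)) h1
  have h4 := IntegrableAtFilter.eq_zero_of_tendsto (hF.integrableAtFilter atBot)
    (fun s hs => by
      obtain ⟨b, hb⟩ := mem_atBot_sets.1 hs
      exact top_le_iff.1 ((Real.volume_Iic (a := b)) ▸ measure_mono hb)) h2
  rw [← intervalIntegral.integral_Iic_add_Ioi (b := 0) hF'.integrableOn hF'.integrableOn]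
  linear_combination h3 - h4

end IsPrim

/-! ### Weak second derivatives -/

/-- A smooth compactly supported function on the line with integral zero is the derivative of one.
-/
theorem exists_deriv_eq {η : ℝ → ℝ} (hη : ContDiff ℝ (⊤ : ℕ∞) η) (hs : HasCompactSupport η)
    (h0 : ∫ y, η y = 0) :
    ∃ κ : ℝ → ℝ, ContDiff ℝ (⊤ : ℕ∞) κ ∧ HasCompactSupport κ ∧ deriv κ = η := by
  obtain ⟨R, hR⟩ := hs.isCompact.isBounded.subset_closedBall 0
  have hz : ∀ y, R < |y| → η y = 0 := fun y hy => by
    by_contra hne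
    have := hR (subset_tsupport _ hne)
    rw [mem_closedBall_zero_iff, Real.norm_eq_abs] at this
    linarith
  have hint : Integrable η := hη.continuous.integrable_of_hasCompactSupport hs
  have hd : ∀ y, HasDerivAt (fun y => ∫ t in (-|R| - 1)..y, η t) (η y) y := fun y =>
    intervalIntegral.integral_hasDerivAt_right (hη.continuous.intervalIntegrable _ _)
      (hη.continuous.stronglyMeasurableAtFilter _ _) hη.continuous.continuousAt
  have hdd : deriv (fun y => ∫ t in (-|R| - 1)..y, η t) = η := funext fun y => (hd y).deriv
  refine ⟨_, ?_, ?_, hdd⟩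
  · rw [contDiff_infty_iff_deriv, hdd]
    exact ⟨fun y => (hd y).differentiableAt, hη⟩
  · refine HasCompactSupport.of_support_subset_isCompact
      (isCompact_Icc (a := -|R| - 1) (b := |R| + 1)) fun y hy => ?_
    by_contra hne
    rw [Set.mem_Icc, not_and_or, not_le, not_le] at hne
    refine hy ?_
    have hzero : ∀ a b : ℝ, (∀ t ∈ Set.uIoc a b, R < |t|) → ∫ t in a..b, η t = 0 := fun a b h =>
      intervalIntegral.integral_zero_ae (Eventually.of_forall fun t ht => hz t (h t ht))
    rcases hne with h | h
    · refine hzero _ _ fun t ht => ?_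
      rw [Set.uIoc_of_ge h.le] at ht
      have := ht.2
      rw [abs_of_neg (by linarith [abs_nonneg R])]
      linarith [le_abs_self R]
    · have h1 : ∫ t in (-|R| - 1)..y, η t = ∫ t, η t := by
        refine intervalIntegral.integral_eq_integral_of_support_subset fun t ht => ?_
        by_contra hne
        rw [Set.mem_Ioc, not_and_or, not_lt, not_le] at hne
        refine ht (hz t ?_)
        rcases hne with h' | h'
        · rw [abs_of_nonpos (by linarith [abs_nonneg R])]; linarith [le_abs_self R]
        · rw [abs_of_pos (by linarith [abs_nonneg R])]; linarith [le_abs_self R]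
      exact h1.trans h0

theorem integrable_test_smul {u : ℝ → ℂ} (hu : LocallyIntegrable u volume) {η : ℝ → ℝ}
    (hη : Continuous η) (hs : HasCompactSupport η) : Integrable fun y => η y • u y :=
  hu.integrable_smul_left_of_hasCompactSupport hη hs

/-- The lemma of du Bois-Reymond. -/
theorem exists_ae_eq_const_of_weak_deriv_eq_zero {u : ℝ → ℂ} (hu : LocallyIntegrable u volume)
    (h : ∀ η : ℝ → ℝ, ContDiff ℝ (⊤ : ℕ∞) η → HasCompactSupport η →
      ∫ y, deriv η y • u y = 0) : ∃ c : ℂ, ∀ᵐ y, u y = c := by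
  let ρ : ContDiffBump (0 : ℝ) := ⟨1, 2, one_pos, one_lt_two⟩
  set r : ℝ → ℝ := ρ.normed volume with hr
  have hrs : ContDiff ℝ (⊤ : ℕ∞) r := ρ.contDiff_normed
  have hrc : HasCompactSupport r := ρ.hasCompactSupport_normed
  have hr1 : ∫ y, r y = 1 := ρ.integral_normed
  refine ⟨∫ y, r y • u y, ?_⟩
  have hl : LocallyIntegrable (fun y => u y - ∫ y, r y • u y) volume :=
    hu.sub (continuous_const.locallyIntegrable)
  have := ae_eq_zero_of_integral_contDiff_smul_eq_zero hl fun η hη hs => by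
    have hri : Integrable r := hrs.continuous.integrable_of_hasCompactSupport hrc
    have hηi : Integrable η := hη.continuous.integrable_of_hasCompactSupport hs
    obtain ⟨κ, hκ, hκs, hκd⟩ := exists_deriv_eq (η := fun y => η y - (∫ t, η t) * r y)
      (hη.sub (contDiff_const.mul hrs)) (hs.sub (hrc.mul_left)) (by
        rw [integral_sub hηi (hri.const_mul _), integral_const_mul, hr1, mul_one, sub_self])
    have h1 := h κ hκ hκs
    rw [hκd] at h1
    have hi1 := integrable_test_smul hu hη.continuous hs
    have hi2 := integrable_test_smul hu hrs.continuous hrc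
    have hi3 : Integrable fun y => (∫ t, η t) • (r y • u y) := hi2.smul (∫ t, η t)
    simp only [sub_smul, mul_smul] at h1
    rw [integral_sub hi1 hi3, integral_smul] at h1
    simp only [smul_sub]
    rw [integral_sub hi1 (hηi.smul_const _), integral_smul_const]
    exact h1
  filter_upwards [this] with y hy using sub_eq_zero.1 hy

/-- `u'' = g` in the sense of distributions. -/
def IsWeakSecondDeriv (u g : ℝ → ℂ) : Prop :=
  ∀ η : ℝ → ℝ, ContDiff ℝ (⊤ : ℕ∞) η → HasCompactSupport η →
    ∫ y, deriv (deriv η) y • u y = ∫ y, η y • g y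

theorem IsPrim.of_real_hasDerivAt {f f' : ℝ → ℝ} (h : ∀ x, HasDerivAt f (f' x) x)
    (hc : Continuous f') : IsPrim (fun y => (f y : ℂ)) (fun y => (f' y : ℂ)) :=
  .of_hasDerivAt (fun x => (h x).ofReal_comp) (Complex.continuous_ofReal.comp hc)

theorem hasDerivAt_of_contDiff {η : ℝ → ℝ} (hη : ContDiff ℝ (⊤ : ℕ∞) η) (y : ℝ) :
    HasDerivAt η (deriv η y) y :=
  (hη.differentiable (by simp)).differentiableAt.hasDerivAt

theorem contDiff_deriv {η : ℝ → ℝ} (hη : ContDiff ℝ (⊤ : ℕ∞) η) :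
    ContDiff ℝ (⊤ : ℕ∞) (deriv η) := (contDiff_infty_iff_deriv.1 hη).2

/-- Integration by parts against a test function. -/
theorem IsPrim.integral_deriv_smul {F F' : ℝ → ℂ} (h : IsPrim F F') {η : ℝ → ℝ}
    (hη : ContDiff ℝ (⊤ : ℕ∞) η) (hs : HasCompactSupport η) :
    ∫ y, deriv η y • F y = -∫ y, η y • F' y := by
  have h1 := (IsPrim.of_real_hasDerivAt (hasDerivAt_of_contDiff hη)
    (contDiff_deriv hη).continuous).mul h
  have hi1 := integrable_test_smul h.continuous.locallyIntegrable (contDiff_deriv hη).continuous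
    hs.deriv
  have hi2 := integrable_test_smul h.locallyIntegrable hη.continuous hs
  have hi3 := integrable_test_smul h.continuous.locallyIntegrable hη.continuous hs
  have h2 := h1.integral_eq_zero (by simpa using hi3) (by simpa [Pi.add_def] using hi1.add hi2)
  simp only [← Complex.real_smul] at h2
  rw [integral_add hi1 hi2] at h2
  exact eq_neg_of_add_eq_zero_left h2

/-- A function whose weak second derivative is locally integrable is continuously differentiable,
with locally absolutely continuous derivative, after modification on a null set. -/
theorem IsWeakSecondDeriv.exists_isPrim {u g : ℝ → ℂ} (h : IsWeakSecondDeriv u g)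
    (hu : LocallyIntegrable u volume) (hg : LocallyIntegrable g volume) :
    ∃ U V : ℝ → ℂ, u =ᵐ[volume] U ∧ IsPrim U V ∧ IsPrim V g := by
  set V₀ : ℝ → ℂ := fun y => ∫ t in 0..y, g t with hV₀
  have hprim : ∀ {f : ℝ → ℂ}, LocallyIntegrable f volume → IsPrim (fun y => ∫ t in 0..y, f t) f :=
    fun hf => ⟨hf, fun a b => intervalIntegral.integral_interval_sub_left
      (intervalIntegrable_of_locallyIntegrable hf _ _)
      (intervalIntegrable_of_locallyIntegrable hf _ _)⟩
  have hVg : IsPrim V₀ g := hprim hg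
  set U₀ : ℝ → ℂ := fun y => ∫ t in 0..y, V₀ t with hU₀
  have hUV : IsPrim U₀ V₀ := hprim hVg.continuous.locallyIntegrable
  set z : ℝ → ℂ := fun y => u y - U₀ y with hz
  have hzl : LocallyIntegrable z volume := hu.sub hUV.continuous.locallyIntegrable
  have hz2 : ∀ η : ℝ → ℝ, ContDiff ℝ (⊤ : ℕ∞) η → HasCompactSupport η →
      ∫ y, deriv (deriv η) y • z y = 0 := fun η hη hs => by
    have h1 := h η hη hs
    have h2 := hUV.integral_deriv_smul (contDiff_deriv hη) hs.deriv
    have h3 := hVg.integral_deriv_smul hη hs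
    have hd := (contDiff_deriv (contDiff_deriv hη)).continuous
    simp only [hz, smul_sub]
    rw [integral_sub (integrable_test_smul hu hd hs.deriv.deriv)
      (integrable_test_smul hUV.continuous.locallyIntegrable hd hs.deriv.deriv), h1, h2, h3]
    ring
  let ρ : ContDiffBump (0 : ℝ) := ⟨1, 2, one_pos, one_lt_two⟩
  set r : ℝ → ℝ := ρ.normed volume with hr
  have hrs : ContDiff ℝ (⊤ : ℕ∞) r := ρ.contDiff_normed
  have hrc : HasCompactSupport r := ρ.hasCompactSupport_normed
  have hr1 : ∫ y, r y = 1 := ρ.integral_normed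
  set c : ℂ := ∫ y, deriv r y • z y with hc
  have hlin : IsPrim (fun y : ℝ => c * (y : ℂ)) (fun _ => c) := by
    have := (IsPrim.of_hasDerivAt (F := fun y : ℝ => (y : ℂ)) (F' := fun _ => 1)
      (fun x => (hasDerivAt_id x).ofReal_comp) continuous_const).const_mul c
    simpa using this
  obtain ⟨d, hd⟩ := exists_ae_eq_const_of_weak_deriv_eq_zero
    (u := fun y => z y + c * (y : ℂ)) (hzl.add hlin.continuous.locallyIntegrable) fun η hη hs => by
    have hri : Integrable r := hrs.continuous.integrable_of_hasCompactSupport hrc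
    have hηi : Integrable η := hη.continuous.integrable_of_hasCompactSupport hs
    obtain ⟨κ, hκ, hκs, hκd⟩ := exists_deriv_eq (η := fun y => η y - (∫ t, η t) * r y)
      (hη.sub (contDiff_const.mul hrs)) (hs.sub (hrc.mul_left)) (by
        rw [integral_sub hηi (hri.const_mul _), integral_const_mul, hr1, mul_one, sub_self])
    have h1 := hz2 κ hκ hκs
    have hκ2 : deriv (deriv κ) = fun y => deriv η y - (∫ t, η t) * deriv r y := by
      rw [hκd]; funext y
      exact ((hasDerivAt_of_contDiff hη y).sub ((hasDerivAt_of_contDiff hrs y).const_mul _)).deriv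
    rw [hκ2] at h1
    have hi1 := integrable_test_smul hzl (contDiff_deriv hη).continuous hs.deriv
    have hi2 := integrable_test_smul hzl (contDiff_deriv hrs).continuous hrc.deriv
    have hi3 : Integrable fun y => (∫ t, η t) • (deriv r y • z y) := hi2.smul (∫ t, η t)
    simp only [sub_smul, mul_smul] at h1
    rw [integral_sub hi1 hi3, integral_smul, ← hc] at h1
    have h2 := hlin.integral_deriv_smul hη hs
    rw [integral_smul_const] at h2
    simp only [smul_add]
    rw [integral_add hi1 (integrable_test_smul hlin.continuous.locallyIntegrable
      (contDiff_deriv hη).continuous hs.deriv), h2, ← sub_eq_add_neg]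
    exact h1
  have hV : IsPrim (fun y => V₀ y + -c) g := by
    have := hVg.add (IsPrim.of_hasDerivAt (F := fun _ : ℝ => -c) (F' := fun _ => 0)
      (fun x => hasDerivAt_const x _) continuous_const)
    simpa using this
  have hU : IsPrim (fun y => (U₀ y + (-1) * (c * (y : ℂ))) + d) (fun y => V₀ y + -c) := by
    have := (hUV.add (hlin.const_mul (-1))).add
      (IsPrim.of_hasDerivAt (F := fun _ : ℝ => d) (F' := fun _ => 0)
      (fun x => hasDerivAt_const x _) continuous_const)
    simpa using this
  refine ⟨_, _, ?_, hU, hV⟩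
  filter_upwards [hd] with y hy
  rw [← hy, hz]; ring

/-! ### The two Lyapunov functionals, in an abstract Hilbert space -/

section Hilbert

variable {E : Type*} [NormedAddCommGroup E] [InnerProductSpace ℂ E]

local notation "⟪" x ", " y "⟫" => inner ℂ x y

theorem norm_sub_smul_sq (h : ℝ) (a b : E) :
    ‖a - (h : ℂ) • b‖ ^ 2 = ‖a‖ ^ 2 - 2 * h * ⟪a, b⟫.re + h ^ 2 * ‖b‖ ^ 2 := by
  have := norm_sub_sq (𝕜 := ℂ) a ((h : ℂ) • b)
  rw [this, inner_smul_right, norm_smul, Complex.norm_real, mul_pow, Real.norm_eq_abs, sq_abs]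
  simp only [RCLike.re_to_complex, Complex.re_ofReal_mul]
  ring

theorem inner_im_symm (a b : E) : ⟪a, b⟫.im = -⟪b, a⟫.im := by
  rw [← inner_conj_symm a b, Complex.conj_im]

theorem inner_re_symm (a b : E) : ⟪a, b⟫.re = ⟪b, a⟫.re := by
  rw [← inner_conj_symm a b, Complex.conj_re]

theorem inner_self_re (a : E) : ⟪a, a⟫.re = ‖a‖ ^ 2 := by
  have := inner_self_eq_norm_sq (𝕜 := ℂ) a
  simpa using this

theorem inner_self_im' (a : E) : ⟪a, a⟫.im = 0 := by
  have := inner_im_symm a a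
  linarith

theorem abs_re_inner_le (a b : E) : |⟪a, b⟫.re| ≤ ‖a‖ * ‖b‖ :=
  (Complex.abs_re_le_norm _).trans (norm_inner_le_norm a b)

theorem abs_im_inner_le (a b : E) : |⟪a, b⟫.im| ≤ ‖a‖ * ‖b‖ :=
  (Complex.abs_im_le_norm _).trans (norm_inner_le_norm a b)

/-- The square-integrable functions attached to one `x`-frequency `k` of an element of the domain
of `𝓛`: with `u` the mode, `Φ = (k² - ∂ᵧ²)⁻¹ u` and `f` the mode of `𝓛 ω`, the fields record
`u`, `y u`, `y² u`, `u'`, `y u'`, `u''`, `Φ`, `Φ'`, `y Φ`, the identity for `f`, and the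
integrations by parts among these functions which the energy estimates use. -/
structure ModeRelations (ν k : ℝ) (u yu yyu v yv s p p' yp f : E) : Prop where
  eqn : f = (ν : ℂ) • s - (ν * k ^ 2 : ℂ) • u - (Complex.I * k) • yyu - (2 * Complex.I * k) • p
  s_u : ⟪s, u⟫ = -⟪v, v⟫
  yyu_u : ⟪yyu, u⟫ = ⟪yu, yu⟫
  yv_u : ⟪yv, u⟫ = ⟪v, yu⟫
  p_u : ⟪p, u⟫ = ⟪p', p'⟫ + (k ^ 2 : ℝ) * ⟪p, p⟫
  s_p : ⟪s, p⟫ = (k ^ 2 : ℝ) * ⟪u, p⟫ - ⟪u, u⟫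
  s_yyu : ⟪s, yyu⟫.re = -‖yv‖ ^ 2 + ‖u‖ ^ 2
  s_yyu_im : ⟪s, yyu⟫.im = -2 * ⟪v, yu⟫.im
  yv_yyu : ⟪yv, yyu⟫.re = -(3 / 2) * ‖yu‖ ^ 2
  yv_p : ⟪yv, p⟫.re = -‖p'‖ ^ 2 - (1 / 2) * ⟪p, u⟫.re
  p_sq : ‖p‖ ^ 2 = -2 * ⟪p', yp⟫.re
  yp_sq : k ^ 2 * ‖yp‖ ^ 2 ≤ ⟪yu, yp⟫.re - 2 * ⟪p', yp⟫.re

namespace ModeRelations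

variable {ν k : ℝ} {u yu yyu v yv s p p' yp f : E}
  (R : ModeRelations ν k u yu yyu v yv s p p' yp f)

include R

theorem re_inner (x : E) : ⟪x, f⟫.re = ν * ⟪x, s⟫.re - ν * k ^ 2 * ⟪x, u⟫.re + k * ⟪x, yyu⟫.im
    + 2 * k * ⟪x, p⟫.im := by
  rw [R.eqn, inner_sub_right, inner_sub_right, inner_sub_right, inner_smul_right, inner_smul_right,
    inner_smul_right, inner_smul_right]
  simp [← Complex.ofReal_pow]

theorem im_inner (x : E) : ⟪x, f⟫.im = ν * ⟪x, s⟫.im - ν * k ^ 2 * ⟪x, u⟫.im - k * ⟪x, yyu⟫.re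
    - 2 * k * ⟪x, p⟫.re := by
  rw [R.eqn, inner_sub_right, inner_sub_right, inner_sub_right, inner_smul_right, inner_smul_right,
    inner_smul_right, inner_smul_right]
  simp [← Complex.ofReal_pow]

theorem p_u_im : ⟪p, u⟫.im = 0 := by
  rw [R.p_u, Complex.add_im, Complex.im_ofReal_mul, inner_self_im', inner_self_im']; ring

/-- `Re ⟨𝓛ω, ω⟩ = -ν ‖∇ω‖²`: both transport and the nonlocal term are antisymmetric. -/
theorem re_u_f : ⟪u, f⟫.re = -ν * (‖v‖ ^ 2 + k ^ 2 * ‖u‖ ^ 2) := by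
  have h1 := congrArg Complex.re R.s_u
  have h2 := congrArg Complex.im R.yyu_u
  rw [Complex.neg_re, inner_self_re] at h1
  rw [inner_self_im'] at h2
  rw [R.re_inner, inner_re_symm u s, h1, inner_self_re, inner_im_symm u yyu, h2, inner_im_symm u p,
    R.p_u_im]
  ring

/-- `Re ⟨𝓛ω, (y² + 2(-Δ)⁻¹)ω⟩`: the inviscid part of `𝓛` is `-∂ₓ` composed with the symmetric
operator `y² + 2(-Δ)⁻¹`, hence does not contribute. -/
theorem re_yyu_f : ⟪yyu, f⟫.re + 2 * ⟪p, f⟫.re =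
    -ν * (‖yv‖ ^ 2 + k ^ 2 * ‖yu‖ ^ 2 + ‖u‖ ^ 2) := by
  have h1 := congrArg Complex.re R.yyu_u
  have h2 := congrArg Complex.re R.s_p
  have h3 := R.s_yyu
  rw [inner_self_re] at h1
  rw [Complex.sub_re, Complex.re_ofReal_mul, inner_self_re, inner_re_symm u p] at h2
  rw [R.re_inner, R.re_inner, h1, inner_re_symm yyu s, h3, inner_re_symm p s, h2, inner_self_im',
    inner_self_im', inner_im_symm p yyu]
  ring

/-- One implicit Euler step `w = u - h f` decreases `‖ω‖² + ‖yω‖² + 2⟨(-Δ)⁻¹ω, ω⟩`, and controls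
the dissipation. -/
theorem energy_step {yf pf p'f : E} {h : ℝ} (hν : 0 ≤ ν) (hh : 0 ≤ h)
    (hyf : ⟪yu, yf⟫ = ⟪yyu, f⟫)
    (hpf : (⟪p', p'f⟫ + (k ^ 2 : ℝ) * ⟪p, pf⟫).re = ⟪p, f⟫.re) :
    ‖u‖ ^ 2 + ‖yu‖ ^ 2 + 2 * (‖p'‖ ^ 2 + k ^ 2 * ‖p‖ ^ 2) + 2 * h * ν * ‖v‖ ^ 2 ≤
      ‖u - (h : ℂ) • f‖ ^ 2 + ‖yu - (h : ℂ) • yf‖ ^ 2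
        + 2 * (‖p' - (h : ℂ) • p'f‖ ^ 2 + k ^ 2 * ‖p - (h : ℂ) • pf‖ ^ 2) := by
  have h1 := R.re_u_f
  have h2 := R.re_yyu_f
  rw [Complex.add_re, Complex.re_ofReal_mul] at hpf
  simp only [norm_sub_smul_sq, hyf]
  have e : 0 ≤ h ^ 2 * (‖f‖ ^ 2 + ‖yf‖ ^ 2 + 2 * (‖p'f‖ ^ 2 + k ^ 2 * ‖pf‖ ^ 2)) := by positivity
  have e2 : 0 ≤ h * ν * (k ^ 2 * ‖u‖ ^ 2 + ‖yv‖ ^ 2 + k ^ 2 * ‖yu‖ ^ 2 + ‖u‖ ^ 2) := by positivity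
  have e3 : h * (⟪u, f⟫.re + ⟪yyu, f⟫.re + 2 * ⟪p', p'f⟫.re + 2 * k ^ 2 * ⟪p, pf⟫.re) =
      h * (-ν * (‖v‖ ^ 2 + k ^ 2 * ‖u‖ ^ 2) - ν * (‖yv‖ ^ 2 + k ^ 2 * ‖yu‖ ^ 2 + ‖u‖ ^ 2)) := by
    congr 1; linear_combination h1 + h2 + 2 * hpf
  nlinarith [e, e2, e3]

/-- `k² ‖Φ‖² ≤ 2 ‖yu‖ ‖Φ'‖ + 4 ‖Φ'‖²`. -/
theorem norm_p_sq_le :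
    k ^ 2 * ‖p‖ ^ 2 ≤ 2 * ‖yu‖ * ‖p'‖ + 4 * ‖p'‖ ^ 2 := by
  have h1 := R.p_sq
  have h2 := R.yp_sq
  have h3 := abs_le.1 (abs_re_inner_le p' yp)
  have h4 := (abs_le.1 (abs_re_inner_le yu yp)).2
  have h5 : k ^ 2 * ‖yp‖ ≤ ‖yu‖ + 2 * ‖p'‖ := by
    rcases eq_or_lt_of_le (norm_nonneg yp) with h | h
    · rw [← h]; have := norm_nonneg yu; have := norm_nonneg p'; linarith
    · refine le_of_mul_le_mul_right ?_ h
      nlinarith [h3.1]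
  have h6 : ‖p‖ ^ 2 ≤ 2 * ‖p'‖ * ‖yp‖ := by nlinarith [h3.1]
  nlinarith [norm_nonneg p', mul_le_mul_of_nonneg_left h5 (norm_nonneg p')]

end ModeRelations

/-- The hypocoercive functional
`‖ω‖² + α‖∂ᵧω‖² - 2β Im⟨yω, ∂ᵧω⟩ + γ(‖yω‖² + 2⟨(-Δ)⁻¹ω, ω⟩)` of one mode, with `α = √ν/(4k²)`,
`β = 1/(4k)` and `γ = 1/√ν`. Here `yu`, `v`, `p`, `p'` stand for `y u`, `u'`, `Φ`, `Φ'`. -/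
noncomputable def hypo (ν k : ℝ) (u yu v p p' : E) : ℝ :=
  ‖u‖ ^ 2 + √ν / (4 * k ^ 2) * ‖v‖ ^ 2 - 2 * (1 / (4 * k)) * ⟪v, yu⟫.im
    + (1 / √ν) * (‖yu‖ ^ 2 + 2 * (‖p'‖ ^ 2 + k ^ 2 * ‖p‖ ^ 2))

/-- The cross term of `hypo` is at most half of the two neighbouring terms. -/
theorem abs_cross_le {ν k : ℝ} (hν : 0 < ν) (hk : k ≠ 0) (yu v : E) :
    |2 * (1 / (4 * k)) * ⟪v, yu⟫.im| ≤
      (1 / 2) * (√ν / (4 * k ^ 2) * ‖v‖ ^ 2 + (1 / √ν) * ‖yu‖ ^ 2) := by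
  have h1 := abs_im_inner_le v yu
  have hs : 0 < √ν := Real.sqrt_pos.2 hν
  have hk' : 0 < |k| := abs_pos.2 hk
  set m := √(√ν) with hm
  have hm0 : 0 < m := Real.sqrt_pos.2 hs
  have hm2 : √ν = m ^ 2 := (Real.sq_sqrt hs.le).symm
  have h2 : |2 * (1 / (4 * k)) * ⟪v, yu⟫.im| ≤ 2 * (1 / (4 * |k|)) * (‖v‖ * ‖yu‖) := by
    rw [abs_mul]
    have : |2 * (1 / (4 * k))| = 2 * (1 / (4 * |k|)) := by
      rw [abs_mul, abs_div, abs_mul]; norm_num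
    rw [this]
    gcongr
  refine h2.trans ?_
  have h3 := sq_nonneg (m / (2 * |k|) * ‖v‖ - 1 / m * ‖yu‖)
  rw [hm2, ← sq_abs k]
  have h4 : (m / (2 * |k|) * ‖v‖ - 1 / m * ‖yu‖) ^ 2 = m ^ 2 / (4 * |k| ^ 2) * ‖v‖ ^ 2
      + 1 / m ^ 2 * ‖yu‖ ^ 2 - 2 * (2 * (1 / (4 * |k|)) * (‖v‖ * ‖yu‖)) := by
    field_simp; ring
  linarith

theorem le_hypo {ν k : ℝ} (hν : 0 < ν) (hk : k ≠ 0) (u yu v p p' : E) :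
    ‖u‖ ^ 2 + (1 / 2) * ((1 / √ν) * ‖yu‖ ^ 2) ≤ hypo ν k u yu v p p' := by
  have h1 := (abs_le.1 (abs_cross_le hν hk yu v)).2
  have h2 : 0 ≤ (1 / √ν) * (2 * (‖p'‖ ^ 2 + k ^ 2 * ‖p‖ ^ 2)) := by positivity
  have h3 : 0 ≤ √ν / (4 * k ^ 2) * ‖v‖ ^ 2 := by positivity
  rw [hypo]; linarith

theorem hypo_le {ν k : ℝ} (hν : 0 < ν) (hk : k ≠ 0) (u yu v p p' : E) :
    hypo ν k u yu v p p' ≤ ‖u‖ ^ 2 + (3 / 2) * (√ν / (4 * k ^ 2) * ‖v‖ ^ 2)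
      + (1 / √ν) * ((3 / 2) * ‖yu‖ ^ 2 + 2 * (‖p'‖ ^ 2 + k ^ 2 * ‖p‖ ^ 2)) := by
  have h1 := (abs_le.1 (abs_cross_le hν hk yu v)).1
  rw [hypo]; linarith

/-- The real inequality behind `ModeRelations.hypo_step`; the capital letters are norms, and `m`
is `√ν`. -/
theorem hypo_dissipation_le {m k N B P Q W A C J I : ℝ} (hm : 0 < m) (hk : 1 ≤ k ^ 2)
    (hB : 0 ≤ B) (hP : 0 ≤ P)
    (hJ : |J| ≤ P * B) (hI : |I| ≤ Q * W) (hC : k ^ 2 * C ^ 2 ≤ 2 * B * A + 4 * A ^ 2) :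
    -m ^ 2 * (P ^ 2 + k ^ 2 * N ^ 2)
      + m / (4 * k ^ 2) * (-m ^ 2 * W ^ 2 - m ^ 2 * k ^ 2 * P ^ 2 + 2 * k * J)
      - 1 / (4 * k) * (2 * k * B ^ 2 + 4 * k * A ^ 2 + 2 * m ^ 2 * I - 2 * m ^ 2 * k ^ 2 * J)
      - 1 / m * (m ^ 2 * (Q ^ 2 + k ^ 2 * B ^ 2 + N ^ 2)) ≤
    -(m / 14) * (N ^ 2 + (3 / 2) * (m / (4 * k ^ 2) * P ^ 2)
      + (1 / m) * ((3 / 2) * B ^ 2 + 2 * (A ^ 2 + k ^ 2 * C ^ 2))) := by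
  have hk0 : k ≠ 0 := fun h => by rw [h] at hk; norm_num at hk
  have hκ : 0 < |k| := abs_pos.2 hk0
  set κ := |k| with hκd
  have hkk : k ^ 2 = κ ^ 2 := (sq_abs k).symm
  have hκ1 : 1 ≤ κ ^ 2 := hkk ▸ hk
  have e1 : m / (4 * k ^ 2) * (-m ^ 2 * W ^ 2 - m ^ 2 * k ^ 2 * P ^ 2 + 2 * k * J) =
      -(m ^ 3 / (4 * k ^ 2)) * W ^ 2 - m ^ 3 / 4 * P ^ 2 + m / (2 * k) * J := by
    field_simp; ring
  have e2 : 1 / (4 * k) * (2 * k * B ^ 2 + 4 * k * A ^ 2 + 2 * m ^ 2 * I - 2 * m ^ 2 * k ^ 2 * J)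
      = B ^ 2 / 2 + A ^ 2 + m ^ 2 / (2 * k) * I - m ^ 2 * k / 2 * J := by
    field_simp; ring
  have e3 : 1 / m * (m ^ 2 * (Q ^ 2 + k ^ 2 * B ^ 2 + N ^ 2)) =
      m * Q ^ 2 + m * k ^ 2 * B ^ 2 + m * N ^ 2 := by field_simp
  have e4 : (m / 14) * (N ^ 2 + (3 / 2) * (m / (4 * k ^ 2) * P ^ 2)
      + (1 / m) * ((3 / 2) * B ^ 2 + 2 * (A ^ 2 + k ^ 2 * C ^ 2))) =
      m * N ^ 2 / 14 + 3 / 112 * (m ^ 2 * P ^ 2 * (1 / k ^ 2))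
        + 1 / 14 * ((3 / 2) * B ^ 2 + 2 * (A ^ 2 + k ^ 2 * C ^ 2)) := by
    field_simp; ring
  have a1 : m / (2 * k) * J ≤ m ^ 2 * P ^ 2 / 2 + B ^ 2 / 8 := by
    have h1 : m / (2 * k) * J ≤ m / (2 * κ) * (P * B) := by
      refine (le_abs_self _).trans ?_
      rw [abs_mul, abs_div, abs_mul, abs_of_pos hm, abs_two, ← hκd]
      gcongr
    have h2 : m / (2 * κ) * (P * B) ≤ m / 2 * (P * B) := by
      have : 1 ≤ κ := by nlinarith
      gcongr
      linarith
    have h3 : (m * P - B / 2) ^ 2 = m ^ 2 * P ^ 2 - 2 * (m / 2 * (P * B)) + B ^ 2 / 4 := by ring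
    linarith [sq_nonneg (m * P - B / 2)]
  have amgm : ∀ x y : ℝ, m * (x * y) ≤ m * x ^ 2 + m * y ^ 2 := fun x y => by
    have h1 : m * x ^ 2 + m * y ^ 2 - m * (x * y) = m * ((x - y / 2) ^ 2 + 3 / 4 * y ^ 2) := by ring
    have h2 : 0 ≤ m * ((x - y / 2) ^ 2 + 3 / 4 * y ^ 2) := by positivity
    linarith
  have a2 : -(m ^ 2 / (2 * k) * I) ≤ m ^ 3 / (4 * k ^ 2) * W ^ 2 + m * Q ^ 2 := by
    have h1 : -(m ^ 2 / (2 * k) * I) ≤ m ^ 2 / (2 * κ) * (Q * W) := by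
      refine (neg_le_abs _).trans ?_
      rw [abs_mul, abs_div, abs_mul, abs_of_pos (pow_pos hm 2), abs_two, ← hκd]
      gcongr
    have h2 : m ^ 2 / (2 * κ) * (Q * W) = m * (Q * (m * W / (2 * κ))) := by
      field_simp
    have h3 : m ^ 3 / (4 * k ^ 2) * W ^ 2 = m * (m * W / (2 * κ)) ^ 2 := by
      rw [hkk]; field_simp; ring
    rw [h3]
    rw [h2] at h1
    linarith [amgm Q (m * W / (2 * κ))]
  have a3 : m ^ 2 * k / 2 * J ≤ m ^ 3 / 4 * P ^ 2 + m * k ^ 2 * B ^ 2 := by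
    have h1 : m ^ 2 * k / 2 * J ≤ m ^ 2 * κ / 2 * (P * B) := by
      refine (le_abs_self _).trans ?_
      rw [abs_mul, abs_div, abs_mul, abs_of_pos (pow_pos hm 2), abs_two, ← hκd]
      gcongr
    have h2 := amgm (m * P / 2) (κ * B)
    have h3 : m * (m * P / 2 * (κ * B)) = m ^ 2 * κ / 2 * (P * B) := by ring
    have h4 : m * (m * P / 2) ^ 2 + m * (κ * B) ^ 2 = m ^ 3 / 4 * P ^ 2 + m * κ ^ 2 * B ^ 2 := by
      ring
    rw [hkk]
    linarith
  have a4 : m ^ 2 * P ^ 2 * (1 / k ^ 2) ≤ m ^ 2 * P ^ 2 := by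
    refine mul_le_of_le_one_right (by positivity) ?_
    rw [div_le_one (by positivity)]; exact hk
  have a5 : 0 ≤ m ^ 2 * (k ^ 2 * N ^ 2) := by positivity
  have a6 : 0 ≤ m * N ^ 2 := by positivity
  have a7 : 0 ≤ m ^ 2 * P ^ 2 := by positivity
  rw [e1, e2, e3, neg_mul (m / 14), e4]
  have a8 : 2 * B * A ≤ B ^ 2 / 2 + 2 * A ^ 2 := by
    have h3 : (B - 2 * A) ^ 2 = B ^ 2 - 2 * (2 * B * A) + 4 * A ^ 2 := by ring
    linarith [sq_nonneg (B - 2 * A)]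
  have a9 := sq_nonneg B
  have a10 := sq_nonneg A
  linarith

/-- One implicit Euler step `w = u - h f` contracts the hypocoercive functional by the factor
`1 + 2 h r` with `r = √ν / 14`. -/
theorem ModeRelations.hypo_step {ν k : ℝ} {u yu yyu v yv s p p' yp f : E}
    (R : ModeRelations ν k u yu yyu v yv s p p' yp f) {yf pf p'f f' : E} {h : ℝ}
    (hν : 0 < ν) (hh : 0 ≤ h) (hk : 1 ≤ k ^ 2)
    (hyf : ⟪yu, yf⟫ = ⟪yyu, f⟫)
    (hpf : (⟪p', p'f⟫ + (k ^ 2 : ℝ) * ⟪p, pf⟫).re = ⟪p, f⟫.re)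
    (hvf : ⟪v, f'⟫ = -⟪s, f⟫) (hyuf : ⟪f', yu⟫ = -⟪f, u⟫ - ⟪f, yv⟫)
    (hvyf : ⟪v, yf⟫ = ⟪yv, f⟫) :
    (1 + 2 * h * (√ν / 14)) * hypo ν k u yu v p p' ≤
      hypo ν k (u - (h : ℂ) • f) (yu - (h : ℂ) • yf) (v - (h : ℂ) • f') (p - (h : ℂ) • pf)
        (p' - (h : ℂ) • p'f) := by
  have hk0 : k ≠ 0 := fun h => by rw [h] at hk; norm_num at hk
  set m := √ν with hm
  have hm0 : 0 < m := Real.sqrt_pos.2 hν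
  have hm2 : ν = m ^ 2 := (Real.sq_sqrt hν.le).symm
  have h1 := R.re_u_f
  have h2 := R.re_yyu_f
  have h3 : ⟪s, f⟫.re = ν * ‖s‖ ^ 2 + ν * k ^ 2 * ‖v‖ ^ 2 - 2 * k * ⟪v, yu⟫.im := by
    have e1 := congrArg Complex.re R.s_u
    have e2 := congrArg Complex.im R.s_p
    rw [Complex.neg_re, inner_self_re] at e1
    rw [Complex.sub_im, Complex.im_ofReal_mul, inner_self_im', inner_im_symm u p, R.p_u_im] at e2
    rw [R.re_inner, inner_self_re, e1, e2, R.s_yyu_im]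
    ring
  have h4 : ⟪u, f⟫.im + 2 * ⟪yv, f⟫.im = 2 * k * ‖yu‖ ^ 2 + 4 * k * ‖p'‖ ^ 2
      + 2 * ν * ⟪yv, s⟫.im - 2 * ν * k ^ 2 * ⟪v, yu⟫.im := by
    have e1 := congrArg Complex.im R.s_u
    have e2 := congrArg Complex.re R.yyu_u
    rw [Complex.neg_im, inner_self_im'] at e1
    rw [inner_self_re] at e2
    rw [R.im_inner, R.im_inner, inner_im_symm u s, e1, inner_self_im', inner_re_symm u yyu, e2,
      inner_re_symm u p, R.yv_u, R.yv_yyu, R.yv_p]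
    ring
  have h5 : ⟪v - (h : ℂ) • f', yu - (h : ℂ) • yf⟫.im = ⟪v, yu⟫.im
      - h * (⟪u, f⟫.im + 2 * ⟪yv, f⟫.im) + h ^ 2 * ⟪f', yf⟫.im := by
    rw [inner_sub_left, inner_sub_right, inner_sub_right, inner_smul_left, inner_smul_left,
      inner_smul_right, inner_smul_right, hyuf, hvyf]
    simp only [Complex.conj_ofReal, Complex.sub_im, Complex.im_ofReal_mul, Complex.neg_im]
    rw [inner_im_symm f u, inner_im_symm f yv]
    ring
  have h6 : ⟪v, f'⟫.re = -⟪s, f⟫.re := by rw [hvf, Complex.neg_re]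
  rw [Complex.add_re, Complex.re_ofReal_mul] at hpf
  have hexp : hypo ν k (u - (h : ℂ) • f) (yu - (h : ℂ) • yf) (v - (h : ℂ) • f')
      (p - (h : ℂ) • pf) (p' - (h : ℂ) • p'f) = hypo ν k u yu v p p'
      - 2 * h * (⟪u, f⟫.re + m / (4 * k ^ 2) * ⟪v, f'⟫.re
        - 1 / (4 * k) * (⟪u, f⟫.im + 2 * ⟪yv, f⟫.im)
        + 1 / m * (⟪yyu, f⟫.re + 2 * ⟪p, f⟫.re)) + h ^ 2 * hypo ν k f yf f' pf p'f := by
    simp only [hypo, norm_sub_smul_sq, h5, hyf, ← hpf, ← hm]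
    ring
  have hf0 : 0 ≤ hypo ν k f yf f' pf p'f :=
    le_trans (by positivity) (le_hypo hν hk0 f yf f' pf p'f)
  have hd := hypo_dissipation_le (N := ‖u‖) (m := m) hm0 hk (norm_nonneg yu) (norm_nonneg v)
    (abs_im_inner_le v yu) (abs_im_inner_le yv s)
    (R.norm_p_sq_le)
  have hle := hypo_le hν hk0 u yu v p p'
  rw [← hm] at hle
  have hq : ⟪u, f⟫.re + m / (4 * k ^ 2) * ⟪v, f'⟫.re - 1 / (4 * k) * (⟪u, f⟫.im + 2 * ⟪yv, f⟫.im)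
        + 1 / m * (⟪yyu, f⟫.re + 2 * ⟪p, f⟫.re) ≤ -(m / 14) * hypo ν k u yu v p p' := by
    refine le_trans (le_of_eq ?_) (hd.trans ?_)
    · rw [h1, h2, h4, h6, h3, hm2]; ring
    · rw [neg_mul, neg_mul, neg_le_neg_iff]; gcongr
  rw [hexp]
  have := mul_le_mul_of_nonneg_left hq hh
  have h7 : 0 ≤ h ^ 2 * hypo ν k f yf f' pf p'f := by positivity
  linarith

end Hilbert

/-! ### Weighted energy identities on the line -/

/-- Dilated cutoffs `χ (y / (n + 1))`, with their first two derivatives. -/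
theorem exists_cutoff : ∃ (χ χ' χ'' : ℕ → ℝ → ℝ) (C : ℝ), 0 ≤ C ∧
    (∀ n y, HasDerivAt (χ n) (χ' n y) y) ∧ (∀ n y, HasDerivAt (χ' n) (χ'' n y) y) ∧
    (∀ n, Continuous (χ'' n)) ∧ (∀ n, HasCompactSupport (χ n)) ∧
    (∀ n y, 0 ≤ χ n y ∧ χ n y ≤ 1 ∧ |χ' n y| ≤ C ∧ |χ'' n y| ≤ C) ∧
    ∀ y, ∀ᶠ n in atTop, χ n y = 1 ∧ χ' n y = 0 ∧ χ'' n y = 0 := by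
  let ρ : ContDiffBump (0 : ℝ) := ⟨1, 2, one_pos, one_lt_two⟩
  set f : ℝ → ℝ := fun y => ρ y with hf
  have hfs : ContDiff ℝ (⊤ : ℕ∞) f := ρ.contDiff
  have hfc : HasCompactSupport f := ρ.hasCompactSupport
  have hd1 := hasDerivAt_of_contDiff hfs
  have hd2 := hasDerivAt_of_contDiff (contDiff_deriv hfs)
  have hc1 := (contDiff_deriv hfs).continuous
  have hc2 := (contDiff_deriv (contDiff_deriv hfs)).continuous
  obtain ⟨C1, hC1⟩ := hfc.deriv.exists_bound_of_continuous hc1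
  obtain ⟨C2, hC2⟩ := hfc.deriv.deriv.exists_bound_of_continuous hc2
  have hs : ∀ (n : ℕ) (y : ℝ), HasDerivAt (fun y : ℝ => y / ((n : ℝ) + 1)) (1 / ((n : ℝ) + 1)) y :=
    fun n y => (hasDerivAt_id y).div_const _
  have hn0 : ∀ n : ℕ, (0 : ℝ) < (n : ℝ) + 1 := fun n => by positivity
  have hn1 : ∀ n : ℕ, 1 / ((n : ℝ) + 1) ≤ 1 := fun n => by
    rw [div_le_one (hn0 n)]; have : (0 : ℝ) ≤ n := n.cast_nonneg; linarith
  have hnn : ∀ n : ℕ, 0 ≤ 1 / ((n : ℝ) + 1) := fun n => by positivity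
  refine ⟨fun n y => f (y / ((n : ℝ) + 1)),
    fun n y => deriv f (y / ((n : ℝ) + 1)) * (1 / ((n : ℝ) + 1)),
    fun n y => deriv (deriv f) (y / ((n : ℝ) + 1)) * (1 / ((n : ℝ) + 1)) * (1 / ((n : ℝ) + 1)),
    |C1| + |C2|, by positivity, fun n y => (hd1 _).comp y (hs n y),
    fun n y => ((hd2 _).comp y (hs n y)).mul_const _, fun n => by fun_prop, fun n => ?_,
    fun n y => ⟨ρ.nonneg, ρ.le_one, ?_, ?_⟩, fun y => ?_⟩
  · have : (fun y : ℝ => f (y / ((n : ℝ) + 1))) = f ∘ (fun y : ℝ => ((n : ℝ) + 1)⁻¹ • y) := by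
      funext y; simp [div_eq_inv_mul]
    change HasCompactSupport (fun y : ℝ => f (y / ((n : ℝ) + 1)))
    rw [this]
    exact hfc.comp_smul (inv_ne_zero (hn0 n).ne')
  · rw [abs_mul, abs_of_nonneg (hnn n)]
    have h1 := hC1 (y / ((n : ℝ) + 1))
    rw [Real.norm_eq_abs] at h1
    have h2 := mul_le_mul h1 (hn1 n) (hnn n) ((abs_nonneg _).trans h1)
    linarith [le_abs_self C1, abs_nonneg C2]
  · rw [abs_mul, abs_mul, abs_of_nonneg (hnn n), mul_assoc]
    have h1 := hC2 (y / ((n : ℝ) + 1))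
    rw [Real.norm_eq_abs] at h1
    have h2 := mul_le_mul h1 (mul_le_one₀ (hn1 n) (hnn n) (hn1 n)) (mul_nonneg (hnn n) (hnn n))
      ((abs_nonneg _).trans h1)
    linarith [le_abs_self C2, abs_nonneg C1]
  · obtain ⟨N, hN⟩ := exists_nat_gt |y|
    filter_upwards [eventually_ge_atTop N] with n hn
    have hmem : y / ((n : ℝ) + 1) ∈ Metric.ball (0 : ℝ) 1 := by
      rw [mem_ball_zero_iff, Real.norm_eq_abs, abs_div, abs_of_pos (hn0 n), div_lt_one (hn0 n)]
      have : (N : ℝ) ≤ n := by exact_mod_cast hn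
      linarith
    have heq : f =ᶠ[𝓝 (y / ((n : ℝ) + 1))] fun _ => 1 := by
      filter_upwards [Metric.isOpen_ball.mem_nhds hmem] with z hz
      exact ρ.one_of_mem_closedBall (Metric.ball_subset_closedBall hz)
    have heq1 := heq.deriv
    have heq2 := heq1.deriv
    refine ⟨heq.eq_of_nhds, ?_, ?_⟩
    · rw [heq1.eq_of_nhds]; simp
    · rw [heq2.eq_of_nhds]; simp

/-- Fatou's lemma for Bochner integrals of nonnegative functions. -/
theorem integrable_of_tendsto_of_integral_le {f : ℝ → ℝ} {F : ℕ → ℝ → ℝ} {B : ℝ}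
    (hF : ∀ n, Integrable (F n)) (h0 : ∀ n y, 0 ≤ F n y)
    (hlim : ∀ y, Tendsto (fun n => F n y) atTop (𝓝 (f y))) (hB : ∀ n, ∫ y, F n y ≤ B) :
    Integrable f := by
  have hm : AEStronglyMeasurable f volume :=
    aestronglyMeasurable_of_tendsto_ae atTop (fun n => (hF n).1) (Eventually.of_forall hlim)
  have hf0 : ∀ y, 0 ≤ f y := fun y => ge_of_tendsto' (hlim y) fun n => h0 n y
  refine ⟨hm, ?_⟩
  rw [hasFiniteIntegral_iff_ofReal (Eventually.of_forall hf0)]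
  have h1 : ∫⁻ y, ENNReal.ofReal (f y) = ∫⁻ y, liminf (fun n => ENNReal.ofReal (F n y)) atTop :=
    lintegral_congr fun y => ((ENNReal.continuous_ofReal.tendsto _).comp (hlim y)).liminf_eq.symm
  rw [h1]
  refine lt_of_le_of_lt (lintegral_liminf_le' fun n => (hF n).1.aemeasurable.ennreal_ofReal) ?_
  have h2 : ∀ n, ∫⁻ y, ENNReal.ofReal (F n y) ≤ ENNReal.ofReal B := fun n => by
    rw [← ofReal_integral_eq_lintegral_ofReal (hF n) (Eventually.of_forall (h0 n))]
    exact ENNReal.ofReal_le_ofReal (hB n)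
  refine lt_of_le_of_lt (liminf_le_liminf (Eventually.of_forall h2)) ?_
  rw [liminf_const]
  exact ENNReal.ofReal_lt_top

variable {U V S : ℝ → ℂ}

theorem re_integral {f : ℝ → ℂ} (hf : Integrable f) : (∫ y, f y).re = ∫ y, (f y).re :=
  (integral_re hf).symm

theorem integrable_ofReal_mul {r : ℝ → ℝ} {f : ℝ → ℂ} (hr : Continuous r)
    (hs : HasCompactSupport r) (hf : Continuous f) : Integrable fun y => (r y : ℂ) * f y := by
  simpa using integrable_test_smul hf.locallyIntegrable hr hs

/-- The energy identity for `U'' = S`, tested with `ρ U`, where `ρ` has compact support. -/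
theorem energy_identity (hU : IsPrim U V) (hV : IsPrim V S) {ρ ρ' ρ'' : ℝ → ℝ}
    (h1 : ∀ y, HasDerivAt ρ (ρ' y) y) (h2 : ∀ y, HasDerivAt ρ' (ρ'' y) y) (h3 : Continuous ρ'')
    (hs : HasCompactSupport ρ) :
    ∫ y, ρ y * ‖V y‖ ^ 2 =
      (1 / 2) * (∫ y, ρ'' y * ‖U y‖ ^ 2) - ∫ y, ρ y * (S y * conj (U y)).re := by
  have c0 : Continuous ρ := continuous_iff_continuousAt.2 fun y => (h1 y).continuousAt
  have c1 : Continuous ρ' := continuous_iff_continuousAt.2 fun y => (h2 y).continuousAt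
  have e1 : ρ' = deriv ρ := funext fun y => (h1 y).deriv.symm
  have e2 : ρ'' = deriv ρ' := funext fun y => (h2 y).deriv.symm
  have s1 : HasCompactSupport ρ' := e1 ▸ hs.deriv
  have s2 : HasCompactSupport ρ'' := e2 ▸ s1.deriv
  have cU := hU.continuous
  have cV := hV.continuous
  have pρ := IsPrim.of_real_hasDerivAt h1 c1
  have pρ' := IsPrim.of_real_hasDerivAt h2 h3
  have p1 := pρ.mul (hV.mul hU.conjugate)
  have p2 := (pρ'.mul (hU.mul hU.conjugate)).const_mul (1 / 2)
  have p := p1.sub p2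
  have hSU : LocallyIntegrable (fun y => S y * conj (U y)) volume :=
    hV.locallyIntegrable.mul_continuous hU.conjugate.continuous
  have i1 : Integrable fun y => ρ y * (S y * conj (U y)).re := by
    have := (integrable_test_smul hSU c0 hs).re
    simpa using this
  have i2 : Integrable fun y => ρ y * ‖V y‖ ^ 2 :=
    (by fun_prop : Continuous fun y => ρ y * ‖V y‖ ^ 2).integrable_of_hasCompactSupport
      hs.mul_right
  have i3 : Integrable fun y => ρ'' y * ‖U y‖ ^ 2 :=
    (by fun_prop : Continuous fun y => ρ'' y * ‖U y‖ ^ 2).integrable_of_hasCompactSupport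
      s2.mul_right
  have hcc : Continuous fun y => conj (U y) := Complex.continuous_conj.comp cU
  have hcv : Continuous fun y => conj (V y) := Complex.continuous_conj.comp cV
  have j1 : Integrable fun y => (ρ' y : ℂ) * (V y * conj (U y)) :=
    integrable_ofReal_mul c1 s1 (by fun_prop)
  have j2 : Integrable fun y => (ρ y : ℂ) * (S y * conj (U y) + V y * conj (V y)) := by
    have a1 := integrable_test_smul hSU c0 hs
    have a2 : Integrable fun y => (ρ y : ℂ) * (V y * conj (V y)) :=
      integrable_ofReal_mul c0 hs (by fun_prop)
    refine (a1.add a2).congr (Eventually.of_forall fun y => ?_)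
    simp [mul_add]
  have j3 : Integrable fun y => (ρ'' y : ℂ) * (U y * conj (U y)) :=
    integrable_ofReal_mul h3 s2 (by fun_prop)
  have j4 : Integrable fun y => (ρ' y : ℂ) * (V y * conj (U y) + U y * conj (V y)) :=
    integrable_ofReal_mul c1 s1 (by fun_prop)
  have j5 : Integrable fun y => (ρ y : ℂ) * (V y * conj (U y)) :=
    integrable_ofReal_mul c0 hs (by fun_prop)
  have j6 : Integrable fun y => (ρ' y : ℂ) * (U y * conj (U y)) :=
    integrable_ofReal_mul c1 s1 (by fun_prop)
  have jD := (j1.add j2).sub ((j3.add j4).const_mul (1 / 2))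
  have key := p.integral_eq_zero (j5.sub (j6.const_mul _)) jD
  have hre := (re_integral jD).symm.trans (congrArg Complex.re key)
  have : ∀ y, ((ρ' y : ℂ) * (V y * conj (U y)) + (ρ y : ℂ) * (S y * conj (U y)
      + V y * conj (V y)) - 1 / 2 * ((ρ'' y : ℂ) * (U y * conj (U y)) +
      (ρ' y : ℂ) * (V y * conj (U y) + U y * conj (V y)))).re =
      ρ y * (S y * conj (U y)).re + ρ y * ‖V y‖ ^ 2 - (1 / 2) * (ρ'' y * ‖U y‖ ^ 2) := by
    intro y
    rw [Complex.sq_norm, Complex.sq_norm, Complex.normSq_apply, Complex.normSq_apply]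
    simp
    ring
  simp only [Pi.add_apply, Pi.sub_apply, this, Complex.zero_re] at hre
  rw [integral_sub (f := fun y => ρ y * (S y * conj (U y)).re + ρ y * ‖V y‖ ^ 2) (i1.add i2)
    (i3.const_mul _), integral_add i1 i2, integral_const_mul] at hre
  linarith

/-- The energy identity for `U'' = S` with a weight `w` whose derivatives are controlled by `w`. In
particular `V = U'` lies in the weighted space: this follows from Fatou's lemma. -/
theorem weighted_energy (hU : IsPrim U V) (hV : IsPrim V S) {w w' w'' : ℝ → ℝ}
    (h1 : ∀ y, HasDerivAt w (w' y) y) (h2 : ∀ y, HasDerivAt w' (w'' y) y) (h3 : Continuous w'')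
    (h0 : ∀ y, 0 ≤ w y) {C : ℝ} (b1 : ∀ y, |w' y| ≤ C * w y) (b2 : ∀ y, |w'' y| ≤ C * w y)
    (i1 : Integrable fun y => w y * ‖U y‖ ^ 2)
    (i2 : Integrable fun y => w y * (S y * conj (U y)).re) :
    Integrable (fun y => w y * ‖V y‖ ^ 2) ∧
      ∫ y, w y * ‖V y‖ ^ 2 =
        (1 / 2) * (∫ y, w'' y * ‖U y‖ ^ 2) - ∫ y, w y * (S y * conj (U y)).re := by
  obtain ⟨χ, χ', χ'', D, hD, d1, d2, d3, d4, d5, d6⟩ := exists_cutoff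
  have cU := hU.continuous
  have cV := hV.continuous
  have cw : Continuous w := continuous_iff_continuousAt.2 fun y => (h1 y).continuousAt
  have cw' : Continuous w' := continuous_iff_continuousAt.2 fun y => (h2 y).continuousAt
  have cχ : ∀ n, Continuous (χ n) := fun n =>
    continuous_iff_continuousAt.2 fun y => (d1 n y).continuousAt
  have cχ' : ∀ n, Continuous (χ' n) := fun n =>
    continuous_iff_continuousAt.2 fun y => (d2 n y).continuousAt
  have en := fun n => energy_identity hU hV (ρ := fun y => w y * χ n y)
    (ρ' := fun y => w' y * χ n y + w y * χ' n y)
    (ρ'' := fun y => (w'' y * χ n y + w' y * χ' n y) + (w' y * χ' n y + w y * χ'' n y))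
    (fun y => (h1 y).mul (d1 n y)) (fun y => ((h2 y).mul (d1 n y)).add ((h1 y).mul (d2 n y)))
    (by have := d3 n; have := cχ n; have := cχ' n; fun_prop) (d4 n).mul_left
  have l1 : Tendsto (fun n => ∫ y, ((w'' y * χ n y + w' y * χ' n y)
      + (w' y * χ' n y + w y * χ'' n y)) * ‖U y‖ ^ 2) atTop (𝓝 (∫ y, w'' y * ‖U y‖ ^ 2)) := by
    refine tendsto_integral_of_dominated_convergence
      (fun y => (C + 2 * C * D + D) * (w y * ‖U y‖ ^ 2)) (fun n => ?_) (i1.const_mul _)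
      (fun n => Eventually.of_forall fun y => ?_) (Eventually.of_forall fun y => ?_)
    · have := d3 n; have := cχ n; have := cχ' n
      exact Continuous.aestronglyMeasurable (by fun_prop)
    · obtain ⟨e1, e2, e3, e4⟩ := d5 n y
      rw [norm_mul, norm_pow, norm_norm, ← mul_assoc, Real.norm_eq_abs]
      refine mul_le_mul_of_nonneg_right ?_ (by positivity)
      have g0 := (abs_nonneg _).trans (b1 y)
      have k1 : |w'' y * χ n y| ≤ C * w y := by
        rw [abs_mul, abs_of_nonneg e1]
        exact (mul_le_of_le_one_right (abs_nonneg _) e2).trans (b2 y)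
      have k2 : |w' y * χ' n y| ≤ C * w y * D := by
        rw [abs_mul]; exact mul_le_mul (b1 y) e3 (abs_nonneg _) g0
      have k3 : |w y * χ'' n y| ≤ w y * D := by
        rw [abs_mul, abs_of_nonneg (h0 y)]; exact mul_le_mul_of_nonneg_left e4 (h0 y)
      have t1 := abs_add_le (w'' y * χ n y + w' y * χ' n y) (w' y * χ' n y + w y * χ'' n y)
      have t2 := abs_add_le (w'' y * χ n y) (w' y * χ' n y)
      have t3 := abs_add_le (w' y * χ' n y) (w y * χ'' n y)
      linarith
    · refine tendsto_const_nhds.congr' ?_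
      filter_upwards [d6 y] with n hn
      rw [hn.1, hn.2.1, hn.2.2]; ring
  have l2 : Tendsto (fun n => ∫ y, w y * χ n y * (S y * conj (U y)).re) atTop
      (𝓝 (∫ y, w y * (S y * conj (U y)).re)) := by
    refine tendsto_integral_of_dominated_convergence
      (fun y => ‖w y * (S y * conj (U y)).re‖) (fun n => ?_) i2.norm
      (fun n => Eventually.of_forall fun y => ?_) (Eventually.of_forall fun y => ?_)
    · have := (cχ n).aestronglyMeasurable (μ := volume).mul i2.1
      exact this.congr (Eventually.of_forall fun y => by simp only [Pi.mul_apply]; ring)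
    · obtain ⟨e1, e2, -⟩ := d5 n y
      rw [mul_right_comm, norm_mul, Real.norm_of_nonneg e1]
      exact mul_le_of_le_one_right (norm_nonneg _) e2
    · refine tendsto_const_nhds.congr' ?_
      filter_upwards [d6 y] with n hn
      rw [hn.1, mul_one]
  have l3 : Tendsto (fun n => ∫ y, w y * χ n y * ‖V y‖ ^ 2) atTop
      (𝓝 ((1 / 2) * (∫ y, w'' y * ‖U y‖ ^ 2) - ∫ y, w y * (S y * conj (U y)).re)) :=
    ((l1.const_mul _).sub l2).congr fun n => (en n).symm
  have hl : ∀ y, Tendsto (fun n => w y * χ n y * ‖V y‖ ^ 2) atTop (𝓝 (w y * ‖V y‖ ^ 2)) := by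
    intro y
    refine tendsto_const_nhds.congr' ?_
    filter_upwards [d6 y] with n hn
    rw [hn.1, mul_one]
  obtain ⟨B, hB⟩ := l3.bddAbove_range
  have hint : Integrable fun y => w y * ‖V y‖ ^ 2 := by
    refine integrable_of_tendsto_of_integral_le (fun n => ?_) (fun n y => ?_) hl
      (fun n => hB ⟨n, rfl⟩)
    · have := cχ n
      exact (by fun_prop : Continuous fun y => w y * χ n y * ‖V y‖ ^ 2)
        |>.integrable_of_hasCompactSupport ((d4 n).mul_left).mul_right
    · exact mul_nonneg (mul_nonneg (h0 y) (d5 n y).1) (by positivity)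
  refine ⟨hint, tendsto_nhds_unique ?_ l3⟩
  refine tendsto_integral_of_dominated_convergence
    (fun y => w y * ‖V y‖ ^ 2) (fun n => ?_) hint
    (fun n => Eventually.of_forall fun y => ?_) (Eventually.of_forall hl)
  · have := cχ n
    exact Continuous.aestronglyMeasurable (by fun_prop)
  · obtain ⟨e1, e2, -⟩ := d5 n y
    rw [Real.norm_of_nonneg (mul_nonneg (mul_nonneg (h0 y) e1) (by positivity))]
    exact mul_le_mul_of_nonneg_right (mul_le_of_le_one_right (h0 y) e2) (by positivity)

/-! ### Integration by parts in `L²` -/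

/-- Integration by parts with a real weight `c`. -/
theorem integral_by_parts {A A' B B' : ℝ → ℂ} (hA : IsPrim A A') (hB : IsPrim B B') {c c' : ℝ → ℝ}
    (hc : ∀ y, HasDerivAt c (c' y) y) (hc' : Continuous c')
    (i0 : Integrable fun y => (c y : ℂ) * (conj (A y) * B y))
    (i1 : Integrable fun y => (c' y : ℂ) * (conj (A y) * B y))
    (i2 : Integrable fun y => (c y : ℂ) * (conj (A' y) * B y))
    (i3 : Integrable fun y => (c y : ℂ) * (conj (A y) * B' y)) :
    (∫ y, (c' y : ℂ) * (conj (A y) * B y)) + (∫ y, (c y : ℂ) * (conj (A' y) * B y))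
      + (∫ y, (c y : ℂ) * (conj (A y) * B' y)) = 0 := by
  have p := (IsPrim.of_real_hasDerivAt hc hc').mul (hA.conjugate.mul hB)
  rw [← integral_add i1 i2]
  refine (integral_add (i1.add i2) i3).symm.trans ?_
  rw [← p.integral_eq_zero i0 (((i1.add i2).add i3).congr (Eventually.of_forall fun y => ?_))]
  · refine integral_congr_ae (Eventually.of_forall fun y => ?_)
    simp only [Pi.add_apply]; ring
  · simp only [Pi.add_apply]; ring

theorem inner_toLp {a b : ℝ → ℂ} (ha : MemLp a 2) (hb : MemLp b 2) :
    inner ℂ (ha.toLp a) (hb.toLp b) = ∫ y, conj (a y) * b y := by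
  rw [L2.inner_def]
  refine integral_congr_ae ?_
  filter_upwards [ha.coeFn_toLp, hb.coeFn_toLp] with y h1 h2
  rw [h1, h2, RCLike.inner_apply, mul_comm]

theorem integrable_conj_mul {a b : ℝ → ℂ} (ha : MemLp a 2) (hb : MemLp b 2) :
    Integrable fun y => conj (a y) * b y := by
  have := L2.integrable_inner (𝕜 := ℂ) (ha.toLp a) (hb.toLp b)
  refine this.congr ?_
  filter_upwards [ha.coeFn_toLp, hb.coeFn_toLp] with y h1 h2
  rw [h1, h2, RCLike.inner_apply, mul_comm]

theorem norm_toLp_sq {a : ℝ → ℂ} (ha : MemLp a 2) : ‖ha.toLp a‖ ^ 2 = ∫ y, ‖a y‖ ^ 2 := by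
  have h := inner_self_eq_norm_sq_to_K (𝕜 := ℂ) (ha.toLp a)
  rw [inner_toLp ha ha] at h
  have h2 : ∀ y, conj (a y) * a y = ((‖a y‖ ^ 2 : ℝ) : ℂ) := fun y => by
    rw [Complex.conj_mul']; simp
  simp only [h2] at h
  rw [integral_complex_ofReal] at h
  apply Complex.ofReal_injective
  push_cast
  exact h.symm

/-- Integration by parts with a real weight, in terms of inner products in `L²`: the pairs
`(aᵢ, bᵢ)` are the chosen factorisations into square integrable functions. -/
theorem inner_by_parts {A A' B B' : ℝ → ℂ} (hA : IsPrim A A') (hB : IsPrim B B') {c c' : ℝ → ℝ}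
    (hc : ∀ y, HasDerivAt c (c' y) y) (hc' : Continuous c') {a₀ b₀ a₁ b₁ a₂ b₂ a₃ b₃ : ℝ → ℂ}
    (ha₀ : MemLp a₀ 2) (hb₀ : MemLp b₀ 2) (ha₁ : MemLp a₁ 2) (hb₁ : MemLp b₁ 2)
    (ha₂ : MemLp a₂ 2) (hb₂ : MemLp b₂ 2) (ha₃ : MemLp a₃ 2) (hb₃ : MemLp b₃ 2)
    (e₀ : ∀ y, conj (a₀ y) * b₀ y = (c y : ℂ) * (conj (A y) * B y))
    (e₁ : ∀ y, conj (a₁ y) * b₁ y = (c' y : ℂ) * (conj (A y) * B y))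
    (e₂ : ∀ y, conj (a₂ y) * b₂ y = (c y : ℂ) * (conj (A' y) * B y))
    (e₃ : ∀ y, conj (a₃ y) * b₃ y = (c y : ℂ) * (conj (A y) * B' y)) :
    inner ℂ (ha₁.toLp a₁) (hb₁.toLp b₁) + inner ℂ (ha₂.toLp a₂) (hb₂.toLp b₂)
      + inner ℂ (ha₃.toLp a₃) (hb₃.toLp b₃) = 0 := by
  rw [inner_toLp, inner_toLp, inner_toLp]
  have i0 := integrable_conj_mul ha₀ hb₀
  have i1 := integrable_conj_mul ha₁ hb₁
  have i2 := integrable_conj_mul ha₂ hb₂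
  have i3 := integrable_conj_mul ha₃ hb₃
  simp only [e₀, e₁, e₂, e₃] at i0 i1 i2 i3 ⊢
  exact integral_by_parts hA hB hc hc' i0 i1 i2 i3

theorem hasDerivAt_one_add_sq (y : ℝ) : HasDerivAt (fun y : ℝ => 1 + y ^ 2) (2 * y) y := by
  simpa using (hasDerivAt_pow 2 y).const_add 1

theorem two_mul_abs_le (y : ℝ) : 2 * |y| ≤ 1 + y ^ 2 := by
  nlinarith [sq_nonneg (|y| - 1), sq_abs y]

theorem integrable_weight {a : ℝ → ℂ} (h : MemLp a 2) (h' : MemLp (fun y : ℝ => (y : ℂ) * a y) 2) :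
    Integrable fun y => (1 + y ^ 2) * ‖a y‖ ^ 2 := by
  refine ((h.integrable_norm_pow two_ne_zero).add (h'.integrable_norm_pow two_ne_zero)).congr
    (Eventually.of_forall fun y => ?_)
  simp only [Pi.add_apply, norm_mul, Complex.norm_real, mul_pow, Real.norm_eq_abs, sq_abs]
  ring

theorem memLp_of_integrable_weight {a : ℝ → ℂ} (hm : AEStronglyMeasurable a volume)
    (h : Integrable fun y => (1 + y ^ 2) * ‖a y‖ ^ 2) :
    MemLp a 2 ∧ MemLp (fun y : ℝ => (y : ℂ) * a y) 2 := by
  have hym : AEStronglyMeasurable (fun y : ℝ => (y : ℂ) * a y) volume :=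
    Complex.continuous_ofReal.aestronglyMeasurable.mul hm
  constructor
  · refine (memLp_two_iff_integrable_sq_norm hm).2 (h.mono' (hm.norm.pow 2)
      (Eventually.of_forall fun y => ?_))
    rw [norm_pow, norm_norm]
    nlinarith [mul_nonneg (sq_nonneg y) (sq_nonneg ‖a y‖)]
  · refine (memLp_two_iff_integrable_sq_norm hym).2 (h.mono' (hym.norm.pow 2)
      (Eventually.of_forall fun y => ?_))
    rw [norm_pow, norm_norm, norm_mul, mul_pow, Complex.norm_real, Real.norm_eq_abs, sq_abs]
    nlinarith [sq_nonneg ‖a y‖]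

theorem integrable_weight_re {a b : ℝ → ℂ} (ha : MemLp a 2) (ha' : MemLp (fun y : ℝ => (y : ℂ) * a y) 2)
    (hb : MemLp b 2) (hb' : MemLp (fun y : ℝ => (y : ℂ) * b y) 2) :
    Integrable fun y => (1 + y ^ 2) * (a y * conj (b y)).re := by
  refine ((integrable_conj_mul hb ha).re.add (integrable_conj_mul hb' ha').re).congr
    (Eventually.of_forall fun y => ?_)
  simp
  ring

/-! ### The mode equations and the regularity of their solutions -/

/-- The `k`-th mode `Φ = (k² - ∂ᵧ²)⁻¹ U` of the negative stream function of a vorticity with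
`k`-th mode `U`; `Φ'` is the derivative of `Φ`. -/
structure IsStreamMode (k : ℝ) (U Φ Φ' : ℝ → ℂ) : Prop where
  memLp : MemLp U 2
  memLp_y : MemLp (fun y : ℝ => (y : ℂ) * U y) 2
  memLp_phi : MemLp Φ 2
  memLp_y_phi : MemLp (fun y : ℝ => (y : ℂ) * Φ y) 2
  prim_phi : IsPrim Φ Φ'
  prim_phi' : IsPrim Φ' fun y => (k ^ 2 : ℂ) * Φ y - U y

namespace IsStreamMode

variable {k : ℝ} {U Φ Φ' : ℝ → ℂ}

/-- The derivative of the stream function lies in the weighted space, by the weighted energy identity. -/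
theorem memLp_phi' (H : IsStreamMode k U Φ Φ') :
    MemLp Φ' 2 ∧ MemLp (fun y : ℝ => (y : ℂ) * Φ' y) 2 := by
  refine memLp_of_integrable_weight H.prim_phi'.continuous.aestronglyMeasurable
    (weighted_energy H.prim_phi H.prim_phi' hasDerivAt_one_add_sq (w'' := fun _ => 2)
    (fun y => by simpa using (hasDerivAt_id y).const_mul 2) continuous_const
    (fun y => by positivity) (C := 2) (fun y => ?_) (fun y => ?_)
    (integrable_weight H.memLp_phi H.memLp_y_phi) (integrable_weight_re ?_ ?_
      H.memLp_phi H.memLp_y_phi)).1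
  · rw [abs_mul, abs_two]; nlinarith [two_mul_abs_le y]
  · rw [abs_two]; nlinarith [sq_nonneg y]
  · exact (H.memLp_phi.const_mul _).sub H.memLp
  · refine ((H.memLp_y_phi.const_mul (k ^ 2 : ℂ)).sub H.memLp_y).ae_eq
      (Eventually.of_forall fun y => ?_)
    simp only [Pi.sub_apply]; ring

end IsStreamMode

/-- The `k`-th mode of the resolvent equation: `U` is the mode of an element of the domain of `𝓛`
and `f` that of its image; `V = U'` and `S = U''`. -/
structure IsDomainMode (ν k : ℝ) (U V S Φ Φ' f : ℝ → ℂ) : Prop extends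
    IsStreamMode k U Φ Φ' where
  prim : IsPrim U V
  prim' : IsPrim V S
  memLp_f : MemLp f 2
  memLp_y_f : MemLp (fun y : ℝ => (y : ℂ) * f y) 2
  eqn : ∀ y, (ν : ℂ) * S y = (f y + (ν * k ^ 2 : ℂ) * U y + (2 * Complex.I * k) * Φ y)
    + (Complex.I * k) * ((y : ℂ) ^ 2 * U y)

namespace IsDomainMode

variable {ν k : ℝ} {U V S Φ Φ' f : ℝ → ℂ}

theorem memLp_rhs (H : IsDomainMode ν k U V S Φ Φ' f) :
    MemLp (fun y => f y + (ν * k ^ 2 : ℂ) * U y + (2 * Complex.I * k) * Φ y) 2 ∧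
    MemLp (fun y : ℝ => (y : ℂ) * (f y + (ν * k ^ 2 : ℂ) * U y + (2 * Complex.I * k) * Φ y)) 2 := by
  refine ⟨(H.memLp_f.add (H.memLp.const_mul _)).add (H.memLp_phi.const_mul _),
    ((H.memLp_y_f.add (H.memLp_y.const_mul (ν * k ^ 2 : ℂ))).add
      (H.memLp_y_phi.const_mul (2 * Complex.I * k))).ae_eq (Eventually.of_forall fun y => ?_)⟩
  simp only [Pi.add_apply]; ring

/-- The viscous term gives a weighted bound for `U'`. -/
theorem memLp_v (H : IsDomainMode ν k U V S Φ Φ' f) (hν : 0 < ν) :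
    MemLp V 2 ∧ MemLp (fun y : ℝ => (y : ℂ) * V y) 2 := by
  have hg := H.memLp_rhs
  refine memLp_of_integrable_weight H.prim'.continuous.aestronglyMeasurable
    (weighted_energy H.prim H.prim' hasDerivAt_one_add_sq (w'' := fun _ => 2)
    (fun y => by simpa using (hasDerivAt_id y).const_mul 2) continuous_const
    (fun y => by positivity) (C := 2) (fun y => ?_) (fun y => ?_)
    (integrable_weight H.memLp H.memLp_y) ?_).1
  · rw [abs_mul, abs_two]; nlinarith [two_mul_abs_le y]
  · rw [abs_two]; nlinarith [sq_nonneg y]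
  · refine ((integrable_weight_re hg.1 hg.2 H.memLp H.memLp_y).const_mul ν⁻¹).congr
      (Eventually.of_forall fun y => ?_)
    have h1 : S y = (ν : ℂ)⁻¹ * ((ν : ℂ) * S y) := by
      rw [← mul_assoc, inv_mul_cancel₀ (by exact_mod_cast hν.ne'), one_mul]
    have h2 : ((Complex.I * k) * ((y : ℂ) ^ 2 * U y) * conj (U y)).re = 0 := by
      have : (Complex.I * k) * ((y : ℂ) ^ 2 * U y) * conj (U y) =
          ((k * (y ^ 2 * Complex.normSq (U y)) : ℝ) : ℂ) * Complex.I := by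
        push_cast; rw [← Complex.mul_conj]; ring
      rw [this, Complex.re_ofReal_mul, Complex.I_re, mul_zero]
    have h3 : (S y * conj (U y)).re = ν⁻¹ * ((f y + (ν * k ^ 2 : ℂ) * U y +
        (2 * Complex.I * k) * Φ y) * conj (U y)).re := by
      rw [h1, H.eqn, mul_assoc, ← Complex.ofReal_inv, Complex.re_ofReal_mul, add_mul,
        Complex.add_re, h2, add_zero]
    simp only [h3]; ring

/-- Maximal regularity of a mode: `U''` and the transport term `y² U` are separately square integrable.
In the square of the equation, the cross term of `ν U''` and `i k y² U` is an integral of lower order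
after integration by parts. -/
theorem memLp_s (H : IsDomainMode ν k U V S Φ Φ' f) (hν : 0 < ν) : MemLp S 2 := by
  obtain ⟨χ, χ', χ'', D, hD, d1, d2, -, d4, d5, d6⟩ := exists_cutoff
  obtain ⟨hV, hyV⟩ := H.memLp_v hν
  set g : ℝ → ℂ := fun y => f y + (ν * k ^ 2 : ℂ) * U y + (2 * Complex.I * k) * Φ y with hgd
  have hg : MemLp g 2 := H.memLp_rhs.1
  have cU := H.prim.continuous
  have cV := H.prim'.continuous
  have cχ : ∀ n, Continuous (χ n) := fun n =>
    continuous_iff_continuousAt.2 fun y => (d1 n y).continuousAt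
  have cχ' : ∀ n, Continuous (χ' n) := fun n =>
    continuous_iff_continuousAt.2 fun y => (d2 n y).continuousAt
  have s' : ∀ n, HasCompactSupport (χ' n) := fun n => by
    have : χ' n = deriv (χ n) := funext fun y => (d1 n y).deriv.symm
    rw [this]; exact (d4 n).deriv
  have hSm : AEStronglyMeasurable S volume := H.prim'.locallyIntegrable.aestronglyMeasurable
  have hgi := hg.integrable_norm_pow two_ne_zero
  have hUi := integrable_weight H.memLp H.memLp_y
  have hVi := integrable_weight hV hyV
  set W : ℝ → ℝ := fun y => (1 + y ^ 2) * ‖V y‖ ^ 2 + (1 + y ^ 2) * ‖U y‖ ^ 2 with hW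
  have hWi : Integrable W := hVi.add hUi
  have hSg : ∀ y, ν * ‖S y‖ ≤ ‖g y‖ + |k| * (y ^ 2 * ‖U y‖) := fun y => by
    have h1 : ν * ‖S y‖ = ‖(ν : ℂ) * S y‖ := by simp [abs_of_pos hν]
    rw [h1, H.eqn]
    refine (norm_add_le _ _).trans_eq ?_
    simp [hgd]
  have hSi : ∀ n, Integrable fun y => χ n y * ‖S y‖ ^ 2 := fun n => by
    have c := cχ n
    have i1 : Integrable fun y => χ n y * (k ^ 2 * (y ^ 4 * ‖U y‖ ^ 2)) :=
      (by fun_prop : Continuous fun y => χ n y * (k ^ 2 * (y ^ 4 * ‖U y‖ ^ 2)))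
        |>.integrable_of_hasCompactSupport (d4 n).mul_right
    refine (((hgi.add i1).const_mul (2 * (ν⁻¹) ^ 2))).mono'
      (c.aestronglyMeasurable.mul (hSm.norm.pow 2)) (Eventually.of_forall fun y => ?_)
    obtain ⟨e1, e2, -⟩ := d5 n y
    rw [Real.norm_of_nonneg (by positivity)]
    simp only [Pi.add_apply]
    have h1 : ‖S y‖ ≤ ν⁻¹ * (‖g y‖ + |k| * (y ^ 2 * ‖U y‖)) := by
      rw [← inv_mul_cancel_left₀ hν.ne' ‖S y‖]
      exact mul_le_mul_of_nonneg_left (hSg y) (by positivity)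
    have h2 : ‖S y‖ ^ 2 ≤ (ν⁻¹) ^ 2 * (2 * (‖g y‖ ^ 2 + k ^ 2 * (y ^ 4 * ‖U y‖ ^ 2))) := by
      refine (pow_le_pow_left₀ (norm_nonneg _) h1 2).trans ?_
      rw [mul_pow]
      refine mul_le_mul_of_nonneg_left ?_ (by positivity)
      have := sq_nonneg (‖g y‖ - |k| * (y ^ 2 * ‖U y‖))
      have e : (|k| * (y ^ 2 * ‖U y‖)) ^ 2 = k ^ 2 * (y ^ 4 * ‖U y‖ ^ 2) := by
        rw [mul_pow, sq_abs]; ring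
      linarith [sq_nonneg (‖g y‖ - |k| * (y ^ 2 * ‖U y‖)), e,
        (by ring : (‖g y‖ - |k| * (y ^ 2 * ‖U y‖)) ^ 2 + (‖g y‖ + |k| * (y ^ 2 * ‖U y‖)) ^ 2 =
          2 * ‖g y‖ ^ 2 + 2 * (|k| * (y ^ 2 * ‖U y‖)) ^ 2)]
    calc χ n y * ‖S y‖ ^ 2
        ≤ χ n y * ((ν⁻¹) ^ 2 * (2 * (‖g y‖ ^ 2 + k ^ 2 * (y ^ 4 * ‖U y‖ ^ 2)))) :=
          mul_le_mul_of_nonneg_left h2 e1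
      _ = 2 * ν⁻¹ ^ 2 * (χ n y * ‖g y‖ ^ 2 + χ n y * (k ^ 2 * (y ^ 4 * ‖U y‖ ^ 2))) := by ring
      _ ≤ _ := by
          gcongr
          exact mul_le_of_le_one_left (by positivity) e2
  -- the contribution of the transport term is bounded by the weighted energy of `U` and `V`
  have hT : ∀ n, Integrable (fun y => ((y ^ 2 * χ n y : ℝ) : ℂ) * (conj (S y) * U y)) ∧
      ‖∫ y, ((y ^ 2 * χ n y : ℝ) : ℂ) * (conj (S y) * U y)‖ ≤ (2 + D) * ∫ y, W y := fun n => by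
    have c := cχ n
    have c' := cχ' n
    have hs : HasCompactSupport fun y => y ^ 2 * χ n y := (d4 n).mul_left
    have hs' : HasCompactSupport fun y => 2 * y * χ n y + y ^ 2 * χ' n y :=
      (d4 n).mul_left.add (s' n).mul_left
    have cV' : Continuous fun y => conj (V y) := Complex.continuous_conj.comp cV
    have i0 := integrable_ofReal_mul (f := fun y => conj (V y) * U y)
      (by fun_prop : Continuous fun y => y ^ 2 * χ n y) hs (by fun_prop)
    have i1 := integrable_ofReal_mul (f := fun y => conj (V y) * U y)
      (by fun_prop : Continuous fun y => 2 * y * χ n y + y ^ 2 * χ' n y) hs' (by fun_prop)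
    have i3 := integrable_ofReal_mul (f := fun y => conj (V y) * V y)
      (by fun_prop : Continuous fun y => y ^ 2 * χ n y) hs (by fun_prop)
    have i2 : Integrable fun y => ((y ^ 2 * χ n y : ℝ) : ℂ) * (conj (S y) * U y) := by
      have hl : LocallyIntegrable (fun y => conj (S y) * U y) volume :=
        H.prim'.conjugate.locallyIntegrable.mul_continuous cU
      simpa using integrable_test_smul hl
        (by fun_prop : Continuous fun y => y ^ 2 * χ n y) hs
    have key := integral_by_parts H.prim' H.prim (c := fun y => y ^ 2 * χ n y)
      (c' := fun y => 2 * y * χ n y + y ^ 2 * χ' n y)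
      (fun y => by simpa [Pi.mul_def] using (hasDerivAt_pow 2 y).mul (d1 n y)) (by fun_prop) i0 i1 i2 i3
    refine ⟨i2, ?_⟩
    have e : ∫ y, ((y ^ 2 * χ n y : ℝ) : ℂ) * (conj (S y) * U y) =
        -((∫ y, ((2 * y * χ n y + y ^ 2 * χ' n y : ℝ) : ℂ) * (conj (V y) * U y)) +
          ∫ y, ((y ^ 2 * χ n y : ℝ) : ℂ) * (conj (V y) * V y)) := by
      linear_combination key
    rw [e, norm_neg]
    refine (norm_add_le _ _).trans ?_
    have n1 : ‖∫ y, ((2 * y * χ n y + y ^ 2 * χ' n y : ℝ) : ℂ) * (conj (V y) * U y)‖ ≤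
        ∫ y, (1 + D) * W y := by
      refine norm_integral_le_of_norm_le (hWi.const_mul _) (Eventually.of_forall fun y => ?_)
      obtain ⟨e1, e2, e3, -⟩ := d5 n y
      rw [norm_mul, norm_mul, Complex.norm_real, RCLike.norm_conj, Real.norm_eq_abs]
      have a1 : |2 * y * χ n y + y ^ 2 * χ' n y| ≤ (1 + D) * (1 + y ^ 2) := by
        refine (abs_add_le _ _).trans ?_
        rw [abs_mul, abs_mul, abs_mul, abs_two, abs_of_nonneg e1, abs_of_nonneg (sq_nonneg y)]
        have := mul_le_mul (two_mul_abs_le y) e2 e1 (by positivity)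
        have := mul_le_mul_of_nonneg_left e3 (sq_nonneg y)
        nlinarith
      have a2 : ‖V y‖ * ‖U y‖ ≤ ‖V y‖ ^ 2 + ‖U y‖ ^ 2 := by
        nlinarith [sq_nonneg (‖V y‖ - ‖U y‖), sq_nonneg ‖V y‖, sq_nonneg ‖U y‖]
      refine (mul_le_mul a1 a2 (by positivity) (by positivity)).trans_eq ?_
      simp only [hW]; ring
    have n2 : ‖∫ y, ((y ^ 2 * χ n y : ℝ) : ℂ) * (conj (V y) * V y)‖ ≤ ∫ y, W y := by
      refine norm_integral_le_of_norm_le hWi (Eventually.of_forall fun y => ?_)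
      obtain ⟨e1, e2, -⟩ := d5 n y
      rw [norm_mul, norm_mul, Complex.norm_real, RCLike.norm_conj,
        Real.norm_of_nonneg (by positivity)]
      have := mul_le_of_le_one_right (sq_nonneg y) e2
      have := mul_le_mul_of_nonneg_right this (sq_nonneg ‖V y‖)
      have : 0 ≤ (1 + y ^ 2) * ‖U y‖ ^ 2 := by positivity
      simp only [hW]
      nlinarith [sq_nonneg ‖V y‖]
    rw [integral_const_mul] at n1
    linarith
  have hbound : ∀ n, ∫ y, χ n y * ‖S y‖ ^ 2 ≤
      (2 / ν) * ((1 / (2 * ν)) * (∫ y, ‖g y‖ ^ 2) + |k| * ((2 + D) * ∫ y, W y)) := fun n => by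
    obtain ⟨i2, hb⟩ := hT n
    have i4 := (i2.const_mul (Complex.I * k)).re
    have pt : ∀ y, (ν / 2) * (χ n y * ‖S y‖ ^ 2) ≤ (1 / (2 * ν)) * ‖g y‖ ^ 2 +
        (Complex.I * k * (((y ^ 2 * χ n y : ℝ) : ℂ) * (conj (S y) * U y))).re := fun y => by
      obtain ⟨e1, e2, -⟩ := d5 n y
      have h1 : (((ν : ℂ) * S y) * conj (S y)).re = ν * ‖S y‖ ^ 2 := by
        rw [mul_assoc, Complex.mul_conj', ← Complex.ofReal_pow, Complex.re_ofReal_mul,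
          Complex.ofReal_re]
      rw [H.eqn, add_mul, Complex.add_re] at h1
      have h2 : (g y * conj (S y)).re ≤ ‖g y‖ * ‖S y‖ := by
        refine (Complex.re_le_norm _).trans_eq ?_
        rw [norm_mul, RCLike.norm_conj]
      have h3 : (Complex.I * k * (((y ^ 2 * χ n y : ℝ) : ℂ) * (conj (S y) * U y))).re =
          χ n y * ((Complex.I * k) * ((y : ℂ) ^ 2 * U y) * conj (S y)).re := by
        rw [← Complex.re_ofReal_mul]; congr 1; push_cast; ring
      have h4 : ‖g y‖ * ‖S y‖ ≤ (1 / (2 * ν)) * ‖g y‖ ^ 2 + (ν / 2) * ‖S y‖ ^ 2 := by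
        have : 0 ≤ (1 / (2 * ν)) * (‖g y‖ - ν * ‖S y‖) ^ 2 := by positivity
        have e : (1 / (2 * ν)) * (‖g y‖ - ν * ‖S y‖) ^ 2 = (1 / (2 * ν)) * ‖g y‖ ^ 2
          - ‖g y‖ * ‖S y‖ + (ν / 2) * ‖S y‖ ^ 2 := by field_simp; ring
        linarith
      rw [h3]
      have h5 : (ν / 2) * ‖S y‖ ^ 2 ≤ (1 / (2 * ν)) * ‖g y‖ ^ 2
          + ((Complex.I * k) * ((y : ℂ) ^ 2 * U y) * conj (S y)).re := by
        have h1' : (g y * conj (S y)).re + ((Complex.I * k) * ((y : ℂ) ^ 2 * U y)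
          * conj (S y)).re = ν * ‖S y‖ ^ 2 := h1
        linarith
      have h6 := mul_le_mul_of_nonneg_left h5 e1
      have h7 : χ n y * ((1 / (2 * ν)) * ‖g y‖ ^ 2) ≤ (1 / (2 * ν)) * ‖g y‖ ^ 2 :=
        mul_le_of_le_one_left (by positivity) e2
      linarith
    have i5 : Integrable fun y =>
        (Complex.I * k * (((y ^ 2 * χ n y : ℝ) : ℂ) * (conj (S y) * U y))).re := i4
    have hm := integral_mono ((hSi n).const_mul (ν / 2)) ((hgi.const_mul _).add i5) pt
    simp only [Pi.add_apply] at hm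
    rw [integral_const_mul, integral_add (hgi.const_mul _) i5, integral_const_mul,
      ← re_integral (i2.const_mul (Complex.I * k)), integral_const_mul] at hm
    have h8 : (Complex.I * k * ∫ y, ((y ^ 2 * χ n y : ℝ) : ℂ) * (conj (S y) * U y)).re ≤
        |k| * ((2 + D) * ∫ y, W y) := by
      refine (Complex.re_le_norm _).trans ?_
      rw [norm_mul, norm_mul, Complex.norm_I, one_mul, Complex.norm_real, Real.norm_eq_abs]
      exact mul_le_mul_of_nonneg_left hb (abs_nonneg _)
    have h9 : ∫ y, χ n y * ‖S y‖ ^ 2 = (2 / ν) * ((ν / 2) * ∫ y, χ n y * ‖S y‖ ^ 2) := by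
      field_simp
    rw [h9]
    exact mul_le_mul_of_nonneg_left (hm.trans (by linarith)) (by positivity)
  refine (memLp_two_iff_integrable_sq_norm hSm).2 (integrable_of_tendsto_of_integral_le hSi
    (fun n y => mul_nonneg (d5 n y).1 (by positivity)) (fun y => ?_) hbound)
  refine tendsto_const_nhds.congr' ?_
  filter_upwards [d6 y] with n hn
  rw [hn.1, one_mul]

theorem memLp_yyu (H : IsDomainMode ν k U V S Φ Φ' f) (hν : 0 < ν) (hk : k ≠ 0) :
    MemLp (fun y : ℝ => (y : ℂ) ^ 2 * U y) 2 := by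
  refine ((((H.memLp_s hν).const_mul (ν : ℂ)).sub H.memLp_rhs.1).const_mul
    (Complex.I * k)⁻¹).ae_eq (Eventually.of_forall fun y => ?_)
  have hk' : Complex.I * (k : ℂ) ≠ 0 := mul_ne_zero Complex.I_ne_zero (by exact_mod_cast hk)
  simp only [Pi.sub_apply, H.eqn]
  rw [add_sub_cancel_left, inv_mul_cancel_left₀ hk']

end IsDomainMode

/-! ### Integrations by parts for a mode -/

theorem inner_toLp_congr {a b c d : ℝ → ℂ} (ha : MemLp a 2) (hb : MemLp b 2) (hc : MemLp c 2)
    (hd : MemLp d 2) (h : ∀ y, conj (a y) * b y = conj (c y) * d y) :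
    inner ℂ (ha.toLp a) (hb.toLp b) = inner ℂ (hc.toLp c) (hd.toLp d) := by
  rw [inner_toLp, inner_toLp]; simp only [h]

theorem toLp_sub_smul {a b c : ℝ → ℂ} {h : ℂ} (ha : MemLp a 2 volume) (hb : MemLp b 2 volume)
    (hc : MemLp c 2 volume) (e : ∀ y, a y - h * b y = c y) : ha.toLp a - h • hb.toLp b = hc.toLp c :=
  (MemLp.toLp_congr (ha.sub (hb.const_smul h)) hc (Eventually.of_forall e))

namespace IsStreamMode

variable {k : ℝ} {U Φ Φ' : ℝ → ℂ} (H : IsStreamMode k U Φ Φ')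

include H

/-- The quadratic form of `k² - ∂ᵧ²` represents the pairing with the vorticity. -/
theorem inner_phi {A A' : ℝ → ℂ} (hA : IsPrim A A') (mA : MemLp A 2) (mA' : MemLp A' 2) :
    inner ℂ (mA.toLp A) (H.memLp.toLp U) = inner ℂ (mA'.toLp A') (H.memLp_phi'.1.toLp Φ')
      + (k ^ 2 : ℝ) * inner ℂ (mA.toLp A) (H.memLp_phi.toLp Φ) := by
  have mc : MemLp (fun y => (k ^ 2 : ℂ) * Φ y - U y) 2 := (H.memLp_phi.const_mul _).sub H.memLp
  have h := inner_by_parts hA H.prim_phi' (c := fun _ => 1) (c' := fun _ => 0)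
    (fun y => hasDerivAt_const y 1) continuous_const mA H.memLp_phi'.1
    (MemLp.zero : MemLp (fun _ : ℝ => (0 : ℂ)) 2) H.memLp_phi'.1 mA' H.memLp_phi'.1 mA mc
    (fun y => by simp) (fun y => by simp) (fun y => by simp) (fun y => by simp)
  have e : mc.toLp _ = ((k ^ 2 : ℝ) : ℂ) • H.memLp_phi.toLp Φ - H.memLp.toLp U := by
    rw [← MemLp.toLp_const_smul, ← MemLp.toLp_sub]
    exact MemLp.toLp_congr _ _ (Eventually.of_forall fun y => by simp)
  have z : (MemLp.zero : MemLp (fun _ : ℝ => (0 : ℂ)) 2 volume).toLp _ = 0 := rfl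
  rw [e, inner_sub_right, inner_smul_right, z, inner_zero_left] at h
  linear_combination -h

theorem energy_eq : (inner ℂ (H.memLp_phi.toLp Φ) (H.memLp.toLp U)).re =
    ‖H.memLp_phi'.1.toLp Φ'‖ ^ 2 + k ^ 2 * ‖H.memLp_phi.toLp Φ‖ ^ 2 := by
  rw [H.inner_phi H.prim_phi H.memLp_phi H.memLp_phi'.1, Complex.add_re, Complex.re_ofReal_mul,
    inner_self_re, inner_self_re]

theorem energy_le (hk : 1 ≤ k ^ 2) :
    ‖H.memLp_phi'.1.toLp Φ'‖ ^ 2 + k ^ 2 * ‖H.memLp_phi.toLp Φ‖ ^ 2 ≤ ‖H.memLp.toLp U‖ ^ 2 := by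
  have h1 := H.energy_eq
  have h2 := (le_abs_self _).trans (abs_re_inner_le (H.memLp_phi.toLp Φ) (H.memLp.toLp U))
  set a := ‖H.memLp_phi.toLp Φ‖ with ha
  set b := ‖H.memLp.toLp U‖ with hb
  have h0 : 0 ≤ a := norm_nonneg _
  have hb0 : 0 ≤ b := norm_nonneg _
  have h3 : a ^ 2 ≤ k ^ 2 * a ^ 2 := le_mul_of_one_le_left (sq_nonneg _) hk
  have h4 : 0 ≤ ‖H.memLp_phi'.1.toLp Φ'‖ ^ 2 := by positivity
  have h5 : a ≤ b := by
    rcases eq_or_lt_of_le h0 with h | h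
    · rw [← h]; exact hb0
    · nlinarith
  nlinarith

end IsStreamMode

theorem hasDerivAt_sq' (y : ℝ) : HasDerivAt (fun y : ℝ => y ^ 2) (2 * y) y := by
  simpa using hasDerivAt_pow 2 y

theorem hasDerivAt_cube (y : ℝ) : HasDerivAt (fun y : ℝ => y ^ 3) (3 * y ^ 2) y := by
  simpa using hasDerivAt_pow 3 y

/-- Modes of elements of the domain satisfy the identities which the functionals use: each is one
integration by parts, all of whose terms are products of square integrable functions. -/
theorem IsDomainMode.relations {ν k : ℝ} {U V S Φ Φ' f : ℝ → ℂ}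
    (H : IsDomainMode ν k U V S Φ Φ' f) (hν : 0 < ν) (hk : k ≠ 0) :
    ModeRelations ν k (H.memLp.toLp U) (H.memLp_y.toLp _) ((H.memLp_yyu hν hk).toLp _)
      ((H.memLp_v hν).1.toLp V) ((H.memLp_v hν).2.toLp _) ((H.memLp_s hν).toLp S)
      (H.memLp_phi.toLp Φ) (H.memLp_phi'.1.toLp Φ') (H.memLp_y_phi.toLp _)
      (H.memLp_f.toLp f) := by
  have mz : MemLp (fun _ : ℝ => (0 : ℂ)) 2 volume := MemLp.zero
  have z : mz.toLp _ = 0 := rfl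
  have hmul : ∀ {a : ℝ → ℂ} (c : ℂ), MemLp a 2 volume → MemLp (fun y => c * a y) 2 :=
    fun c h => h.const_mul c
  have hsm : ∀ {a : ℝ → ℂ} (c : ℂ) (h : MemLp a 2 volume), (hmul c h).toLp _ = c • h.toLp a :=
    fun c h => (MemLp.toLp_const_smul c h)
  obtain ⟨hV, hyV⟩ := H.memLp_v hν
  have hS := H.memLp_s hν
  have hyy := H.memLp_yyu hν hk
  obtain ⟨hP', hyP'⟩ := H.memLp_phi'
  have hU := H.memLp
  have hyU := H.memLp_y
  have hP := H.memLp_phi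
  have hyP := H.memLp_y_phi
  have hQ : MemLp (fun y => (k ^ 2 : ℂ) * Φ y - U y) 2 := (hP.const_mul _).sub hU
  have hyQ : MemLp (fun y : ℝ => (y : ℂ) * ((k ^ 2 : ℂ) * Φ y - U y)) 2 :=
    ((hyP.const_mul (k ^ 2 : ℂ)).sub hyU).ae_eq (Eventually.of_forall fun y => by
      simp only [Pi.sub_apply]; ring)
  have eQ : hQ.toLp _ = ((k ^ 2 : ℝ) : ℂ) • hP.toLp Φ - hU.toLp U := by
    rw [← MemLp.toLp_const_smul, ← MemLp.toLp_sub]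
    exact MemLp.toLp_congr _ _ (Eventually.of_forall fun y => by simp)
  have eyQ : hyQ.toLp _ = ((k ^ 2 : ℝ) : ℂ) • hyP.toLp _ - hyU.toLp _ := by
    rw [← MemLp.toLp_const_smul, ← MemLp.toLp_sub]
    exact MemLp.toLp_congr _ _ (Eventually.of_forall fun y => by simp; ring)
  have pU := H.prim
  have pV := H.prim'
  have pP := H.prim_phi
  have pP' := H.prim_phi'
  have c1 : ∀ y : ℝ, HasDerivAt (fun _ : ℝ => (1 : ℝ)) ((fun _ : ℝ => (0 : ℝ)) y) y :=
    fun y => hasDerivAt_const y 1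
  have cy : ∀ y : ℝ, HasDerivAt (fun y : ℝ => y) ((fun _ : ℝ => (1 : ℝ)) y) y := hasDerivAt_id
  have h1 := H.inner_phi pU hU hV
  have h2 := H.inner_phi pP hP hP'
  refine ⟨?_, ?_, ?_, ?_, h2, ?_, ?_, ?_, ?_, ?_, ?_, ?_⟩
  · rw [← MemLp.toLp_const_smul, ← MemLp.toLp_const_smul, ← MemLp.toLp_const_smul,
      ← MemLp.toLp_const_smul, ← MemLp.toLp_sub, ← MemLp.toLp_sub, ← MemLp.toLp_sub]
    refine MemLp.toLp_congr _ _ (Eventually.of_forall fun y => ?_)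
    have := H.eqn y
    simp only [Pi.sub_apply, Pi.smul_apply, smul_eq_mul]
    linear_combination -this
  · have h := inner_by_parts pV pU c1 continuous_const hV hU mz mz hS hU hV hV
      (fun y => by simp) (fun y => by simp) (fun y => by simp) (fun y => by simp)
    rw [z, inner_zero_left] at h
    linear_combination h
  · exact inner_toLp_congr _ _ _ _ fun y => by simp; ring
  · exact inner_toLp_congr _ _ _ _ fun y => by simp; ring
  · have h3 := inner_by_parts pV pP c1 continuous_const hV hP mz mz hS hP hV hP'
      (fun y => by simp) (fun y => by simp) (fun y => by simp) (fun y => by simp)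
    rw [z, inner_zero_left] at h3
    linear_combination h3 + h1
  · have h3 := inner_by_parts pV pU hasDerivAt_sq' (by fun_prop) hyV hyU hV (hmul 2 hyU) hS hyy
      hyV hyV (fun y => by simp; ring) (fun y => by simp; ring) (fun y => by simp; ring)
      (fun y => by simp; ring)
    have h4 := inner_by_parts pU pU cy (by fun_prop) hyU hU hU hU hV hyU hyU hV
      (fun y => by simp; ring) (fun y => by simp) (fun y => by ring) (fun y => by simp; ring)
    rw [hsm 2 hyU, inner_smul_right] at h3
    have r3 := congrArg Complex.re h3
    have r4 := congrArg Complex.re h4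
    simp only [Complex.add_re, Complex.zero_re, inner_self_re] at r3 r4
    rw [inner_re_symm (hyU.toLp _)] at r4
    have e : ((2 : ℂ) * inner ℂ (hV.toLp V) (hyU.toLp _)).re =
        2 * (inner ℂ (hV.toLp V) (hyU.toLp _)).re := by simp
    linarith
  · have h3 := inner_by_parts pV pU hasDerivAt_sq' (by fun_prop) hyV hyU hV (hmul 2 hyU) hS hyy
      hyV hyV (fun y => by simp; ring) (fun y => by simp; ring) (fun y => by simp; ring)
      (fun y => by simp; ring)
    rw [hsm 2 hyU, inner_smul_right] at h3
    have r3 := congrArg Complex.im h3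
    simp only [Complex.add_im, Complex.zero_im, inner_self_im'] at r3
    have e : ((2 : ℂ) * inner ℂ (hV.toLp V) (hyU.toLp _)).im =
        2 * (inner ℂ (hV.toLp V) (hyU.toLp _)).im := by simp
    linarith
  · have h3 := inner_by_parts pU pU hasDerivAt_cube (by fun_prop) hyU hyy hyU (hmul 3 hyU) hyV hyy
      hyy hyV (fun y => by simp; ring) (fun y => by simp; ring) (fun y => by simp; ring)
      (fun y => by simp; ring)
    rw [hsm 3 hyU, inner_smul_right] at h3
    have r3 := congrArg Complex.re h3
    simp only [Complex.add_re, Complex.zero_re] at r3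
    rw [inner_re_symm (hyy.toLp _)] at r3
    have e : ((3 : ℂ) * inner ℂ (hyU.toLp _) (hyU.toLp _)).re =
        3 * ‖hyU.toLp _‖ ^ 2 := by
      rw [← inner_self_re]; simp
    linarith
  · have h3 := inner_by_parts pU pP cy (by fun_prop) hyU hP hU hP hyV hP hU hyP'
      (fun y => by simp; ring) (fun y => by simp) (fun y => by simp; ring) (fun y => by ring)
    have h4 := inner_by_parts pP pP cy (by fun_prop) hyP hP hP hP hP' hyP hyP hP'
      (fun y => by simp; ring) (fun y => by simp) (fun y => by ring) (fun y => by simp; ring)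
    have h5 := inner_by_parts pP' pP' cy (by fun_prop) hyP' hP' hP' hP' hQ hyP' hyP' hQ
      (fun y => by simp; ring) (fun y => by simp) (fun y => by simp; ring) (fun y => by simp; ring)
    have h6 : inner ℂ (hP.toLp Φ) (hyP'.toLp _) = inner ℂ (hyP.toLp _) (hP'.toLp _) :=
      inner_toLp_congr _ _ _ _ fun y => by simp; ring
    have h7 : inner ℂ (hyP'.toLp _) (hU.toLp U) = inner ℂ (hP'.toLp _) (hyU.toLp _) :=
      inner_toLp_congr _ _ _ _ fun y => by simp; ring
    have h8 : inner ℂ (hyP'.toLp _) (hP.toLp Φ) = inner ℂ (hP'.toLp _) (hyP.toLp _) :=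
      inner_toLp_congr _ _ _ _ fun y => by simp; ring
    rw [eQ, inner_sub_right, inner_sub_left, inner_smul_left, inner_smul_right, h7, h8] at h5
    have r2 := congrArg Complex.re h2
    have r3 := congrArg Complex.re h3
    have r4 := congrArg Complex.re h4
    have r5 := congrArg Complex.re h5
    simp only [Complex.add_re, Complex.sub_re, Complex.zero_re, inner_self_re, Complex.conj_ofReal,
      Complex.re_ofReal_mul] at r2 r3 r4 r5
    rw [inner_re_symm (hyP.toLp _)] at r4
    rw [inner_re_symm (hU.toLp U) (hyP'.toLp _), h7] at r5
    rw [inner_re_symm (hP.toLp Φ) (hyP'.toLp _), h8] at r5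
    rw [inner_re_symm (hU.toLp U) (hP.toLp Φ), inner_re_symm (hU.toLp U) (hyP'.toLp _), h7] at r3
    linear_combination r3 + (1 / 2) * r5 - (k ^ 2 / 2) * r4 - (1 / 2) * r2
  · have h4 := inner_by_parts pP pP cy (by fun_prop) hyP hP hP hP hP' hyP hyP hP'
      (fun y => by simp; ring) (fun y => by simp) (fun y => by ring) (fun y => by simp; ring)
    have r4 := congrArg Complex.re h4
    simp only [Complex.add_re, Complex.zero_re, inner_self_re] at r4
    rw [inner_re_symm (hyP.toLp _)] at r4
    linarith
  · have h3 := inner_by_parts pP' pP hasDerivAt_sq' (by fun_prop) hyP' hyP hP' (hmul 2 hyP) hyQ hyP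
      hyP' hyP' (fun y => by simp; ring) (fun y => by simp; ring) (fun y => by simp; ring)
      (fun y => by simp; ring)
    rw [hsm 2 hyP, inner_smul_right, eyQ, inner_sub_left, inner_smul_left] at h3
    have r3 := congrArg Complex.re h3
    simp only [Complex.add_re, Complex.sub_re, Complex.zero_re, inner_self_re, Complex.conj_ofReal,
      Complex.re_ofReal_mul] at r3
    have e : ((2 : ℂ) * inner ℂ (hP'.toLp _) (hyP.toLp _)).re =
        2 * (inner ℂ (hP'.toLp _) (hyP.toLp _)).re := by simp
    have : 0 ≤ ‖hyP'.toLp _‖ ^ 2 := by positivity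
    linarith

/-! ### Decay of a mode under the implicit Euler scheme -/

open Classical in
/-- The class in `L²` of a function, and `0` if the function is not square integrable. -/
noncomputable def toL2 (a : ℝ → ℂ) : Lp ℂ 2 (volume : Measure ℝ) :=
  if h : MemLp a 2 then h.toLp a else 0

theorem toL2_eq {a : ℝ → ℂ} (h : MemLp a 2) : toL2 a = h.toLp a := dif_pos h

theorem inner_toL2 {a b : ℝ → ℂ} (ha : MemLp a 2) (hb : MemLp b 2) :
    inner ℂ (toL2 a) (toL2 b) = ∫ y, conj (a y) * b y := by
  rw [toL2_eq ha, toL2_eq hb, inner_toLp]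

theorem inner_toL2_congr {a b c d : ℝ → ℂ} (ha : MemLp a 2) (hb : MemLp b 2) (hc : MemLp c 2)
    (hd : MemLp d 2) (h : ∀ y, conj (a y) * b y = conj (c y) * d y) :
    inner ℂ (toL2 a) (toL2 b) = inner ℂ (toL2 c) (toL2 d) := by
  rw [inner_toL2 ha hb, inner_toL2 hc hd]; simp only [h]

theorem toL2_sub_smul {a b c : ℝ → ℂ} {h : ℂ} (ha : MemLp a 2 volume) (hb : MemLp b 2 volume)
    (hc : MemLp c 2 volume) (e : ∀ y, a y - h * b y = c y) :
    toL2 a - h • toL2 b = toL2 c := by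
  rw [toL2_eq ha, toL2_eq hb, toL2_eq hc, toLp_sub_smul ha hb hc e]

/-- The weighted energy `‖U‖² + ‖yU‖²` of a mode, its contribution to the square of the norm
of `X`. -/
noncomputable def modeNorm (U : ℝ → ℂ) : ℝ :=
  ‖toL2 U‖ ^ 2 + ‖toL2 fun y : ℝ => (y : ℂ) * U y‖ ^ 2

theorem modeNorm_eq {U : ℝ → ℂ} (h : MemLp U 2) (h' : MemLp (fun y : ℝ => (y : ℂ) * U y) 2) :
    modeNorm U = ∫ y, (1 + y ^ 2) * ‖U y‖ ^ 2 := by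
  rw [modeNorm, toL2_eq h, toL2_eq h', norm_toLp_sq, norm_toLp_sq,
    ← integral_add (h.integrable_norm_pow two_ne_zero) (h'.integrable_norm_pow two_ne_zero)]
  refine integral_congr_ae (Eventually.of_forall fun y => ?_)
  simp only [norm_mul, Complex.norm_real, mul_pow, Real.norm_eq_abs, sq_abs]
  ring

theorem modeNorm_nonneg (U : ℝ → ℂ) : 0 ≤ modeNorm U := by unfold modeNorm; positivity

/-- The energy `‖U‖² + ‖yU‖² + 2 (‖Φ'‖² + k²‖Φ‖²)`, which the inviscid flow conserves. -/
noncomputable def modeEnergy (k : ℝ) (U Φ Φ' : ℝ → ℂ) : ℝ :=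
  modeNorm U + 2 * (‖toL2 Φ'‖ ^ 2 + k ^ 2 * ‖toL2 Φ‖ ^ 2)

/-- The hypocoercive functional of a mode. -/
noncomputable def modeHypo (ν k : ℝ) (U V Φ Φ' : ℝ → ℂ) : ℝ :=
  hypo ν k (toL2 U) (toL2 fun y : ℝ => (y : ℂ) * U y) (toL2 V) (toL2 Φ) (toL2 Φ')

theorem IsStreamMode.modeEnergy_le {k : ℝ} {U Φ Φ' : ℝ → ℂ} (H : IsStreamMode k U Φ Φ')
    (hk : 1 ≤ k ^ 2) : modeEnergy k U Φ Φ' ≤ 3 * modeNorm U := by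
  have h1 := H.energy_le hk
  rw [← toL2_eq, ← toL2_eq, ← toL2_eq] at h1
  have h2 : 0 ≤ ‖toL2 fun y : ℝ => (y : ℂ) * U y‖ ^ 2 := by positivity
  rw [modeEnergy, modeNorm]
  linarith

theorem IsStreamMode.sub_div {k : ℝ} {U Φ Φ' U₀ Φ₀ Φ₀' : ℝ → ℂ} (H : IsStreamMode k U Φ Φ')
    (H₀ : IsStreamMode k U₀ Φ₀ Φ₀') (h : ℝ) :
    IsStreamMode k (fun y => (U y - U₀ y) / h) (fun y => (Φ y - Φ₀ y) / h)
      (fun y => (Φ' y - Φ₀' y) / h) := by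
  have e : ∀ {a b : ℝ → ℂ}, MemLp (fun y : ℝ => (y : ℂ) * a y) 2 volume →
      MemLp (fun y : ℝ => (y : ℂ) * b y) 2 volume →
      MemLp (fun y : ℝ => (y : ℂ) * ((a y - b y) / h)) 2 volume := fun ha hb =>
    ((ha.sub hb).mul_const (h : ℂ)⁻¹).ae_eq (Eventually.of_forall fun y => by
      simp only [Pi.sub_apply]; ring)
  refine ⟨?_, e H.memLp_y H₀.memLp_y, ?_, e H.memLp_y_phi H₀.memLp_y_phi, ?_, ?_⟩
  · simpa [div_eq_mul_inv] using (H.memLp.sub H₀.memLp).mul_const (h : ℂ)⁻¹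
  · simpa [div_eq_mul_inv] using (H.memLp_phi.sub H₀.memLp_phi).mul_const (h : ℂ)⁻¹
  · simpa [div_eq_inv_mul] using (H.prim_phi.sub H₀.prim_phi).const_mul (h : ℂ)⁻¹
  · have := (H.prim_phi'.sub H₀.prim_phi').const_mul (h : ℂ)⁻¹
    simp only [div_eq_inv_mul]
    refine this.congr_ae (Eventually.of_forall fun y => ?_)
    simp only; ring

theorem IsDomainMode.relations_toL2 {ν k : ℝ} {U V S Φ Φ' f : ℝ → ℂ}
    (H : IsDomainMode ν k U V S Φ Φ' f) (hν : 0 < ν) (hk : k ≠ 0) :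
    ModeRelations ν k (toL2 U) (toL2 fun y : ℝ => (y : ℂ) * U y)
      (toL2 fun y : ℝ => (y : ℂ) ^ 2 * U y) (toL2 V) (toL2 fun y : ℝ => (y : ℂ) * V y) (toL2 S)
      (toL2 Φ) (toL2 Φ') (toL2 fun y : ℝ => (y : ℂ) * Φ y) (toL2 f) := by
  rw [toL2_eq H.memLp, toL2_eq H.memLp_y, toL2_eq (H.memLp_yyu hν hk), toL2_eq (H.memLp_v hν).1,
    toL2_eq (H.memLp_v hν).2, toL2_eq (H.memLp_s hν), toL2_eq H.memLp_phi, toL2_eq H.memLp_phi'.1,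
    toL2_eq H.memLp_y_phi, toL2_eq H.memLp_f]
  exact H.relations hν hk

section Step

variable {ν k h : ℝ} {U V S Φ Φ' U₀ V₀ S₀ Φ₀ Φ₀' f₀ : ℝ → ℂ}

theorem phi_relation (H : IsDomainMode ν k U V S Φ Φ' fun y => (U y - U₀ y) / h)
    (H₀ : IsStreamMode k U₀ Φ₀ Φ₀') :
    (inner ℂ (toL2 Φ') (toL2 fun y => (Φ' y - Φ₀' y) / h) +
      (k ^ 2 : ℝ) * inner ℂ (toL2 Φ) (toL2 fun y => (Φ y - Φ₀ y) / h)).re =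
    (inner ℂ (toL2 Φ) (toL2 fun y => (U y - U₀ y) / h)).re := by
  have Hf := H.toIsStreamMode.sub_div H₀ h
  rw [toL2_eq H.memLp_phi, toL2_eq H.memLp_phi'.1, toL2_eq Hf.memLp_phi, toL2_eq Hf.memLp_phi'.1,
    toL2_eq Hf.memLp, Hf.inner_phi H.prim_phi H.memLp_phi H.memLp_phi'.1]

/-- The energy is nonincreasing along the implicit Euler scheme and controls the dissipation. The initial
datum `U₀` need not be in the domain. -/
theorem modeEnergy_step (H : IsDomainMode ν k U V S Φ Φ' fun y => (U y - U₀ y) / h)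
    (H₀ : IsStreamMode k U₀ Φ₀ Φ₀') (hν : 0 < ν) (hk : k ≠ 0) (hh : 0 < h) :
    modeEnergy k U Φ Φ' + 2 * h * ν * ‖toL2 V‖ ^ 2 ≤ modeEnergy k U₀ Φ₀ Φ₀' := by
  have Hf := H.toIsStreamMode.sub_div H₀ h
  have hh' : (h : ℂ) ≠ 0 := by exact_mod_cast hh.ne'
  have key := (H.relations_toL2 hν hk).energy_step
    (yf := toL2 fun y : ℝ => (y : ℂ) * ((U y - U₀ y) / h)) hν.le hh.le
    (inner_toL2_congr H.memLp_y Hf.memLp_y (H.memLp_yyu hν hk) H.memLp_f fun y => by simp; ring)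
    (phi_relation H H₀)
  rw [toL2_sub_smul H.memLp Hf.memLp H₀.memLp fun y => by field_simp; ring,
    toL2_sub_smul H.memLp_y Hf.memLp_y H₀.memLp_y fun y => by field_simp; ring,
    toL2_sub_smul H.memLp_phi Hf.memLp_phi H₀.memLp_phi fun y => by field_simp; ring,
    toL2_sub_smul H.memLp_phi'.1 Hf.memLp_phi'.1 H₀.memLp_phi'.1 fun y => by field_simp; ring]
    at key
  rw [modeEnergy, modeEnergy, modeNorm, modeNorm]
  linarith

/-- The hypocoercive functional contracts along the implicit Euler scheme. It is only defined for data
with a derivative, whence the assumption on `U₀`. -/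
theorem modeHypo_step (H : IsDomainMode ν k U V S Φ Φ' fun y => (U y - U₀ y) / h)
    (H₀ : IsDomainMode ν k U₀ V₀ S₀ Φ₀ Φ₀' f₀) (hν : 0 < ν) (hk : 1 ≤ k ^ 2) (hh : 0 < h) :
    (1 + 2 * h * (√ν / 14)) * modeHypo ν k U V Φ Φ' ≤ modeHypo ν k U₀ V₀ Φ₀ Φ₀' := by
  have hk0 : k ≠ 0 := fun h => by rw [h] at hk; norm_num at hk
  have Hf := H.toIsStreamMode.sub_div H₀.toIsStreamMode h
  have hh' : (h : ℂ) ≠ 0 := by exact_mod_cast hh.ne'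
  obtain ⟨hV, hyV⟩ := H.memLp_v hν
  obtain ⟨hV₀, -⟩ := H₀.memLp_v hν
  have hf' : MemLp (fun y => (V y - V₀ y) / h) 2 := by
    simpa [div_eq_mul_inv] using (hV.sub hV₀).mul_const (h : ℂ)⁻¹
  have pf : IsPrim (fun y => (U y - U₀ y) / h) (fun y => (V y - V₀ y) / h) := by
    simpa [div_eq_inv_mul] using (H.prim.sub H₀.prim).const_mul (h : ℂ)⁻¹
  have mz : MemLp (fun _ : ℝ => (0 : ℂ)) 2 volume := MemLp.zero
  have z : mz.toLp _ = 0 := rfl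
  have h1 := inner_by_parts H.prim' pf (c := fun _ => 1) (c' := fun _ => 0)
    (fun y => hasDerivAt_const y 1) continuous_const hV Hf.memLp mz mz (H.memLp_s hν) Hf.memLp hV hf'
      (fun y => by simp) (fun y => by simp) (fun y => by simp) (fun y => by simp)
  rw [z, inner_zero_left] at h1
  have h2 := inner_by_parts pf H.prim (c := fun y => y) (c' := fun _ => 1)
    (fun y => hasDerivAt_id y) continuous_const Hf.memLp H.memLp_y Hf.memLp H.memLp hf' H.memLp_y
      Hf.memLp hyV (fun y => by ring) (fun y => by simp) (fun y => by ring) (fun y => by ring)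
  have key := (H.relations_toL2 hν hk0).hypo_step (f' := toL2 fun y => (V y - V₀ y) / h)
    (yf := toL2 fun y : ℝ => (y : ℂ) * ((U y - U₀ y) / h)) hν hh.le hk
    (inner_toL2_congr H.memLp_y Hf.memLp_y (H.memLp_yyu hν hk0) H.memLp_f fun y => by simp; ring)
    (phi_relation H H₀.toIsStreamMode)
    (by rw [toL2_eq hV, toL2_eq hf', toL2_eq (H.memLp_s hν), toL2_eq H.memLp_f]
        linear_combination h1)
    (by rw [toL2_eq hf', toL2_eq H.memLp_y, toL2_eq H.memLp_f, toL2_eq H.memLp, toL2_eq hyV]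
        linear_combination h2)
    (inner_toL2_congr hV Hf.memLp_y hyV H.memLp_f fun y => by simp; ring)
  rwa [toL2_sub_smul H.memLp Hf.memLp H₀.memLp fun y => by field_simp; ring,
    toL2_sub_smul H.memLp_y Hf.memLp_y H₀.memLp_y fun y => by field_simp; ring,
    toL2_sub_smul hV hf' hV₀ fun y => by field_simp; ring,
    toL2_sub_smul H.memLp_phi Hf.memLp_phi H₀.memLp_phi fun y => by field_simp; ring,
    toL2_sub_smul H.memLp_phi'.1 Hf.memLp_phi'.1 H₀.memLp_phi'.1 fun y => by field_simp; ring]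
    at key

end Step

/-- Decay of a mode under the implicit Euler scheme of step `h`. The first bound is the energy
estimate. For the second, the energy dissipation provides one among the first `⌈1 / h⌉` steps at which
`U'`, and with it the hypocoercive functional, is bounded by a multiple of `‖U 0‖² / √ν`; from then on
the functional decays. -/
theorem modeNorm_le {ν k h : ℝ} (hν : 0 < ν) (hν1 : ν < 1) (hk : 1 ≤ k ^ 2) (hh : 0 < h)
    (hh1 : h ≤ 1) {U V S Φ Φ' : ℕ → ℝ → ℂ} (H₀ : IsStreamMode k (U 0) (Φ 0) (Φ' 0))
    (H : ∀ n, IsDomainMode ν k (U (n + 1)) (V (n + 1)) (S (n + 1)) (Φ (n + 1)) (Φ' (n + 1))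
      fun y => (U (n + 1) y - U n y) / h) (n : ℕ) :
    modeNorm (U n) ≤ 3 * modeNorm (U 0) ∧
      modeNorm (U n) * (1 + 2 * h * (√ν / 14)) ^ n ≤ 15 / √ν * modeNorm (U 0) := by
  have hk0 : k ≠ 0 := fun h => by rw [h] at hk; norm_num at hk
  set m := √ν with hm
  have hm0 : 0 < m := Real.sqrt_pos.2 hν
  have hm2 : ν = m ^ 2 := (Real.sq_sqrt hν.le).symm
  have hm1 : m < 1 := by nlinarith
  have HS : ∀ n, IsStreamMode k (U n) (Φ n) (Φ' n) := fun n => by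
    cases n with
    | zero => exact H₀
    | succ n => exact (H n).toIsStreamMode
  set E : ℕ → ℝ := fun n => modeEnergy k (U n) (Φ n) (Φ' n) with hE
  set P : ℕ → ℝ := fun n => ‖toL2 (V n)‖ ^ 2 with hP
  set K : ℕ → ℝ := fun n => modeHypo ν k (U n) (V n) (Φ n) (Φ' n) with hK
  set W : ℕ → ℝ := fun n => modeNorm (U n) with hW
  have hW0 : ∀ n, 0 ≤ W n := fun n => modeNorm_nonneg _
  have WE : ∀ n, W n ≤ E n := fun n => by
    simp only [hE, hW, modeEnergy]
    have : 0 ≤ 2 * (‖toL2 (Φ' n)‖ ^ 2 + k ^ 2 * ‖toL2 (Φ n)‖ ^ 2) := by positivity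
    linarith
  have EW : E 0 ≤ 3 * W 0 := H₀.modeEnergy_le hk
  have hP0 : ∀ n, 0 ≤ P n := fun n => by positivity
  have step : ∀ n, E (n + 1) + 2 * h * ν * P (n + 1) ≤ E n := fun n =>
    modeEnergy_step (H n) (HS n) hν hk0 hh
  have sum : ∀ n, E n + 2 * h * ν * ∑ j ∈ Finset.range n, P (j + 1) ≤ E 0 := fun n => by
    induction n with
    | zero => simp
    | succ n ih => rw [Finset.sum_range_succ]; linarith [step n]
  have Eanti : ∀ n, E n ≤ E 0 := fun n => by
    have := sum n
    have : 0 ≤ 2 * h * ν * ∑ j ∈ Finset.range n, P (j + 1) :=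
      mul_nonneg (by positivity) (Finset.sum_nonneg fun j _ => hP0 _)
    linarith
  have first : ∀ n, W n ≤ 3 * W 0 := fun n => (WE n).trans ((Eanti n).trans EW)
  refine ⟨first n, ?_⟩
  set ρ : ℝ := 1 + 2 * h * (m / 14) with hρ
  have hρ1 : 1 ≤ ρ := by rw [hρ]; have : 0 ≤ 2 * h * (m / 14) := by positivity
                         linarith
  -- `N` steps amount to a time between `1` and `2`, during which `ρ ^ N` stays bounded.
  set N : ℕ := ⌈1 / h⌉₊ with hN
  have hN1 : 1 / h ≤ N := Nat.le_ceil _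
  have hN2 : (N : ℝ) < 1 / h + 1 := Nat.ceil_lt_add_one (by positivity)
  have hNh : 1 ≤ N * h := by rwa [div_le_iff₀ hh] at hN1
  have hNh2 : h * N ≤ 2 := by
    have := mul_lt_mul_of_pos_left hN2 hh
    rw [mul_add, mul_one_div_cancel hh.ne'] at this
    linarith
  have hNpos : 0 < N := Nat.ceil_pos.2 (by positivity)
  have hρN : ρ ^ N ≤ 7 / 5 := by
    have h1 : ρ ^ N ≤ Real.exp (2 / 7) := by
      calc ρ ^ N ≤ Real.exp (2 * h * (m / 14)) ^ N := by
            refine pow_le_pow_left₀ (by linarith) ?_ N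
            rw [hρ, add_comm]; exact Real.add_one_le_exp _
        _ = Real.exp (N * (2 * h * (m / 14))) := (Real.exp_nat_mul _ _).symm
        _ ≤ Real.exp (2 / 7) := Real.exp_le_exp.2 (by nlinarith)
    have h2 : (5 / 7 : ℝ) ≤ Real.exp (-(2 / 7)) := by
      have := Real.add_one_le_exp (-(2 / 7) : ℝ); linarith
    have h3 : Real.exp (2 / 7) * Real.exp (-(2 / 7)) = 1 := by rw [← Real.exp_add]; simp
    have h4 := Real.exp_pos (2 / 7)
    nlinarith
  have hm' : 1 ≤ 1 / m := by rw [le_div_iff₀ hm0]; linarith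
  have hW15 : W 0 ≤ 1 / m * W 0 := le_mul_of_one_le_left (hW0 0) hm'
  rcases le_or_gt n N with hn | hn
  · have h1 : ρ ^ n ≤ 7 / 5 := (pow_le_pow_right₀ hρ1 hn).trans hρN
    calc W n * ρ ^ n ≤ (3 * W 0) * (7 / 5) :=
          mul_le_mul (first n) h1 (by positivity) (by have := hW0 0; positivity)
      _ ≤ 15 * (1 / m * W 0) := by linarith [hW0 0]
      _ = 15 / m * W 0 := by ring
  -- At some early step the dissipation is at most its average.
  · obtain ⟨j, hj, hPj⟩ : ∃ j ∈ Finset.range N, P (j + 1) ≤ E 0 / (2 * ν) := by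
      refine Finset.exists_le_of_sum_le ⟨0, Finset.mem_range.2 hNpos⟩ ?_
      rw [Finset.sum_const, Finset.card_range, nsmul_eq_mul, mul_div_assoc',
        le_div_iff₀ (by positivity)]
      have h1 := sum N
      have h2 := (hW0 N).trans (WE N)
      have hs : 0 ≤ ∑ j ∈ Finset.range N, P (j + 1) := Finset.sum_nonneg fun j _ => hP0 _
      have h3 : h * (∑ j ∈ Finset.range N, P (j + 1)) * (2 * ν) ≤ E 0 := by linarith
      have h4 := mul_le_mul_of_nonneg_left h3 (Nat.cast_nonneg (α := ℝ) N)
      have h5 : (∑ j ∈ Finset.range N, P (j + 1)) * (2 * ν) ≤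
          (N * h) * ((∑ j ∈ Finset.range N, P (j + 1)) * (2 * ν)) :=
        le_mul_of_one_le_left (by positivity) hNh
      linarith
    rw [Finset.mem_range] at hj
    have hKj : K (j + 1) ≤ 1 / m * (27 / 16 * E 0) := by
      have h1 := hypo_le hν hk0 (toL2 (U (j + 1))) (toL2 fun y : ℝ => (y : ℂ) * U (j + 1) y)
        (toL2 (V (j + 1))) (toL2 (Φ (j + 1))) (toL2 (Φ' (j + 1)))
      have h2 := Eanti (j + 1)
      simp only [hE, modeEnergy, modeNorm] at h2
      have h3 : (3 / 2) * (√ν / (4 * k ^ 2) * ‖toL2 (V (j + 1))‖ ^ 2) ≤ 1 / m * (3 / 16 * E 0) := by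
        rw [← hm]
        have hE0 : 0 ≤ E 0 := (hW0 0).trans (WE 0)
        have a1 : m / (4 * k ^ 2) ≤ m / 4 := by
          refine div_le_div_of_nonneg_left hm0.le (by norm_num) (by linarith)
        have a2 : m / (4 * k ^ 2) * P (j + 1) ≤ m / 4 * (E 0 / (2 * ν)) :=
          mul_le_mul a1 hPj (hP0 _) (by positivity)
        have a3 : m / 4 * (E 0 / (2 * ν)) = 1 / m * (1 / 8 * E 0) := by
          rw [hm2]; field_simp; ring
        rw [a3] at a2
        linarith
      have h4 : ‖toL2 (U (j + 1))‖ ^ 2 ≤ 1 / m * ‖toL2 (U (j + 1))‖ ^ 2 :=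
        le_mul_of_one_le_left (by positivity) hm'
      have h5 : 1 / m * ((3 / 2) * ‖toL2 (U (j + 1))‖ ^ 2
          + (3 / 2) * ‖toL2 fun y : ℝ => (y : ℂ) * U (j + 1) y‖ ^ 2
          + 3 * (‖toL2 (Φ' (j + 1))‖ ^ 2 + k ^ 2 * ‖toL2 (Φ (j + 1))‖ ^ 2)) ≤
          1 / m * (3 / 2 * E 0) :=
        mul_le_mul_of_nonneg_left (by simp only [hE, modeEnergy, modeNorm]; linarith)
          (by positivity)
      have h6 : 0 ≤ 1 / m * (‖toL2 (Φ' (j + 1))‖ ^ 2 + k ^ 2 * ‖toL2 (Φ (j + 1))‖ ^ 2) := by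
        positivity
      have h7 : 0 ≤ 1 / m * ‖toL2 (U (j + 1))‖ ^ 2 := by positivity
      simp only [hK, modeHypo]
      rw [← hm] at h1
      linarith
    have hKstep : ∀ i, K (j + i + 1) * ρ ^ i ≤ K (j + 1) := fun i => by
      induction i with
      | zero => simp
      | succ i ih =>
        have := modeHypo_step (H (j + i + 1)) (H (j + i)) hν hk hh
        calc K (j + (i + 1) + 1) * ρ ^ (i + 1) = (ρ * K (j + i + 1 + 1)) * ρ ^ i := by
              rw [pow_succ]; change K (j + i + 1 + 1) * _ = _; ring
          _ ≤ K (j + i + 1) * ρ ^ i :=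
              mul_le_mul_of_nonneg_right this (pow_nonneg (by linarith) i)
          _ ≤ _ := ih
    obtain ⟨i, rfl⟩ : ∃ i, n = j + i + 1 := ⟨n - (j + 1), by omega⟩
    have hWK : W (j + i + 1) ≤ 2 * K (j + i + 1) := by
      have h1 := le_hypo hν hk0 (toL2 (U (j + i + 1)))
        (toL2 fun y : ℝ => (y : ℂ) * U (j + i + 1) y)
        (toL2 (V (j + i + 1))) (toL2 (Φ (j + i + 1))) (toL2 (Φ' (j + i + 1)))
      rw [← hm] at h1
      have h4 : ‖toL2 fun y : ℝ => (y : ℂ) * U (j + i + 1) y‖ ^ 2 ≤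
          1 / m * ‖toL2 fun y : ℝ => (y : ℂ) * U (j + i + 1) y‖ ^ 2 :=
        le_mul_of_one_le_left (by positivity) hm'
      have h5 : 0 ≤ ‖toL2 (U (j + i + 1))‖ ^ 2 := by positivity
      simp only [hK, hW, modeHypo, modeNorm]
      linarith
    have hρi : ρ ^ (j + 1) ≤ 7 / 5 := (pow_le_pow_right₀ hρ1 (by omega)).trans hρN
    have hi : W (j + i + 1) * ρ ^ i ≤ 1 / m * (81 / 8 * W 0) := by
      have h1 := mul_le_mul_of_nonneg_right hWK (pow_nonneg (by linarith : (0 : ℝ) ≤ ρ) i)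
      have h2 := hKstep i
      have h3 : 1 / m * (27 / 16 * E 0) ≤ 1 / m * (27 / 16 * (3 * W 0)) :=
        mul_le_mul_of_nonneg_left (by linarith) (by positivity)
      linarith
    calc W (j + i + 1) * ρ ^ (j + i + 1) = (W (j + i + 1) * ρ ^ i) * ρ ^ (j + 1) := by
          ring
      _ ≤ (1 / m * (81 / 8 * W 0)) * (7 / 5) :=
          mul_le_mul hi hρi (by positivity) (by have := hW0 0; positivity)
      _ ≤ 15 * (1 / m * W 0) := by
          have := hW0 0
          have : 0 ≤ 1 / m * W 0 := by positivity
          linarith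
      _ = 15 / m * W 0 := by ring

/-! ### Fourier modes in the periodic variable -/

/-- The `k`-th Fourier coefficient in `x` of a function on `𝕋 × ℝ`. -/
noncomputable def mode (F : Dom → ℝ) (k : ℤ) (y : ℝ) : ℂ :=
  fourierCoeff (fun x : Torus => (F (x, y) : ℂ)) k

theorem mode_eq (F : Dom → ℝ) (k : ℤ) (y : ℝ) :
    mode F k y = (2 * Real.pi)⁻¹ • ∫ x : Torus, fourier (-k) x * (F (x, y) : ℂ) := by
  rw [mode, fourierCoeff, AddCircle.integral_haarAddCircle]; rfl

theorem mode_mul (a : ℝ → ℝ) (F : Dom → ℝ) (k : ℤ) (y : ℝ) :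
    mode (fun p => a p.2 * F p) k y = a y * mode F k y := by
  rw [mode, mode, ← fourierCoeff.const_mul]; push_cast; rfl

theorem mode_zero_eq_xMean (F : Dom → ℝ) (y : ℝ) : mode F 0 y = xMean F y := by
  rw [mode_eq, xMean]
  simp [integral_complex_ofReal]

theorem aestronglyMeasurable_mode {F : Dom → ℝ} (hF : AEStronglyMeasurable F volume) (k : ℤ) :
    AEStronglyMeasurable (mode F k) volume := by
  have h1 : AEStronglyMeasurable (fun p : Dom => fourier (-k) p.1 * (F p : ℂ)) volume :=
    (by fun_prop : Continuous fun p : Dom => fourier (-k) p.1).aestronglyMeasurable.mul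
      (Complex.continuous_ofReal.comp_aestronglyMeasurable hF)
  have h2 := (AEStronglyMeasurable.prod_swap (μ := (volume : Measure ℝ))
    (ν := (volume : Measure Torus)) h1).integral_prod_right'
  refine (h2.const_smul (2 * Real.pi)⁻¹).congr (Eventually.of_forall fun y => ?_)
  simp only [mode_eq, Pi.smul_apply, Prod.swap_prod_mk]

theorem ae_memLp_section {F : Dom → ℝ} (hF : MemLp F 2 volume) :
    ∀ᵐ y : ℝ, MemLp (fun x : Torus => F (x, y)) 2 volume := by
  filter_upwards [AEStronglyMeasurable.prodMk_right (μ := (volume : Measure Torus))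
    (ν := (volume : Measure ℝ)) hF.1, Integrable.prod_left_ae (μ := (volume : Measure Torus))
    (ν := (volume : Measure ℝ)) hF.integrable_sq] with y h1 h2
  exact (memLp_two_iff_integrable_sq h1).2 h2

theorem hasSum_mode_section {f : Torus → ℝ} (hf : MemLp f 2 volume) :
    HasSum (fun k : ℤ => ‖fourierCoeff (fun x => (f x : ℂ)) k‖ ^ 2)
      ((2 * Real.pi)⁻¹ * ∫ x, f x ^ 2) := by
  have h1 : MemLp (fun x => (f x : ℂ)) 2 AddCircle.haarAddCircle :=
    memLp_haarAddCircle_iff.2 hf.ofReal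
  have h2 := hasSum_sq_fourierCoeff (h1.toLp _)
  rw [fourierCoeff_congr_ae h1.coeFn_toLp] at h2
  convert h2 using 1
  rw [← smul_eq_mul, ← AddCircle.integral_haarAddCircle]
  refine integral_congr_ae ?_
  filter_upwards [h1.coeFn_toLp] with x hx
  rw [hx, Complex.norm_real, Real.norm_eq_abs, sq_abs]

theorem memLp_mode {F : Dom → ℝ} (hF : MemLp F 2 volume) (k : ℤ) : MemLp (mode F k) 2 := by
  have hm := aestronglyMeasurable_mode hF.1 k
  refine (memLp_two_iff_integrable_sq_norm hm).2 ?_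
  refine ((Integrable.integral_prod_right (μ := (volume : Measure Torus))
    (ν := (volume : Measure ℝ)) hF.integrable_sq).const_mul (2 * Real.pi)⁻¹).mono' (hm.norm.pow 2) ?_
  filter_upwards [ae_memLp_section hF] with y hy
  rw [norm_pow, norm_norm]
  have h := hasSum_mode_section hy
  exact le_hasSum h k fun j _ => by positivity

/-- Parseval's identity in the periodic variable. -/
theorem hasSum_mode {F : Dom → ℝ} (hF : MemLp F 2 volume) :
    HasSum (fun k : ℤ => 2 * Real.pi * ∫ y, ‖mode F k y‖ ^ 2) (∫ p, F p ^ 2) := by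
  have hI := Integrable.integral_prod_right (μ := (volume : Measure Torus))
    (ν := (volume : Measure ℝ)) hF.integrable_sq
  have hi : ∀ k, Integrable fun y => ‖mode F k y‖ ^ 2 := fun k =>
    (memLp_mode hF k).integrable_norm_pow two_ne_zero
  have hs : Summable fun k : ℤ => ∫ y, ‖‖mode F k y‖ ^ 2‖ := by
    refine summable_of_sum_le (c := ∫ y : ℝ, (2 * Real.pi)⁻¹ * ∫ x : Torus, F (x, y) ^ 2)
      (fun k => by positivity) fun u => ?_
    rw [← integral_finsetSum _ fun k _ => (hi k).norm]
    refine integral_mono_ae (integrable_finsetSum _ fun k _ => (hi k).norm) (hI.const_mul _) ?_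
    filter_upwards [ae_memLp_section hF] with y hy
    simp only [norm_pow, norm_norm]
    exact sum_le_hasSum u (fun k _ => by positivity) (hasSum_mode_section hy)
  have h := (hasSum_integral_of_summable_integral_norm hi hs).mul_left (2 * Real.pi)
  have e : 2 * Real.pi * ∫ y, ∑' k : ℤ, ‖mode F k y‖ ^ 2 = ∫ p, F p ^ 2 := by
    have e1 : ∫ y, ∑' k : ℤ, ‖mode F k y‖ ^ 2 =
        ∫ y : ℝ, (2 * Real.pi)⁻¹ * ∫ x : Torus, F (x, y) ^ 2 := by
      refine integral_congr_ae ?_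
      filter_upwards [ae_memLp_section hF] with y hy
      exact (hasSum_mode_section hy).tsum_eq
    rw [e1, integral_const_mul, mul_inv_cancel_left₀ Real.two_pi_pos.ne']
    exact (integral_prod_symm (μ := (volume : Measure Torus)) (ν := (volume : Measure ℝ))
      (fun p : Dom => F p ^ 2) hF.integrable_sq).symm
  rwa [e] at h

theorem ae_eq_zero_of_mode {F : Dom → ℝ} (hF : MemLp F 2 volume) (h : ∀ k, mode F k =ᵐ[volume] 0) :
    F =ᵐ[volume] 0 := by
  have h1 := hasSum_mode hF
  have h2 : (fun k : ℤ => 2 * Real.pi * ∫ y, ‖mode F k y‖ ^ 2) = fun _ => 0 := by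
    funext k
    have : ∫ y, ‖mode F k y‖ ^ 2 = ∫ _ : ℝ, (0 : ℝ) := by
      refine integral_congr_ae ?_
      filter_upwards [h k] with y hy
      simp [hy]
    rw [this, integral_zero, mul_zero]
  rw [h2] at h1
  have h3 := h1.unique hasSum_zero
  rw [integral_eq_zero_iff_of_nonneg (fun p => by positivity) hF.integrable_sq] at h3
  filter_upwards [h3] with p hp
  exact pow_eq_zero_iff two_ne_zero |>.1 hp

/-- Functions which are square integrable on `𝕋 × ℝ` up to a factor of polynomial growth. -/
def IsTempered (F : Dom → ℝ) : Prop :=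
  MemLp (fun p : Dom => ((1 + p.2 ^ 2) ^ 2)⁻¹ * F p) 2 volume

namespace IsTempered

variable {F G : Dom → ℝ}

theorem of_le (hG : MemLp G 2 volume) (hF : AEStronglyMeasurable F volume)
    (h : ∀ p, |F p| ≤ (1 + p.2 ^ 2) ^ 2 * |G p|) : IsTempered F := by
  refine hG.of_le_mul (c := 1) ?_ (Eventually.of_forall fun p => ?_)
  · exact (Continuous.aestronglyMeasurable (by
      refine Continuous.inv₀ (by fun_prop) fun p => by positivity)).mul hF
  · have : 0 < (1 + p.2 ^ 2) ^ 2 := by positivity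
    rw [norm_mul, norm_inv, Real.norm_of_nonneg this.le, one_mul, Real.norm_eq_abs, Real.norm_eq_abs,
      inv_mul_le_iff₀ this]
    exact h p

theorem of_memLp (hF : MemLp F 2 volume) : IsTempered F :=
  of_le hF hF.1 fun p => le_mul_of_one_le_left (abs_nonneg _) (by
    nlinarith [sq_nonneg p.2, sq_nonneg (p.2 ^ 2)])

theorem zero : IsTempered fun _ => 0 := of_memLp MemLp.zero

theorem const_mul (c : ℝ) (hF : IsTempered F) : IsTempered fun p => c * F p :=
  (MemLp.const_mul hF c).ae_eq (Eventually.of_forall fun p => by ring)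

theorem mode_apply (F : Dom → ℝ) (k : ℤ) (y : ℝ) : mode F k y =
    (((1 + y ^ 2) ^ 2 : ℝ) : ℂ) * mode (fun p : Dom => ((1 + p.2 ^ 2) ^ 2)⁻¹ * F p) k y := by
  have := mode_mul (fun y => ((1 + y ^ 2) ^ 2)⁻¹) F k y
  rw [this, ← mul_assoc, ← Complex.ofReal_mul, mul_inv_cancel₀ (by positivity), Complex.ofReal_one,
    one_mul]

theorem locallyIntegrable_mode (hF : IsTempered F) (k : ℤ) :
    LocallyIntegrable (mode F k) volume := by
  have h := (memLp_mode hF k).locallyIntegrable (by norm_num)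
  have e : mode F k = fun y => mode (fun p : Dom => ((1 + p.2 ^ 2) ^ 2)⁻¹ * F p) k y *
      (((1 + y ^ 2) ^ 2 : ℝ) : ℂ) := funext fun y => by rw [mode_apply, mul_comm]
  rw [e]
  exact h.mul_continuous (by fun_prop)

theorem ae_integrable_section (hF : IsTempered F) :
    ∀ᵐ y : ℝ, Integrable (fun x : Torus => (F (x, y) : ℂ)) AddCircle.haarAddCircle := by
  filter_upwards [ae_memLp_section hF] with y hy
  have h1 : MemLp (fun x : Torus => ((((1 + y ^ 2) ^ 2)⁻¹ * F (x, y) : ℝ) : ℂ)) 2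
    AddCircle.haarAddCircle := memLp_haarAddCircle_iff.2 hy.ofReal
  refine ((h1.integrable (by norm_num)).const_mul (((1 + y ^ 2) ^ 2 : ℝ) : ℂ)).congr
    (Eventually.of_forall fun x => ?_)
  simp only
  rw [← Complex.ofReal_mul, mul_inv_cancel_left₀ (by positivity)]

theorem mode_add (hF : IsTempered F) (hG : IsTempered G) (k : ℤ) :
    mode (fun p => F p + G p) k =ᵐ[volume] fun y => mode F k y + mode G k y := by
  filter_upwards [hF.ae_integrable_section, hG.ae_integrable_section] with y h1 h2
  have := congrFun (fourierCoeff.add h1 h2) k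
  simp only [Pi.add_apply] at this
  rw [mode, mode, mode, ← this]
  congr 1; funext x; simp

theorem mode_const_mul (c : ℝ) (F : Dom → ℝ) (k : ℤ) (y : ℝ) :
    mode (fun p => c * F p) k y = c * mode F k y := mode_mul (fun _ => c) F k y

theorem mode_sub (hF : IsTempered F) (hG : IsTempered G) (k : ℤ) :
    mode (fun p => F p - G p) k =ᵐ[volume] fun y => mode F k y - mode G k y := by
  have := hF.mode_add (hG.const_mul (-1)) k
  filter_upwards [this] with y hy
  rw [mode_const_mul] at hy
  simp only [sub_eq_add_neg]
  simpa using hy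

/-- Testing against `e^{-ikx} η(y)` is testing the `k`-th mode against `η`. -/
theorem integral_fourier (hF : IsTempered F) (k : ℤ) {η : ℝ → ℝ} (hη : Continuous η)
    (hs : HasCompactSupport η) :
    Integrable (fun p : Dom => F p • (fourier (-k) p.1 * (η p.2 : ℂ))) ∧
    ∫ p : Dom, F p • (fourier (-k) p.1 * (η p.2 : ℂ)) =
      2 * Real.pi * ∫ y, η y • mode F k y := by
  set θ : Dom → ℂ := fun p => fourier (-k) p.1 * (((1 + p.2 ^ 2) ^ 2 * η p.2 : ℝ) : ℂ) with hθ
  have cθ : Continuous θ := by simp only [hθ]; fun_prop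
  have sθ : HasCompactSupport θ := by
    refine HasCompactSupport.intro (K := Set.univ ×ˢ tsupport η) (isCompact_univ.prod hs.isCompact)
      fun p hp => ?_
    have : η p.2 = 0 := by
      by_contra h
      exact hp ⟨trivial, subset_tsupport _ h⟩
    simp [hθ, this]
  have mθ : MemLp θ 2 (volume : Measure Dom) := cθ.memLp_of_hasCompactSupport sθ
  have e : ∀ p : Dom, F p • (fourier (-k) p.1 * (η p.2 : ℂ)) =
      ((((1 + p.2 ^ 2) ^ 2)⁻¹ * F p : ℝ) : ℂ) * θ p := fun p => by
    have : ((1 + p.2 ^ 2 : ℝ) : ℂ) ≠ 0 := by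
      have : (0 : ℝ) < 1 + p.2 ^ 2 := by positivity
      exact_mod_cast this.ne'
    rw [hθ, Complex.real_smul]
    push_cast at this ⊢
    field_simp
  have hi : Integrable fun p : Dom => F p • (fourier (-k) p.1 * (η p.2 : ℂ)) :=
    ((MemLp.ofReal (K := ℂ) hF).integrable_mul mθ).congr (Eventually.of_forall fun p => (e p).symm)
  refine ⟨hi, (integral_prod_symm (μ := (volume : Measure Torus)) (ν := (volume : Measure ℝ))
      _ hi).trans ?_⟩
  rw [← integral_const_mul]
  refine integral_congr_ae (Eventually.of_forall fun y => ?_)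
  simp only
  rw [mode_eq, Complex.real_smul, Complex.real_smul]
  have : ∀ x : Torus, F (x, y) • (fourier (-k) x * (η y : ℂ)) =
      (fourier (-k) x * (F (x, y) : ℂ)) * (η y : ℂ) := fun x => by rw [Complex.real_smul]; ring
  simp only [this]
  rw [integral_mul_const]
  have : (Real.pi : ℂ) ≠ 0 := by exact_mod_cast Real.pi_ne_zero
  push_cast
  field_simp

end IsTempered

/-! ### Test functions -/

section Test

variable {η : ℝ → ℝ} (L : ℂ →L[ℝ] ℝ) (k : ℤ)

theorem hasDerivAt_fourier_shift (x : Torus) (c : ℂ) :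
    HasDerivAt (fun s : ℝ => L (fourier (-k) (x + (s : Torus)) * c))
      (L (-(Complex.I * k) * fourier (-k) x * c)) 0 := by
  induction x using QuotientAddGroup.induction_on with
  | H a =>
    have h1 := hasDerivAt_fourier_neg (2 * Real.pi) k (a + 0)
    have h2 := (HasDerivAt.comp_const_add a (0 : ℝ) h1).mul_const c
    have h3 := L.hasFDerivAt.comp_hasDerivAt (0 : ℝ) h2
    refine (h3.congr_deriv ?_).congr_of_eventuallyEq (Eventually.of_forall fun s => ?_)
    · congr 2
      have : (Real.pi : ℂ) ≠ 0 := by exact_mod_cast Real.pi_ne_zero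
      rw [add_zero]
      push_cast
      field_simp
    · simp only [Function.comp_apply]
      rfl

/-- Real parts of `c e^{-ikx} η(y)` are test functions. -/
theorem isTest_fourier (hη : ContDiff ℝ (⊤ : ℕ∞) η) (hs : HasCompactSupport η) :
    IsTest fun p : Dom => L (fourier (-k) p.1 * (η p.2 : ℂ)) := by
  constructor
  · have h1 : ContDiff ℝ (⊤ : ℕ∞) fun x : ℝ => fourier (-k) (x : Torus) := by
      have : (fun x : ℝ => fourier (-k) (x : Torus)) = fun x : ℝ =>
          Complex.exp (2 * Real.pi * Complex.I * ((-k : ℤ) : ℂ) * (x : ℂ) / ((2 * Real.pi : ℝ) : ℂ)) :=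
        funext fun x => fourier_coe_apply
      rw [this]
      have : ContDiff ℝ (⊤ : ℕ∞) fun x : ℝ => (x : ℂ) := Complex.ofRealCLM.contDiff
      fun_prop
    have h2 : ContDiff ℝ (⊤ : ℕ∞) fun x : ℝ => (η x : ℂ) := Complex.ofRealCLM.contDiff.comp hη
    exact L.contDiff.comp ((h1.comp contDiff_fst).mul (h2.comp contDiff_snd))
  · refine HasCompactSupport.intro (K := Set.univ ×ˢ tsupport η)
      (isCompact_univ.prod hs.isCompact) fun p hp => ?_
    have : η p.2 = 0 := by
      by_contra h
      exact hp ⟨trivial, subset_tsupport _ h⟩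
    simp [this]

theorem dx_fourier (η : ℝ → ℝ) : dx (fun p : Dom => L (fourier (-k) p.1 * (η p.2 : ℂ))) =
    fun p => L (-(Complex.I * k) * fourier (-k) p.1 * (η p.2 : ℂ)) :=
  funext fun p => (hasDerivAt_fourier_shift L k p.1 (η p.2)).deriv

theorem laplace_fourier (hη : ContDiff ℝ (⊤ : ℕ∞) η) :
    laplace (fun p : Dom => L (fourier (-k) p.1 * (η p.2 : ℂ))) =
      fun p => L (fourier (-k) p.1 * ((deriv (deriv η) p.2 - k ^ 2 * η p.2 : ℝ) : ℂ)) := by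
  have hdy : ∀ {κ : ℝ → ℝ}, ContDiff ℝ (⊤ : ℕ∞) κ →
      dy (fun p : Dom => L (fourier (-k) p.1 * (κ p.2 : ℂ))) =
        fun p => L (fourier (-k) p.1 * ((deriv κ p.2 : ℝ) : ℂ)) := fun {κ} hκ => by
    funext p
    have h1 : HasDerivAt (fun s : ℝ => κ (p.2 + s)) (deriv κ (p.2 + 0)) 0 :=
      HasDerivAt.comp_const_add p.2 (0 : ℝ) (hasDerivAt_of_contDiff hκ _)
    have h2 := h1.ofReal_comp.const_mul (fourier (-k) p.1)
    have h3 := (L.hasFDerivAt.comp_hasDerivAt (0 : ℝ) h2).deriv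
    rw [add_zero] at h3
    exact h3
  have hdx : dx (dx fun p : Dom => L (fourier (-k) p.1 * (η p.2 : ℂ))) =
      fun p => L (-(k : ℂ) ^ 2 * fourier (-k) p.1 * (η p.2 : ℂ)) := by
    rw [dx_fourier]
    funext p
    have := (hasDerivAt_fourier_shift L k p.1 (-(Complex.I * k) * (η p.2 : ℂ))).deriv
    have e : ∀ s : ℝ, L (fourier (-k) (p.1 + (s : Torus)) * (-(Complex.I * k) * (η p.2 : ℂ))) =
        L (-(Complex.I * k) * fourier (-k) (p.1 + (s : Torus)) * (η p.2 : ℂ)) := fun s => by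
      congr 1; ring
    simp only [e] at this
    rw [dx, this]
    congr 1
    linear_combination (k : ℂ) ^ 2 * fourier (-k) p.1 * (η p.2 : ℂ) * Complex.I_sq
  funext p
  rw [laplace, hdx, hdy hη, hdy (contDiff_deriv hη), ← map_add]
  congr 1
  push_cast
  ring

end Test

/-- The equation for the modes of a distributional solution of `Δ F₂ - ∂ₓ F₁ = F₀`. -/
theorem isWeakSecondDeriv_mode {F₀ F₁ F₂ : Dom → ℝ} (h₀ : IsTempered F₀) (h₁ : IsTempered F₁)
    (h₂ : IsTempered F₂)
    (h : ∀ φ, IsTest φ → (∫ p, F₂ p * laplace φ p) + ∫ p, F₁ p * dx φ p = ∫ p, F₀ p * φ p) (k : ℤ) :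
    IsWeakSecondDeriv (mode F₂ k) fun y =>
      (k : ℂ) ^ 2 * mode F₂ k y + Complex.I * k * mode F₁ k y + mode F₀ k y := by
  intro η hη hs
  have cη : Continuous η := hη.continuous
  have cη2 : Continuous (deriv (deriv η)) := (contDiff_deriv (contDiff_deriv hη)).continuous
  have s2 : HasCompactSupport (deriv (deriv η)) := hs.deriv.deriv
  have cκ : Continuous fun y => deriv (deriv η) y - (k : ℝ) ^ 2 * η y := by fun_prop
  have sκ : HasCompactSupport fun y => deriv (deriv η) y - (k : ℝ) ^ 2 * η y :=
    s2.sub hs.mul_left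
  obtain ⟨i0, e0⟩ := h₀.integral_fourier k cη hs
  obtain ⟨i1, e1⟩ := h₁.integral_fourier k cη hs
  obtain ⟨i2, e2⟩ := h₂.integral_fourier k cκ sκ
  have key : ∀ L : ℂ →L[ℝ] ℝ, L (2 * Real.pi * (∫ y, (deriv (deriv η) y - (k : ℝ) ^ 2 * η y) •
      mode F₂ k y) + -(Complex.I * k) * (2 * Real.pi * ∫ y, η y • mode F₁ k y)
      - 2 * Real.pi * ∫ y, η y • mode F₀ k y) = 0 := fun L => by
    have := h _ (isTest_fourier L k hη hs)
    rw [laplace_fourier L k hη, dx_fourier] at this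
    have e : ∀ (F : Dom → ℝ) (z : Dom → ℂ), (fun p => F p * L (z p)) = fun p => L (F p • z p) :=
      fun F z => funext fun p => by rw [map_smul, smul_eq_mul]
    have e' : ∀ p : Dom, F₁ p • (-(Complex.I * k) * fourier (-k) p.1 * (η p.2 : ℂ)) =
        -(Complex.I * k) * (F₁ p • (fourier (-k) p.1 * (η p.2 : ℂ))) := fun p => by
      rw [Complex.real_smul, Complex.real_smul]; ring
    rw [e, e, e, L.integral_comp_comm i2, L.integral_comp_comm i0, e2, e0] at this
    simp only [e'] at this
    rw [L.integral_comp_comm (i1.const_mul _), integral_const_mul, e1] at this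
    rw [map_sub, map_add, this, sub_self]
  have hz : 2 * Real.pi * (∫ y, (deriv (deriv η) y - (k : ℝ) ^ 2 * η y) •
      mode F₂ k y) + -(Complex.I * k) * (2 * Real.pi * ∫ y, η y • mode F₁ k y)
      - 2 * Real.pi * (∫ y, η y • mode F₀ k y) = 0 :=
    Complex.ext (key Complex.reCLM) (key Complex.imCLM)
  have t2 := integrable_test_smul (h₂.locallyIntegrable_mode k) cη2 s2
  have u2 := integrable_test_smul (h₂.locallyIntegrable_mode k) cη hs
  have u1 := integrable_test_smul (h₁.locallyIntegrable_mode k) cη hs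
  have u0 := integrable_test_smul (h₀.locallyIntegrable_mode k) cη hs
  have r1 : ∫ y, (deriv (deriv η) y - (k : ℝ) ^ 2 * η y) • mode F₂ k y =
      (∫ y, deriv (deriv η) y • mode F₂ k y) - (k : ℂ) ^ 2 * ∫ y, η y • mode F₂ k y := by
    rw [← integral_const_mul, ← integral_sub t2 (u2.const_mul _)]
    refine integral_congr_ae (Eventually.of_forall fun y => ?_)
    simp only [Complex.real_smul]; push_cast; ring
  have r2 : ∫ y, η y • ((k : ℂ) ^ 2 * mode F₂ k y + Complex.I * k * mode F₁ k y + mode F₀ k y) =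
      (k : ℂ) ^ 2 * (∫ y, η y • mode F₂ k y) + Complex.I * k * (∫ y, η y • mode F₁ k y)
        + ∫ y, η y • mode F₀ k y := by
    rw [← integral_const_mul, ← integral_const_mul,
      ← integral_add (u2.const_mul ((k : ℂ) ^ 2)) (u1.const_mul (Complex.I * k))]
    refine Eq.trans ?_ (integral_add ((u2.const_mul ((k : ℂ) ^ 2)).add
      (u1.const_mul (Complex.I * k))) u0)
    refine integral_congr_ae (Eventually.of_forall fun y => ?_)
    simp only [Complex.real_smul]; ring
  rw [r2]
  rw [r1] at hz
  have hp : (2 * Real.pi : ℂ) ≠ 0 := by exact_mod_cast Real.two_pi_pos.ne'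
  refine mul_left_cancel₀ hp ?_
  linear_combination hz

/-! ### Weighted resolvent estimates for a mode -/

/-- The resolvent estimate in a weighted space: the imaginary potential `q` plays no role, and the
weight costs `c`, where `w'' ≤ 2 c w`. -/
theorem weighted_resolvent {u R : ℝ → ℂ} {q w w' w'' : ℝ → ℝ} {a c C : ℝ}
    (hu : IsWeakSecondDeriv u fun y => (a + Complex.I * q y) * u y - R y)
    (hul : LocallyIntegrable u volume) (hq : Continuous q) (hRl : LocallyIntegrable R volume)
    (h1 : ∀ y, HasDerivAt w (w' y) y) (h2 : ∀ y, HasDerivAt w' (w'' y) y) (h3 : Continuous w'')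
    (h0 : ∀ y, 0 ≤ w y) (b1 : ∀ y, |w' y| ≤ C * w y) (b2 : ∀ y, |w'' y| ≤ C * w y)
    (hc : ∀ y, w'' y ≤ 2 * c * w y) (hac : c ≤ a)
    (iu : Integrable fun y => w y * ‖u y‖ ^ 2) (iR : Integrable fun y => w y * ‖R y‖ ^ 2) :
    (a - c) ^ 2 * ∫ y, w y * ‖u y‖ ^ 2 ≤ ∫ y, w y * ‖R y‖ ^ 2 := by
  have hl : LocallyIntegrable (fun y => (a + Complex.I * q y) * u y - R y) volume := by
    have : LocallyIntegrable (fun y => u y * (a + Complex.I * q y)) volume :=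
      hul.mul_continuous (by fun_prop)
    refine (this.sub hRl).congr (Eventually.of_forall fun y => ?_)
    simp only [Pi.sub_apply]; ring
  obtain ⟨U, V, huU, hU, hV⟩ := hu.exists_isPrim hul hl
  have iU : Integrable fun y => w y * ‖U y‖ ^ 2 := iu.congr (huU.mono fun y hy => by simp only [hy])
  have eU : ∫ y, w y * ‖u y‖ ^ 2 = ∫ y, w y * ‖U y‖ ^ 2 :=
    integral_congr_ae (huU.mono fun y hy => by simp only [hy])
  have hV' : IsPrim V fun y => (a + Complex.I * q y) * U y - R y :=
    hV.congr_ae (huU.mono fun y hy => by simp only [hy])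
  have cw : Continuous w := continuous_iff_continuousAt.2 fun y => (h1 y).continuousAt
  have re_eq : ∀ y, (((a + Complex.I * q y) * U y - R y) * conj (U y)).re =
      a * ‖U y‖ ^ 2 - (R y * conj (U y)).re := fun y => by
    rw [Complex.sq_norm, Complex.normSq_apply]
    simp
    ring
  have hRU : ∀ y, |(R y * conj (U y)).re| ≤ ‖R y‖ * ‖U y‖ := fun y => by
    refine (Complex.abs_re_le_norm _).trans_eq ?_
    rw [norm_mul, RCLike.norm_conj]
  have iRU : Integrable fun y => w y * (R y * conj (U y)).re := by
    refine (iU.add iR).mono' ?_ (Eventually.of_forall fun y => ?_)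
    · exact cw.aestronglyMeasurable.mul (Complex.continuous_re.comp_aestronglyMeasurable
        (hRl.aestronglyMeasurable.mul (Complex.continuous_conj.comp
          hU.continuous).aestronglyMeasurable))
    · rw [norm_mul, Real.norm_of_nonneg (h0 y), Real.norm_eq_abs, Pi.add_apply, ← mul_add]
      refine mul_le_mul_of_nonneg_left ((hRU y).trans ?_) (h0 y)
      nlinarith [sq_nonneg (‖R y‖ - ‖U y‖), sq_nonneg ‖R y‖, sq_nonneg ‖U y‖]
  have i2 : Integrable fun y => w y * (((a + Complex.I * q y) * U y - R y) * conj (U y)).re := by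
    refine ((iU.const_mul a).sub iRU).congr (Eventually.of_forall fun y => ?_)
    simp only [re_eq, Pi.sub_apply]; ring
  obtain ⟨-, he⟩ := weighted_energy hU hV' h1 h2 h3 h0 b1 b2 iU i2
  have e2 : ∫ y, w y * (((a + Complex.I * q y) * U y - R y) * conj (U y)).re =
      a * (∫ y, w y * ‖U y‖ ^ 2) - ∫ y, w y * (R y * conj (U y)).re := by
    rw [← integral_const_mul, ← integral_sub (iU.const_mul a) iRU]
    refine integral_congr_ae (Eventually.of_forall fun y => ?_)
    simp only [re_eq]; ring
  have hpos : 0 ≤ ∫ y, w y * ‖V y‖ ^ 2 :=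
    integral_nonneg fun y => mul_nonneg (h0 y) (by positivity)
  have iw'' : Integrable fun y => w'' y * ‖U y‖ ^ 2 := by
    refine (iU.const_mul C).mono' (h3.aestronglyMeasurable.mul
      (hU.continuous.norm.pow 2).aestronglyMeasurable) (Eventually.of_forall fun y => ?_)
    rw [norm_mul, norm_pow, norm_norm, Real.norm_eq_abs, ← mul_assoc]
    exact mul_le_mul_of_nonneg_right (b2 y) (by positivity)
  have hw'' : ∫ y, w'' y * ‖U y‖ ^ 2 ≤ 2 * c * ∫ y, w y * ‖U y‖ ^ 2 := by
    rw [← integral_const_mul]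
    refine integral_mono iw'' (iU.const_mul _) fun y => ?_
    simp only [← mul_assoc]
    exact mul_le_mul_of_nonneg_right (hc y) (by positivity)
  have main : (a - c) * ∫ y, w y * ‖U y‖ ^ 2 ≤ ∫ y, w y * (R y * conj (U y)).re := by
    rw [e2] at he; linarith
  rw [eU]
  rcases eq_or_lt_of_le hac with h | h
  · rw [h, sub_self, zero_pow two_ne_zero, zero_mul]
    exact integral_nonneg fun y => mul_nonneg (h0 y) (by positivity)
  · set t := a - c with ht
    have ht0 : 0 < t := by rw [ht]; linarith
    have h5 : t * (2 * ∫ y, w y * (R y * conj (U y)).re) ≤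
        (∫ y, w y * ‖R y‖ ^ 2) + t ^ 2 * ∫ y, w y * ‖U y‖ ^ 2 := by
      rw [← integral_const_mul, ← integral_const_mul, ← integral_const_mul,
        ← integral_add iR (iU.const_mul _)]
      refine integral_mono ((iRU.const_mul 2).const_mul t) (iR.add (iU.const_mul _)) fun y => ?_
      simp only
      have h6 := (le_abs_self _).trans (hRU y)
      have h7 : t * (2 * (R y * conj (U y)).re) ≤ ‖R y‖ ^ 2 + t ^ 2 * ‖U y‖ ^ 2 := by
        have := mul_le_mul_of_nonneg_left h6 ht0.le
        nlinarith [sq_nonneg (‖R y‖ - t * ‖U y‖)]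
      have := mul_le_mul_of_nonneg_left h7 (h0 y)
      linarith
    have h8 := mul_le_mul_of_nonneg_left main ht0.le
    linarith [sq t]

/-- The resolvent estimate for the weight of `X`. -/
theorem weighted_resolvent_one_add_sq {u R : ℝ → ℂ} {q : ℝ → ℝ} {a : ℝ}
    (hu : IsWeakSecondDeriv u fun y => (a + Complex.I * q y) * u y - R y)
    (hul : LocallyIntegrable u volume) (hq : Continuous q) (hRl : LocallyIntegrable R volume)
    (ha : 1 ≤ a) (iu : Integrable fun y => (1 + y ^ 2) * ‖u y‖ ^ 2)
    (iR : Integrable fun y => (1 + y ^ 2) * ‖R y‖ ^ 2) :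
    (a - 1) ^ 2 * ∫ y, (1 + y ^ 2) * ‖u y‖ ^ 2 ≤ ∫ y, (1 + y ^ 2) * ‖R y‖ ^ 2 := by
  refine weighted_resolvent hu hul hq hRl hasDerivAt_one_add_sq (w'' := fun _ => 2)
    (fun y => by simpa using (hasDerivAt_id y).const_mul 2) continuous_const
    (fun y => by positivity) (C := 2) (fun y => ?_) (fun y => ?_) (fun y => ?_) ha iu iR
  · rw [abs_mul, abs_two]; nlinarith [two_mul_abs_le y]
  · rw [abs_two]; nlinarith [sq_nonneg y]
  · nlinarith [sq_nonneg y]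

theorem hasDerivAt_inv_one_add_sq (y : ℝ) :
    HasDerivAt (fun y : ℝ => (1 + y ^ 2)⁻¹) (-(2 * y) / (1 + y ^ 2) ^ 2) y :=
  (hasDerivAt_one_add_sq y).inv (by positivity)

/-- The resolvent estimate for the weight of the dual of `X` with respect to the `L²` pairing. -/
theorem weighted_resolvent_inv {u R : ℝ → ℂ} {q : ℝ → ℝ} {a : ℝ}
    (hu : IsWeakSecondDeriv u fun y => (a + Complex.I * q y) * u y - R y)
    (hul : LocallyIntegrable u volume) (hq : Continuous q) (hRl : LocallyIntegrable R volume)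
    (ha : 9 / 16 ≤ a) (iu : Integrable fun y => (1 + y ^ 2)⁻¹ * ‖u y‖ ^ 2)
    (iR : Integrable fun y => (1 + y ^ 2)⁻¹ * ‖R y‖ ^ 2) :
    (a - 9 / 16) ^ 2 * ∫ y, (1 + y ^ 2)⁻¹ * ‖u y‖ ^ 2 ≤ ∫ y, (1 + y ^ 2)⁻¹ * ‖R y‖ ^ 2 := by
  have hp : ∀ y : ℝ, 0 < 1 + y ^ 2 := fun y => by positivity
  refine weighted_resolvent (w'' := fun y => (6 * y ^ 2 - 2) / (1 + y ^ 2) ^ 3) hu hul hq hRl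
    hasDerivAt_inv_one_add_sq (fun y => ?_) ?_ (fun y => by positivity) (C := 2) (fun y => ?_)
    (fun y => ?_) (fun y => ?_) ha iu iR
  · have h := ((hasDerivAt_id y).const_mul 2).neg.div ((hasDerivAt_one_add_sq y).pow 2)
      (pow_ne_zero 2 (hp y).ne')
    refine (h.congr_deriv ?_).congr_of_eventuallyEq (Eventually.of_forall fun z => ?_)
    · have := (hp y).ne'
      simp only [id, Pi.pow_apply, Pi.neg_apply]
      field_simp
      ring
    · simp
  · exact Continuous.div (by fun_prop) (by fun_prop) fun y => (pow_pos (hp y) 3).ne'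
  · have h := hp y
    rw [abs_div, abs_neg, abs_mul, abs_two, abs_of_pos (pow_pos h 2), div_le_iff₀ (pow_pos h 2),
      show 2 * (1 + y ^ 2)⁻¹ * (1 + y ^ 2) ^ 2 = 2 * (1 + y ^ 2) by field_simp]
    linarith [two_mul_abs_le y, hp y]
  · have h := hp y
    rw [abs_div, abs_of_pos (pow_pos h 3), div_le_iff₀ (pow_pos h 3),
      show 2 * (1 + y ^ 2)⁻¹ * (1 + y ^ 2) ^ 3 = 2 * (1 + y ^ 2) ^ 2 by field_simp, abs_le]
    constructor <;> nlinarith [sq_nonneg (y ^ 2 - 1), sq_nonneg (y ^ 2), sq_nonneg y]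
  · have h := hp y
    rw [div_le_iff₀ (pow_pos h 3), show 2 * (9 / 16) * (1 + y ^ 2)⁻¹ * (1 + y ^ 2) ^ 3 =
      (9 / 8) * (1 + y ^ 2) ^ 2 by field_simp; norm_num]
    nlinarith [sq_nonneg (3 * y ^ 2 - 5)]

/-- A square integrable solution of `u'' = a u`, `a ≥ 0`, vanishes. -/
theorem ae_eq_zero_of_weak_eq {u : ℝ → ℂ} {a : ℝ} (ha : 0 ≤ a)
    (hu : IsWeakSecondDeriv u fun y => (a : ℂ) * u y) (h2 : MemLp u 2) : u =ᵐ[volume] 0 := by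
  have hul := h2.locallyIntegrable (by norm_num)
  obtain ⟨U, V, huU, hU, hV⟩ := hu.exists_isPrim hul (by simpa [Pi.smul_def] using hul.smul (a : ℂ))
  have hU2 : MemLp U 2 := h2.ae_eq huU
  have hV' : IsPrim V fun y => (a : ℂ) * U y :=
    hV.congr_ae (huU.mono fun y hy => by simp only [hy])
  have e : ∀ y, (a * U y * conj (U y)).re = a * ‖U y‖ ^ 2 := fun y => by
    rw [mul_assoc, Complex.mul_conj', ← Complex.ofReal_pow, Complex.re_ofReal_mul,
      Complex.ofReal_re]
  have hi := hU2.integrable_norm_pow two_ne_zero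
  obtain ⟨i, he⟩ := weighted_energy hU hV' (w := fun _ => 1) (w' := fun _ => 0) (w'' := fun _ => 0)
    (fun y => hasDerivAt_const _ _) (fun y => hasDerivAt_const _ _) continuous_const
    (fun y => zero_le_one) (C := 0) (fun y => by simp) (fun y => by simp)
    (by simpa using hi) (by simpa [e] using hi.const_mul a)
  simp only [e, one_mul, zero_mul, integral_zero, mul_zero, zero_sub] at he i
  rw [integral_const_mul] at he
  have n1 : 0 ≤ ∫ y, ‖V y‖ ^ 2 := integral_nonneg fun y => by positivity
  have n2 : 0 ≤ a * ∫ y, ‖U y‖ ^ 2 := mul_nonneg ha (integral_nonneg fun y => by positivity)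
  have hz : ∫ y, ‖V y‖ ^ 2 = 0 := by linarith
  rw [integral_eq_zero_iff_of_nonneg (fun y => by positivity) i] at hz
  have hVz : V =ᵐ[volume] fun _ => 0 := hz.mono fun y hy => by
    simpa using hy
  have hc : ∀ y, U y = U 0 := fun y => by
    have := hU.sub_eq 0 y
    rw [intervalIntegral.integral_congr_ae (g := fun _ => (0 : ℂ)) (hVz.mono fun x hx _ => hx)]
      at this
    simpa [sub_eq_zero] using this
  have hc' : U = fun _ => U 0 := funext hc
  rw [hc'] at hU2
  have h0 : U 0 = 0 := by
    have := (memLp_const_iff (p := 2) (c := U 0) (μ := (volume : Measure ℝ)) two_ne_zero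
      (by norm_num)).1 hU2
    simpa using this
  filter_upwards [huU] with y hy
  rw [hy, hc y, h0]; rfl

/-! ### Calculus of test functions -/

theorem continuous_of_lift {φ : Dom → ℝ} (h : Continuous fun p : ℝ × ℝ => φ ((p.1 : Torus), p.2)) :
    Continuous φ := by
  have := (QuotientAddGroup.isOpenQuotientMap_mk (N := AddSubgroup.zmultiples (2 * Real.pi))).prodMap
    (IsOpenQuotientMap.id (X := ℝ))
  exact this.continuous_comp_iff.1 h

namespace IsTest

variable {φ ζ : Dom → ℝ}

theorem continuous (h : IsTest φ) : Continuous φ := continuous_of_lift h.1.continuous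

theorem hasDerivAt_x (h : IsTest φ) (a y : ℝ) :
    HasDerivAt (fun s : ℝ => φ ((s : Torus), y)) (dx φ ((a : Torus), y)) a := by
  have h1 : Differentiable ℝ fun s : ℝ => φ ((s : Torus), y) :=
    (h.1.differentiable (by simp)).comp (by fun_prop : Differentiable ℝ fun s : ℝ => (s, y))
  refine (h1 a).hasDerivAt.congr_deriv (Eq.symm ?_)
  have : (fun s : ℝ => φ ((a : Torus) + (s : Torus), y)) =
      fun s => (fun s : ℝ => φ ((s : Torus), y)) (a + s) := by funext s; push_cast; rfl
  change deriv (fun s : ℝ => φ ((a : Torus) + (s : Torus), y)) 0 = _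
  rw [this]
  exact (deriv_comp_const_add (f := fun s : ℝ => φ ((s : Torus), y)) a 0).trans (by rw [add_zero])

theorem hasDerivAt_y (h : IsTest φ) (x : Torus) (y : ℝ) :
    HasDerivAt (fun s : ℝ => φ (x, s)) (dy φ (x, y)) y := by
  induction x using QuotientAddGroup.induction_on with
  | H a =>
    have h1 : Differentiable ℝ fun s : ℝ => φ ((a : Torus), s) :=
      (h.1.differentiable (by simp)).comp (by fun_prop : Differentiable ℝ fun s : ℝ => (a, s))
    refine (h1 y).hasDerivAt.congr_deriv (Eq.symm ?_)
    exact (deriv_comp_const_add (f := fun s : ℝ => φ ((a : Torus), s)) y 0).trans (by rw [add_zero])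

theorem isTest_of_fderiv (h : IsTest φ) {D : Dom → ℝ} (v : ℝ × ℝ)
    (hD : ∀ p : ℝ × ℝ, D ((p.1 : Torus), p.2) =
      fderiv ℝ (fun p : ℝ × ℝ => φ ((p.1 : Torus), p.2)) p v)
    (h0 : ∀ p, φ =ᶠ[𝓝 p] 0 → D p = 0) : IsTest D := by
  constructor
  · simp only [hD]
    exact (h.1.fderiv_right (m := (⊤ : ℕ∞)) (by simp)).clm_apply contDiff_const
  · refine HasCompactSupport.intro h.2.isCompact fun p hp => h0 p ?_
    exact notMem_tsupport_iff_eventuallyEq.1 hp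

theorem dx (h : IsTest φ) : IsTest (dx φ) := by
  refine h.isTest_of_fderiv (1, 0) (fun p => ?_) fun p hp => ?_
  · have h1 := ((h.1.differentiable (by simp)) p).hasFDerivAt
    have h2 : HasDerivAt (fun s : ℝ => (s, p.2)) ((1 : ℝ), (0 : ℝ)) p.1 :=
      (hasDerivAt_id p.1).prodMk (hasDerivAt_const _ _)
    exact (h.hasDerivAt_x p.1 p.2).unique
      (HasFDerivAt.comp_hasDerivAt (f := fun s : ℝ => (s, p.2)) p.1 h1 h2)
  · have hc : Tendsto (fun s : ℝ => ((p.1 + (s : Torus), p.2) : Dom)) (𝓝 0) (𝓝 p) := by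
      have : Continuous fun s : ℝ => ((p.1 + (s : Torus), p.2) : Dom) :=
        (continuous_const.add (AddCircle.continuous_mk' _)).prodMk continuous_const
      simpa using this.tendsto 0
    have : (fun s : ℝ => φ (p.1 + (s : Torus), p.2)) =ᶠ[𝓝 0] fun _ => 0 := hc.eventually hp
    rw [Poiseuille.dx, this.deriv_eq, deriv_const]

theorem dy (h : IsTest φ) : IsTest (dy φ) := by
  refine h.isTest_of_fderiv (0, 1) (fun p => ?_) fun p hp => ?_
  · have h1 := ((h.1.differentiable (by simp)) p).hasFDerivAt
    have h2 : HasDerivAt (fun s : ℝ => (p.1, s)) ((0 : ℝ), (1 : ℝ)) p.2 :=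
      (hasDerivAt_const _ _).prodMk (hasDerivAt_id p.2)
    exact (h.hasDerivAt_y p.1 p.2).unique
      (HasFDerivAt.comp_hasDerivAt (f := fun s : ℝ => (p.1, s)) p.2 h1 h2)
  · have hc : Tendsto (fun s : ℝ => ((p.1, p.2 + s) : Dom)) (𝓝 0) (𝓝 p) := by
      have : Continuous fun s : ℝ => ((p.1, p.2 + s) : Dom) := by fun_prop
      simpa using this.tendsto 0
    have : (fun s : ℝ => φ (p.1, p.2 + s)) =ᶠ[𝓝 0] fun _ => 0 := hc.eventually hp
    rw [Poiseuille.dy, this.deriv_eq, deriv_const]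

theorem add (h : IsTest φ) (h' : IsTest ζ) : IsTest fun p => φ p + ζ p :=
  ⟨h.1.add h'.1, h.2.add h'.2⟩

theorem const_mul (c : ℝ) (h : IsTest φ) : IsTest fun p => c * φ p :=
  ⟨contDiff_const.mul h.1, h.2.mul_left⟩

theorem mul (h : IsTest φ) (h' : IsTest ζ) : IsTest fun p => φ p * ζ p :=
  ⟨h.1.mul h'.1, h.2.mul_right⟩

theorem mul_y {a : ℝ → ℝ} (ha : ContDiff ℝ (⊤ : ℕ∞) a) (h : IsTest φ) :
    IsTest fun p => a p.2 * φ p :=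
  ⟨(ha.comp contDiff_snd).mul h.1, h.2.mul_left⟩

theorem laplace (h : IsTest φ) : IsTest (laplace φ) := h.dx.dx.add h.dy.dy

theorem integrable (h : IsTest φ) : Integrable φ :=
  h.continuous.integrable_of_hasCompactSupport h.2

theorem dx_mul (h : IsTest φ) (h' : IsTest ζ) (p : Dom) :
    Poiseuille.dx (fun p => φ p * ζ p) p =
      Poiseuille.dx φ p * ζ p + φ p * Poiseuille.dx ζ p := by
  obtain ⟨x, y⟩ := p
  induction x using QuotientAddGroup.induction_on with
  | H a => exact ((h.mul h').hasDerivAt_x a y).unique ((h.hasDerivAt_x a y).mul (h'.hasDerivAt_x a y))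

theorem dy_mul (h : IsTest φ) (h' : IsTest ζ) (p : Dom) :
    Poiseuille.dy (fun p => φ p * ζ p) p =
      Poiseuille.dy φ p * ζ p + φ p * Poiseuille.dy ζ p :=
  ((h.mul h').hasDerivAt_y p.1 p.2).unique ((h.hasDerivAt_y p.1 p.2).mul (h'.hasDerivAt_y p.1 p.2))

theorem integral_dx (h : IsTest φ) : ∫ p, Poiseuille.dx φ p = 0 := by
  refine (integral_prod_symm (μ := (volume : Measure Torus)) (ν := (volume : Measure ℝ)) _
    h.dx.integrable).trans ?_
  have : ∀ y : ℝ, ∫ x : Torus, Poiseuille.dx φ (x, y) = 0 := fun y => by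
    rw [← AddCircle.intervalIntegral_preimage (2 * Real.pi) 0]
    rw [intervalIntegral.integral_eq_sub_of_hasDerivAt (fun a _ => h.hasDerivAt_x a y)]
    · rw [zero_add, AddCircle.coe_period, QuotientAddGroup.mk_zero, sub_self]
    · refine Continuous.intervalIntegrable ?_ _ _
      exact h.dx.continuous.comp ((AddCircle.continuous_mk' _).prodMk continuous_const)
  simp only [this, integral_zero]

theorem integral_dy (h : IsTest φ) : ∫ p, Poiseuille.dy φ p = 0 := by
  refine (integral_prod (μ := (volume : Measure Torus)) (ν := (volume : Measure ℝ)) _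
    h.dy.integrable).trans ?_
  have hs : ∀ {ξ : Dom → ℝ}, IsTest ξ → ∀ x : Torus, Integrable fun y : ℝ => ξ (x, y) :=
    fun {ξ} hξ x => by
      refine (hξ.continuous.comp (by fun_prop : Continuous fun y : ℝ => ((x, y) : Dom)))
        |>.integrable_of_hasCompactSupport ?_
      refine HasCompactSupport.intro (K := Prod.snd '' tsupport ξ)
        (hξ.2.isCompact.image continuous_snd) fun y hy => ?_
      by_contra hne
      exact hy ⟨(x, y), subset_tsupport _ hne, rfl⟩
  have : ∀ x : Torus, ∫ y : ℝ, Poiseuille.dy φ (x, y) = 0 := fun x =>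
    integral_eq_zero_of_hasDerivAt_of_integrable (fun y => h.hasDerivAt_y x y) (hs h.dy x) (hs h x)
  simp only [this, integral_zero]

theorem integral_mul_dx (h : IsTest φ) (h' : IsTest ζ) :
    ∫ p, φ p * Poiseuille.dx ζ p = -∫ p, Poiseuille.dx φ p * ζ p := by
  have := (h.mul h').integral_dx
  simp only [h.dx_mul h'] at this
  rw [integral_add (h.dx.mul h').integrable (h.mul h'.dx).integrable] at this
  linarith

theorem integral_mul_dy (h : IsTest φ) (h' : IsTest ζ) :
    ∫ p, φ p * Poiseuille.dy ζ p = -∫ p, Poiseuille.dy φ p * ζ p := by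
  have := (h.mul h').integral_dy
  simp only [h.dy_mul h'] at this
  rw [integral_add (h.dy.mul h').integrable (h.mul h'.dy).integrable] at this
  linarith

theorem integral_mul_laplace (h : IsTest φ) (h' : IsTest ζ) :
    ∫ p, φ p * Poiseuille.laplace ζ p = ∫ p, Poiseuille.laplace φ p * ζ p := by
  simp only [Poiseuille.laplace, mul_add, add_mul]
  rw [integral_add (h.mul h'.dx.dx).integrable (h.mul h'.dy.dy).integrable,
    integral_add (h.dx.dx.mul h').integrable (h.dy.dy.mul h').integrable,
    h.integral_mul_dx h'.dx, h.integral_mul_dy h'.dy, h.dx.integral_mul_dx h',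
    h.dy.integral_mul_dy h', neg_neg, neg_neg]

end IsTest

/-! ### The weighted space and its Fourier modes -/

theorem mode_congr_ae {F G : Dom → ℝ} (h : F =ᵐ[volume] G) (k : ℤ) :
    mode F k =ᵐ[volume] mode G k := by
  have h1 : ∀ᵐ q : ℝ × Torus ∂(volume : Measure ℝ).prod (volume : Measure Torus),
      F q.swap = G q.swap :=
    (Measure.measurePreserving_swap (μ := (volume : Measure ℝ))
      (ν := (volume : Measure Torus))).quasiMeasurePreserving.ae h
  filter_upwards [Measure.ae_ae_of_ae_prod h1] with y hy
  rw [mode_eq, mode_eq]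
  congr 1
  refine integral_congr_ae ?_
  filter_upwards [hy] with x hx
  rw [show F (x, y) = G (x, y) from hx]

theorem measurable_weight : Measurable fun p : Dom => ENNReal.ofReal (1 + p.2 ^ 2) := by fun_prop

theorem weightedMeasure_ac : weightedMeasure ≪ (volume : Measure Dom) :=
  withDensity_absolutelyContinuous _ _

theorem ac_weightedMeasure : (volume : Measure Dom) ≪ weightedMeasure :=
  withDensity_absolutelyContinuous' measurable_weight.aemeasurable
    (Eventually.of_forall fun p => by
      have : (0 : ℝ) < 1 + p.2 ^ 2 := by positivity
      simpa using this)

theorem integral_weightedMeasure (F : Dom → ℝ) :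
    ∫ p, F p ∂weightedMeasure = ∫ p : Dom, (1 + p.2 ^ 2) * F p := by
  refine (integral_withDensity_eq_integral_toReal_smul measurable_weight
    (Eventually.of_forall fun p => ENNReal.ofReal_lt_top) F).trans ?_
  refine integral_congr_ae (Eventually.of_forall fun p => ?_)
  have : (0 : ℝ) ≤ 1 + p.2 ^ 2 := by positivity
  simp only [ENNReal.toReal_ofReal this, smul_eq_mul]

theorem memLp_weightedMeasure {F : Dom → ℝ} (hF : AEStronglyMeasurable F volume)
    (h : Integrable fun p : Dom => (1 + p.2 ^ 2) * F p ^ 2) : MemLp F 2 weightedMeasure := by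
  refine (memLp_two_iff_integrable_sq (hF.mono_ac weightedMeasure_ac)).2 ?_
  refine (integrable_withDensity_iff_integrable_smul' measurable_weight
    (Eventually.of_forall fun p => ENNReal.ofReal_lt_top)).2 (h.congr
    (Eventually.of_forall fun p => ?_))
  have : (0 : ℝ) ≤ 1 + p.2 ^ 2 := by positivity
  simp only [ENNReal.toReal_ofReal this, smul_eq_mul]

theorem inner_X (ω g : X) : inner ℝ ω g = ∫ p : Dom, (1 + p.2 ^ 2) * (ω p * g p) := by
  rw [L2.inner_def, ← integral_weightedMeasure]
  refine integral_congr_ae (Eventually.of_forall fun p => ?_)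
  simp [mul_comm]

theorem memLp_X (ω : X) : MemLp ω 2 (volume : Measure Dom) := (norm_sq_X ω).1

theorem memLp_y_X (ω : X) : MemLp (fun p : Dom => p.2 * ω p) 2 volume := (norm_sq_X ω).2.1

theorem memLp_mode_X (ω : X) (k : ℤ) : MemLp (mode ω k) 2 := memLp_mode (memLp_X ω) k

theorem memLp_y_mode_X (ω : X) (k : ℤ) : MemLp (fun y : ℝ => (y : ℂ) * mode ω k y) 2 := by
  have := memLp_mode (memLp_y_X ω) k
  refine this.ae_eq (Eventually.of_forall fun y => ?_)
  exact mode_mul (fun y => y) ω k y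

/-- Parseval's identity in `X`. -/
theorem hasSum_modeNorm (ω : X) :
    HasSum (fun k : ℤ => 2 * Real.pi * modeNorm (mode ω k)) (‖ω‖ ^ 2) := by
  obtain ⟨h1, h2, h3⟩ := norm_sq_X ω
  have := (hasSum_mode h1).add (hasSum_mode h2)
  rw [← h3] at this
  convert this using 2 with k
  have e : ∀ y, mode (fun p : Dom => p.2 * ω p) k y = (y : ℂ) * mode ω k y :=
    fun y => mode_mul (fun y => y) ω k y
  simp only [e]
  rw [modeNorm, toL2_eq (memLp_mode_X ω k), toL2_eq (memLp_y_mode_X ω k),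
    norm_toLp_sq (memLp_mode_X ω k), norm_toLp_sq (memLp_y_mode_X ω k), mul_add]

theorem modeNorm_congr {U V : ℝ → ℂ} (h : U =ᵐ[volume] V) (hU : MemLp U 2)
    (hU' : MemLp (fun y : ℝ => (y : ℂ) * U y) 2) : modeNorm U = modeNorm V := by
  have h' : (fun y : ℝ => (y : ℂ) * U y) =ᵐ[volume] fun y : ℝ => (y : ℂ) * V y :=
    h.mono fun y hy => by simp only [hy]
  rw [modeNorm_eq hU hU', modeNorm_eq (hU.ae_eq h) (hU'.ae_eq h')]
  exact integral_congr_ae (h.mono fun y hy => by simp only [hy])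

theorem X_eq_zero_of_mode {ω : X} (h : ∀ k, mode ω k =ᵐ[volume] 0) : ω = 0 := by
  have := ae_eq_zero_of_mode (memLp_X ω) h
  exact (Lp.eq_zero_iff_ae_eq_zero).2 (weightedMeasure_ac.ae_le this)

theorem isTempered_X (ω : X) : IsTempered ω := .of_memLp (memLp_X ω)

/-- Elements of `X` times functions of growth at most `(1 + y²)²` are tempered. -/
theorem isTempered_mul_X (ω : X) {a : ℝ → ℝ} (ha : Continuous a)
    (h : ∀ y, |a y| ≤ (1 + y ^ 2) ^ 2) : IsTempered fun p => a p.2 * ω p :=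
  .of_le (memLp_X ω) ((by fun_prop : Continuous fun p : Dom => a p.2).aestronglyMeasurable.mul
    (memLp_X ω).1) fun p => by
    rw [abs_mul]; exact mul_le_mul_of_nonneg_right (h _) (abs_nonneg _)

theorem coeFn_sub_X (ω g : X) : ⇑(ω - g) =ᵐ[volume] fun p => ω p - g p :=
  ac_weightedMeasure.ae_le (Lp.coeFn_sub ω g)

theorem coeFn_smul_X (c : ℝ) (ω : X) : ⇑(c • ω) =ᵐ[volume] fun p => c * ω p :=
  ac_weightedMeasure.ae_le (Lp.coeFn_smul c ω)

theorem mode_sub_X (ω g : X) (k : ℤ) :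
    mode (ω - g : X) k =ᵐ[volume] fun y => mode ω k y - mode g k y :=
  (mode_congr_ae (coeFn_sub_X ω g) k).trans ((isTempered_X ω).mode_sub (isTempered_X g) k)

theorem mode_smul_X (c : ℝ) (ω : X) (k : ℤ) :
    mode (c • ω : X) k =ᵐ[volume] fun y => c * mode ω k y :=
  (mode_congr_ae (coeFn_smul_X c ω) k).trans
    (Eventually.of_forall fun y => IsTempered.mode_const_mul c ω k y)

/-! ### Embedding of test functions -/

open Classical in
/-- The element `φ / (1 + y²)` of `X`, which represents the functional `ω ↦ ∫ ω φ`. -/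
noncomputable def toX (φ : Dom → ℝ) : X :=
  if h : MemLp (fun p : Dom => (1 + p.2 ^ 2)⁻¹ * φ p) 2 weightedMeasure then h.toLp _ else 0

section ToX

variable {φ ζ : Dom → ℝ}

theorem memLp_inv_weight (hφ : MemLp φ 2 volume) :
    MemLp (fun p : Dom => (1 + p.2 ^ 2)⁻¹ * φ p) 2 weightedMeasure := by
  have hm : AEStronglyMeasurable (fun p : Dom => (1 + p.2 ^ 2)⁻¹ * φ p) volume :=
    (Continuous.aestronglyMeasurable (Continuous.inv₀ (by fun_prop) fun p => by positivity)).mul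
      hφ.1
  refine memLp_weightedMeasure hm (hφ.integrable_sq.mono' ?_ (Eventually.of_forall fun p => ?_))
  · exact (by fun_prop : Continuous fun p : Dom => 1 + p.2 ^ 2).aestronglyMeasurable.mul (hm.pow 2)
  · have h : (0 : ℝ) < 1 + p.2 ^ 2 := by positivity
    rw [Real.norm_of_nonneg (by positivity), mul_pow, inv_pow, ← mul_assoc,
      show (1 + p.2 ^ 2) * ((1 + p.2 ^ 2) ^ 2)⁻¹ = (1 + p.2 ^ 2)⁻¹ by field_simp]
    exact mul_le_of_le_one_left (by positivity) (inv_le_one_of_one_le₀ (by nlinarith [sq_nonneg p.2]))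

theorem coeFn_toX (hφ : MemLp φ 2 volume) :
    toX φ =ᵐ[volume] fun p : Dom => (1 + p.2 ^ 2)⁻¹ * φ p := by
  rw [toX, dif_pos (memLp_inv_weight hφ)]
  exact ac_weightedMeasure.ae_le (memLp_inv_weight hφ).coeFn_toLp

theorem inner_toX (ω : X) (hφ : MemLp φ 2 volume) : inner ℝ ω (toX φ) = ∫ p, ω p * φ p := by
  rw [inner_X]
  refine integral_congr_ae ((coeFn_toX hφ).mono fun p hp => ?_)
  have h : (0 : ℝ) < 1 + p.2 ^ 2 := by positivity
  simp only [hp]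
  field_simp

theorem toX_add (hφ : MemLp φ 2 volume) (hζ : MemLp ζ 2 volume) :
    toX (fun p => φ p + ζ p) = toX φ + toX ζ := by
  have e : (fun p : Dom => (1 + p.2 ^ 2)⁻¹ * (φ p + ζ p)) =
      (fun p : Dom => (1 + p.2 ^ 2)⁻¹ * φ p) + fun p : Dom => (1 + p.2 ^ 2)⁻¹ * ζ p := by
    funext p; simp only [Pi.add_apply]; ring
  have h : MemLp (fun p : Dom => (1 + p.2 ^ 2)⁻¹ * (φ p + ζ p)) 2 weightedMeasure :=
    memLp_inv_weight (hφ.add hζ)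
  rw [toX, toX, toX, dif_pos (memLp_inv_weight hφ), dif_pos (memLp_inv_weight hζ), dif_pos h,
    ← MemLp.toLp_add]
  exact MemLp.toLp_congr _ _ (Eventually.of_forall fun p => congrFun e p)

theorem toX_const_mul (c : ℝ) (hφ : MemLp φ 2 volume) : toX (fun p => c * φ p) = c • toX φ := by
  rw [toX, toX, dif_pos (memLp_inv_weight hφ), dif_pos (memLp_inv_weight (hφ.const_mul c)),
    ← MemLp.toLp_const_smul]
  refine MemLp.toLp_congr _ _ (Eventually.of_forall fun p => ?_)
  simp only [Pi.smul_apply, smul_eq_mul]; ring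

theorem mode_toX (hφ : MemLp φ 2 volume) (k : ℤ) :
    mode (toX φ) k =ᵐ[volume] fun y => ((1 + y ^ 2)⁻¹ : ℝ) * mode φ k y :=
  (mode_congr_ae (coeFn_toX hφ) k).trans (Eventually.of_forall fun y =>
    mode_mul (fun y => (1 + y ^ 2)⁻¹) φ k y)

theorem integrable_inv_weight {u : ℝ → ℂ} (hu : MemLp u 2) :
    Integrable fun y => (1 + y ^ 2)⁻¹ * ‖u y‖ ^ 2 := by
  refine (hu.integrable_norm_pow two_ne_zero).mono' ?_ (Eventually.of_forall fun y => ?_)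
  · exact (Continuous.aestronglyMeasurable (Continuous.inv₀ (by fun_prop) fun y => by
      positivity)).mul (hu.1.norm.pow 2)
  · rw [Real.norm_of_nonneg (by positivity)]
    exact mul_le_of_le_one_left (by positivity) (inv_le_one_of_one_le₀ (by nlinarith [sq_nonneg y]))

theorem hasSum_toX (hφ : MemLp φ 2 volume) :
    HasSum (fun k : ℤ => 2 * Real.pi * ∫ y, (1 + y ^ 2)⁻¹ * ‖mode φ k y‖ ^ 2) (‖toX φ‖ ^ 2) := by
  convert hasSum_modeNorm (toX φ) using 3 with k
  rw [modeNorm_eq (memLp_mode_X _ k) (memLp_y_mode_X _ k)]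
  refine integral_congr_ae ((mode_toX hφ k).mono fun y hy => ?_)
  have h : (0 : ℝ) < 1 + y ^ 2 := by positivity
  simp only [hy, norm_mul, Complex.norm_real, Real.norm_of_nonneg (inv_pos.2 h).le]
  field_simp

theorem IsTest.memLp (h : IsTest φ) : MemLp φ 2 volume :=
  h.continuous.memLp_of_hasCompactSupport h.2

/-- Test functions, embedded by `toX`, span a dense subspace of `X`. -/
theorem X_eq_zero_of_inner_test {g : X} (h : ∀ φ, IsTest φ → inner ℝ g (toX φ) = 0) : g = 0 := by
  refine X_eq_zero_of_mode fun k => ?_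
  have hw := isWeakSecondDeriv_mode (F₀ := g) (isTempered_X g) .zero .zero (fun φ hφ => by
    have := h φ hφ
    rw [inner_toX g hφ.memLp] at this
    simp [this]) k
  have hm : ∀ y, mode (fun _ => 0) k y = 0 := fun y => by simp [mode_eq]
  refine ae_eq_zero_of_integral_contDiff_smul_eq_zero
    ((memLp_mode_X g k).locallyIntegrable (by norm_num)) fun η hη hs => ?_
  have := hw η hη hs
  simp only [hm] at this
  simpa using this.symm

end ToX

/-! ### The average in `x` -/

/-- The fluctuation of `F` about its average in `x`. -/
noncomputable def fluct (F : Dom → ℝ) (p : Dom) : ℝ := F p - xMean F p.2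

theorem memLp_xMean {F : Dom → ℝ} (hF : MemLp F 2 volume) :
    MemLp (fun p : Dom => xMean F p.2) 2 volume := by
  have h1 : MemLp (xMean F) 2 (volume : Measure ℝ) := by
    have := (memLp_mode hF 0).re
    refine this.ae_eq (Eventually.of_forall fun y => ?_)
    simp [mode_zero_eq_xMean]
  exact h1.comp_snd (volume : Measure Torus)

theorem memLp_fluct {F : Dom → ℝ} (hF : MemLp F 2 volume) : MemLp (fluct F) 2 volume :=
  hF.sub (memLp_xMean hF)

theorem mode_fluct {F : Dom → ℝ} (hF : MemLp F 2 volume) (k : ℤ) :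
    mode (fluct F) k =ᵐ[volume] fun y => if k = 0 then 0 else mode F k y := by
  have h := (IsTempered.of_memLp hF).mode_sub (.of_memLp (memLp_xMean hF)) k
  refine h.trans (Eventually.of_forall fun y => ?_)
  have e : mode (fun p : Dom => xMean F p.2) k y = if k = 0 then (xMean F y : ℂ) else 0 := by
    rw [mode]
    have h1 := fourierCoeff.const_mul (T := 2 * Real.pi) (fun x => fourier 0 x) (xMean F y : ℂ) k
    have h2 : (fun x : Torus => (xMean F y : ℂ) * fourier 0 x) = fun x => (xMean F (x, y).2 : ℂ) := by
      funext x; simp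
    rw [h2] at h1
    rw [h1, fourierCoeff_fourier]
    by_cases hk : k = 0
    · simp [hk]
    · simp [hk]
  simp only [e]
  by_cases hk : k = 0
  · simp only [hk, if_true, mode_zero_eq_xMean, sub_self]
  · simp only [hk, if_false, sub_zero]

theorem integral_mul_xMean {F G : Dom → ℝ} (hF : MemLp F 2 volume) (hG : MemLp G 2 volume) :
    ∫ p : Dom, F p * xMean G p.2 = 2 * Real.pi * ∫ y, xMean F y * xMean G y := by
  have hi : Integrable fun p : Dom => F p * xMean G p.2 := hF.integrable_mul (memLp_xMean hG)
  refine (integral_prod_symm (μ := (volume : Measure Torus)) (ν := (volume : Measure ℝ)) _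
    hi).trans ?_
  rw [← integral_const_mul]
  refine integral_congr_ae (Eventually.of_forall fun y => ?_)
  simp only
  rw [integral_mul_const, xMean, xMean]
  have := Real.pi_ne_zero
  field_simp

theorem integral_fluct_mul {F G : Dom → ℝ} (hF : MemLp F 2 volume) (hG : MemLp G 2 volume) :
    ∫ p, fluct F p * G p = ∫ p, F p * fluct G p := by
  have e1 : ∫ p, fluct F p * G p = (∫ p, F p * G p) - ∫ p, G p * xMean F p.2 := by
    refine Eq.trans ?_ (integral_sub (hF.integrable_mul hG) (hG.integrable_mul (memLp_xMean hF)))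
    refine integral_congr_ae (Eventually.of_forall fun p => ?_)
    simp only [fluct]; ring
  have e2 : ∫ p, F p * fluct G p = (∫ p, F p * G p) - ∫ p, F p * xMean G p.2 := by
    refine Eq.trans ?_ (integral_sub (hF.integrable_mul hG) (hF.integrable_mul (memLp_xMean hG)))
    refine integral_congr_ae (Eventually.of_forall fun p => ?_)
    simp only [fluct]; ring
  rw [e1, e2, integral_mul_xMean hF hG, integral_mul_xMean hG hF]
  simp only [mul_comm]

/-! ### The nonlocal term as a bounded operator -/

/-- A linear map `R` dominated by another linear map `T` has a "relative adjoint": the equation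
`T† a = R† x` is solvable with continuous dependence on the datum `x`. -/
theorem exists_inner_eq_of_norm_le {V H H' : Type*} [AddCommGroup V] [Module ℝ V]
    [NormedAddCommGroup H] [InnerProductSpace ℝ H] [CompleteSpace H]
    [NormedAddCommGroup H'] [InnerProductSpace ℝ H'] [CompleteSpace H']
    (T : V →ₗ[ℝ] H) (R : V →ₗ[ℝ] H') {C : ℝ} (h : ∀ v, ‖R v‖ ≤ C * ‖T v‖) :
    ∃ A : H' →L[ℝ] H, ∀ x v, inner ℝ (A x) (T v) = inner ℝ x (R v) := by
  set K := (LinearMap.range T).topologicalClosure with hK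
  have hT : ∀ v, T v ∈ K := fun v =>
    (LinearMap.range T).le_topologicalClosure (LinearMap.mem_range_self T v)
  let e : V →ₗ[ℝ] K := T.codRestrict K hT
  have hd : DenseRange e := by
    rw [DenseRange, Subtype.dense_iff]
    intro x hx
    refine closure_mono ?_ (show x ∈ closure (LinearMap.range T : Set H) from hx)
    rintro _ ⟨v, rfl⟩
    exact ⟨e v, ⟨v, rfl⟩, rfl⟩
  have : CompleteSpace K := (LinearMap.range T).isClosed_topologicalClosure.completeSpace_coe
  let g : K →L[ℝ] H' := R.extendOfNorm e
  refine ⟨(g.comp K.orthogonalProjectionOnto).adjoint, fun x v => ?_⟩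
  rw [ContinuousLinearMap.adjoint_inner_left]
  congr 1
  have h1 : K.orthogonalProjectionOnto (T v) = e v :=
    K.orthogonalProjectionOnto_mem_subspace_eq_self (⟨T v, hT v⟩ : K)
  rw [ContinuousLinearMap.comp_apply, h1]
  exact LinearMap.extendOfNorm_eq hd ⟨C, h⟩ v

namespace IsTest

variable {φ ζ : Dom → ℝ}

theorem dx_add (h : IsTest φ) (h' : IsTest ζ) :
    Poiseuille.dx (fun p => φ p + ζ p) = fun p => Poiseuille.dx φ p + Poiseuille.dx ζ p := by
  funext ⟨x, y⟩
  induction x using QuotientAddGroup.induction_on with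
  | H a => exact ((h.add h').hasDerivAt_x a y).unique ((h.hasDerivAt_x a y).add (h'.hasDerivAt_x a y))

theorem dx_const_mul (c : ℝ) (h : IsTest φ) :
    Poiseuille.dx (fun p => c * φ p) = fun p => c * Poiseuille.dx φ p := by
  funext ⟨x, y⟩
  induction x using QuotientAddGroup.induction_on with
  | H a => exact ((h.const_mul c).hasDerivAt_x a y).unique ((h.hasDerivAt_x a y).const_mul c)

theorem dy_add (h : IsTest φ) (h' : IsTest ζ) :
    Poiseuille.dy (fun p => φ p + ζ p) = fun p => Poiseuille.dy φ p + Poiseuille.dy ζ p :=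
  funext fun p => ((h.add h').hasDerivAt_y p.1 p.2).unique
    ((h.hasDerivAt_y p.1 p.2).add (h'.hasDerivAt_y p.1 p.2))

theorem dy_const_mul (c : ℝ) (h : IsTest φ) :
    Poiseuille.dy (fun p => c * φ p) = fun p => c * Poiseuille.dy φ p :=
  funext fun p => ((h.const_mul c).hasDerivAt_y p.1 p.2).unique
    ((h.hasDerivAt_y p.1 p.2).const_mul c)

theorem laplace_add (h : IsTest φ) (h' : IsTest ζ) :
    Poiseuille.laplace (fun p => φ p + ζ p) =
      fun p => Poiseuille.laplace φ p + Poiseuille.laplace ζ p := by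
  funext p
  simp only [Poiseuille.laplace, h.dx_add h', h.dy_add h', h.dx.dx_add h'.dx, h.dy.dy_add h'.dy]
  ring

theorem laplace_const_mul (c : ℝ) (h : IsTest φ) :
    Poiseuille.laplace (fun p => c * φ p) = fun p => c * Poiseuille.laplace φ p := by
  funext p
  simp only [Poiseuille.laplace, h.dx_const_mul, h.dy_const_mul, h.dx.dx_const_mul,
    h.dy.dy_const_mul]
  ring

end IsTest

theorem fluct_add {F G : Dom → ℝ} (hF : MemLp F 2 volume) (hG : MemLp G 2 volume) :
    fluct (fun p => F p + G p) =ᵐ[volume] fun p => fluct F p + fluct G p := by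
  have h := (IsTempered.of_memLp hF).mode_add (.of_memLp hG) 0
  have h' : ∀ᵐ p : Dom, mode (fun p => F p + G p) 0 p.2 = mode F 0 p.2 + mode G 0 p.2 :=
    Measure.quasiMeasurePreserving_snd.ae h
  filter_upwards [h'] with p hp
  simp only [mode_zero_eq_xMean] at hp
  have : xMean (fun p => F p + G p) p.2 = xMean F p.2 + xMean G p.2 := by exact_mod_cast hp
  simp only [fluct, this]; ring

theorem fluct_const_mul (c : ℝ) (F : Dom → ℝ) : fluct (fun p => c * F p) = fun p => c * fluct F p := by
  funext p
  simp only [fluct, xMean, integral_const_mul]; ring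

theorem toX_congr {φ ζ : Dom → ℝ} (h : φ =ᵐ[volume] ζ) (hφ : MemLp φ 2 volume) :
    toX φ = toX ζ := by
  have hζ := hφ.ae_eq h
  rw [toX, toX, dif_pos (memLp_inv_weight hφ), dif_pos (memLp_inv_weight hζ)]
  exact MemLp.toLp_congr _ _ (weightedMeasure_ac.ae_le (h.mono fun p hp => by simp only [hp]))

/-- Test functions as a vector space. -/
def testSpace : Submodule ℝ (Dom → ℝ) where
  carrier := {φ | IsTest φ}
  add_mem' h h' := IsTest.add h h'
  zero_mem' := ⟨contDiff_const, HasCompactSupport.zero⟩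
  smul_mem' c _ h := IsTest.const_mul c h

/-- Elliptic regularity for the dual problem: in `L²((1 + y²)⁻¹ dx dy)` the fluctuation of `φ` is
controlled by `Δφ + ∂ₓζ` and `ζ`, frequency by frequency. -/
theorem norm_toX_fluct_le {φ ζ : Dom → ℝ} (hφ : IsTest φ) (hζ : IsTest ζ) :
    ‖toX (fluct φ)‖ ^ 2 ≤
      12 * (‖toX (fun p => laplace φ p + dx ζ p)‖ ^ 2 + ‖toX ζ‖ ^ 2) := by
  have hF : IsTest fun p => laplace φ p + dx ζ p := hφ.laplace.add hζ.dx
  refine hasSum_le (fun k => ?_) (hasSum_toX (memLp_fluct hφ.memLp))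
    (((hasSum_toX hF.memLp).add (hasSum_toX hζ.memLp)).mul_left 12)
  rw [← mul_add, mul_left_comm]
  refine mul_le_mul_of_nonneg_left ?_ Real.two_pi_pos.le
  have i1 := integrable_inv_weight (memLp_mode hF.memLp k)
  have i2 := integrable_inv_weight (memLp_mode hζ.memLp k)
  have e : ∫ y, (1 + y ^ 2)⁻¹ * ‖mode (fluct φ) k y‖ ^ 2 =
      ∫ y, (1 + y ^ 2)⁻¹ * ‖if k = 0 then 0 else mode φ k y‖ ^ 2 :=
    integral_congr_ae ((mode_fluct hφ.memLp k).mono fun y hy => by simp only [hy])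
  rw [e]
  have n1 : 0 ≤ ∫ y : ℝ, (1 + y ^ 2)⁻¹ * ‖mode (fun p => laplace φ p + dx ζ p) k y‖ ^ 2 :=
    integral_nonneg fun y => by positivity
  have n2 : 0 ≤ ∫ y : ℝ, (1 + y ^ 2)⁻¹ * ‖mode ζ k y‖ ^ 2 :=
    integral_nonneg fun y => by positivity
  by_cases hk : k = 0
  · simp only [hk, if_true, norm_zero]
    subst hk
    simpa using add_nonneg n1 n2
  simp only [hk, if_false]
  have hw := isWeakSecondDeriv_mode (F₀ := fun p => laplace φ p + dx ζ p)
    (F₁ := fun p => (-1) * ζ p) (F₂ := φ) (.of_memLp hF.memLp)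
    ((IsTempered.of_memLp hζ.memLp).const_mul _) (.of_memLp hφ.memLp) (fun ξ hξ => by
      have e1 := hφ.integral_mul_laplace hξ
      have e2 := hζ.integral_mul_dx hξ
      have e3 : ∫ p, (laplace φ p + dx ζ p) * ξ p =
          (∫ p, laplace φ p * ξ p) + ∫ p, dx ζ p * ξ p := by
        simp only [add_mul]
        exact integral_add (hφ.laplace.mul hξ).integrable (hζ.dx.mul hξ).integrable
      have e4 : ∫ p, -1 * ζ p * dx ξ p = -∫ p, ζ p * dx ξ p := by
        rw [← integral_neg]; simp
      rw [e1, e3, e4, e2, neg_neg]) k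
  have hR : MemLp (fun y => Complex.I * k * mode ζ k y -
      mode (fun p => laplace φ p + dx ζ p) k y) 2 volume :=
    ((memLp_mode hζ.memLp k).const_mul _).sub (memLp_mode hF.memLp k)
  have hk1 : (1 : ℝ) ≤ (k : ℝ) ^ 2 := by
    have : (1 : ℤ) ≤ k ^ 2 := by
      have := sq_nonneg k
      have h0 : k ^ 2 ≠ 0 := pow_ne_zero 2 hk
      omega
    exact_mod_cast this
  have hmain := weighted_resolvent_inv (u := mode φ k) (R := fun y => Complex.I * k * mode ζ k y -
      mode (fun p => laplace φ p + dx ζ p) k y) (q := fun _ => 0) (a := (k : ℝ) ^ 2) (by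
        intro η hη hs
        rw [hw η hη hs]
        refine integral_congr_ae (Eventually.of_forall fun y => ?_)
        simp only [IsTempered.mode_const_mul]
        congr 1
        push_cast; ring) ((memLp_mode hφ.memLp k).locallyIntegrable (by norm_num))
      continuous_const (hR.locallyIntegrable (by norm_num)) (by linarith)
      (integrable_inv_weight (memLp_mode hφ.memLp k)) (integrable_inv_weight hR)
  have hle : ∫ y, (1 + y ^ 2)⁻¹ * ‖Complex.I * k * mode ζ k y -
      mode (fun p => laplace φ p + dx ζ p) k y‖ ^ 2 ≤
      2 * (k : ℝ) ^ 2 * (∫ y, (1 + y ^ 2)⁻¹ * ‖mode ζ k y‖ ^ 2) +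
      2 * ∫ y, (1 + y ^ 2)⁻¹ * ‖mode (fun p => laplace φ p + dx ζ p) k y‖ ^ 2 := by
    rw [← integral_const_mul, ← integral_const_mul,
      ← integral_add (i2.const_mul _) (i1.const_mul _)]
    refine integral_mono (integrable_inv_weight hR) ((i2.const_mul _).add (i1.const_mul _))
      fun y => ?_
    have hn := norm_sub_le (Complex.I * k * mode ζ k y) (mode (fun p => laplace φ p + dx ζ p) k y)
    have hn' : ‖Complex.I * k * mode ζ k y‖ = |(k : ℝ)| * ‖mode ζ k y‖ := by
      rw [norm_mul, norm_mul, Complex.norm_I, one_mul, Complex.norm_intCast]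
    rw [hn'] at hn
    have hsq := pow_le_pow_left₀ (norm_nonneg _) hn 2
    have hab := sq_nonneg (|(k : ℝ)| * ‖mode ζ k y‖ - ‖mode (fun p => laplace φ p + dx ζ p) k y‖)
    have habs := sq_abs (k : ℝ)
    have hw0 : 0 ≤ (1 + y ^ 2)⁻¹ := by positivity
    have : ‖Complex.I * k * mode ζ k y - mode (fun p => laplace φ p + dx ζ p) k y‖ ^ 2 ≤
        2 * (k : ℝ) ^ 2 * ‖mode ζ k y‖ ^ 2 +
          2 * ‖mode (fun p => laplace φ p + dx ζ p) k y‖ ^ 2 := by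
      rw [← habs]; linarith
    simp only
    refine (mul_le_mul_of_nonneg_left this hw0).trans (le_of_eq ?_)
    ring
  have hA := hmain.trans hle
  set P := ∫ y, (1 + y ^ 2)⁻¹ * ‖mode φ k y‖ ^ 2
  set Q := ∫ y, (1 + y ^ 2)⁻¹ * ‖mode ζ k y‖ ^ 2
  set Z := ∫ y, (1 + y ^ 2)⁻¹ * ‖mode (fun p => laplace φ p + dx ζ p) k y‖ ^ 2
  have hP : 0 ≤ P := integral_nonneg fun y => by positivity
  set a := (k : ℝ) ^ 2
  have h1 : 49 / 256 * a ≤ (a - 9 / 16) ^ 2 := by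
    linarith [mul_nonneg (sub_nonneg.2 hk1) (by linarith : 0 ≤ a - 81 / 256)]
  have h2 := mul_le_mul_of_nonneg_right h1 hP
  have h3 : a * Z ≥ Z := by nlinarith
  have h4 : a * (49 / 256 * P) ≤ a * (2 * Q + 2 * Z) := by linarith
  have := le_of_mul_le_mul_left h4 (by linarith)
  linarith

/-- Existence of the stream function, with values in `X`, together with its `x`-derivative. -/
theorem exists_stream : ∃ A : X →L[ℝ] WithLp 2 (X × X), ∀ ω φ, IsTest φ →
    ∫ p, (A ω).fst p * laplace φ p = ∫ p, fluct ω p * φ p ∧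
    ∫ p, (A ω).snd p * φ p = -∫ p, (A ω).fst p * dx φ p := by
  let T : testSpace × testSpace →ₗ[ℝ] WithLp 2 (X × X) :=
    { toFun := fun v => WithLp.toLp 2
        (toX (fun p => laplace v.1.1 p + dx v.2.1 p), toX v.2.1)
      map_add' := fun v w => by
        have h1 : toX (fun p => laplace (v + w).1.1 p + dx (v + w).2.1 p) =
            toX (fun p => laplace v.1.1 p + dx v.2.1 p) +
              toX (fun p => laplace w.1.1 p + dx w.2.1 p) := by
          rw [← toX_add (v.1.2.laplace.add v.2.2.dx).memLp (w.1.2.laplace.add w.2.2.dx).memLp]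
          congr 1; funext p
          have e1 := congrFun (v.1.2.laplace_add w.1.2) p
          have e2 := congrFun (v.2.2.dx_add w.2.2) p
          refine (congrArg₂ (· + ·) e1 e2).trans ?_
          ring
        have h2 : toX (v + w).2.1 = toX v.2.1 + toX w.2.1 := toX_add v.2.2.memLp w.2.2.memLp
        rw [h1, h2]; rfl
      map_smul' := fun c v => by
        have h1 : toX (fun p => laplace (c • v).1.1 p + dx (c • v).2.1 p) =
            c • toX (fun p => laplace v.1.1 p + dx v.2.1 p) := by
          rw [← toX_const_mul c (v.1.2.laplace.add v.2.2.dx).memLp]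
          congr 1; funext p
          have e1 := congrFun (v.1.2.laplace_const_mul c) p
          have e2 := congrFun (v.2.2.dx_const_mul c) p
          refine (congrArg₂ (· + ·) e1 e2).trans ?_
          ring
        have h2 : toX (c • v).2.1 = c • toX v.2.1 := toX_const_mul c v.2.2.memLp
        rw [h1, h2]; rfl }
  let R : testSpace × testSpace →ₗ[ℝ] X :=
    { toFun := fun v => toX (fluct v.1.1)
      map_add' := fun v w => by
        rw [← toX_add (memLp_fluct v.1.2.memLp) (memLp_fluct w.1.2.memLp)]
        exact toX_congr (fluct_add v.1.2.memLp w.1.2.memLp) (memLp_fluct (v.1.2.add w.1.2).memLp)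
      map_smul' := fun c v => by
        rw [RingHom.id_apply, ← toX_const_mul c (memLp_fluct v.1.2.memLp), ← fluct_const_mul]
        rfl }
  have hb : ∀ v, ‖R v‖ ≤ Real.sqrt 12 * ‖T v‖ := fun v => by
    rw [← Real.sqrt_sq (norm_nonneg (T v)), ← Real.sqrt_mul (by norm_num)]
    refine Real.le_sqrt_of_sq_le ?_
    rw [WithLp.prod_norm_sq_eq_of_L2]
    exact norm_toX_fluct_le v.1.2 v.2.2
  obtain ⟨A, hA⟩ := exists_inner_eq_of_norm_le T R hb
  refine ⟨A, fun ω φ hφ => ⟨?_, ?_⟩⟩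
  · have h := hA ω (⟨φ, hφ⟩, 0)
    have e1 : T (⟨φ, hφ⟩, 0) = WithLp.toLp 2 (toX (laplace φ), toX 0) := by
      have : dx (0 : Dom → ℝ) = 0 := by funext p; simp [dx]
      change WithLp.toLp 2 (toX (fun p => laplace φ p + dx 0 p), toX 0) = _
      rw [this]; simp
    have e2 : R (⟨φ, hφ⟩, 0) = toX (fluct φ) := rfl
    rw [e1, e2, WithLp.prod_inner_apply, inner_toX _ hφ.laplace.memLp, inner_toX _ MemLp.zero,
      inner_toX _ (memLp_fluct hφ.memLp), ← integral_fluct_mul (memLp_X ω) hφ.memLp] at h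
    simpa using h
  · have h := hA ω (0, ⟨φ, hφ⟩)
    have e1 : T (0, ⟨φ, hφ⟩) = WithLp.toLp 2 (toX (dx φ), toX φ) := by
      have : laplace (0 : Dom → ℝ) = 0 := by
        have h1 : dx (0 : Dom → ℝ) = 0 := by funext p; simp [dx]
        have h2 : dy (0 : Dom → ℝ) = 0 := by funext p; simp [dy]
        funext p; simp [laplace, h1, h2]
      change WithLp.toLp 2 (toX (fun p => laplace 0 p + dx φ p), toX φ) = _
      rw [this]; simp
    have e2 : R (0, ⟨φ, hφ⟩) = toX (fluct 0) := rfl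
    have e3 : fluct 0 = 0 := by funext p; simp [fluct, xMean]
    rw [e1, e2, e3, WithLp.prod_inner_apply, inner_toX _ hφ.dx.memLp, inner_toX _ hφ.memLp,
      inner_toX _ MemLp.zero] at h
    have h' : (∫ p, (A ω).fst p * dx φ p) + ∫ p, (A ω).snd p * φ p = 0 := by simpa using h
    linarith

/-- The stream function operator `ω ↦ Δ⁻¹ ω` on `X`; it takes values in `X`, that is, the stream
function decays like its vorticity. -/
noncomputable def streamX (ω : X) : X := (exists_stream.choose ω).fst

/-- The nonlocal term `ω ↦ 2 ∂ₓ Δ⁻¹ ω` as a bounded operator on `X`. -/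
noncomputable def nonlocal : X →L[ℝ] X :=
  (2 : ℝ) • (WithLp.sndL (𝕜 := ℝ) 2 X X).comp exists_stream.choose

theorem integral_streamX_mul_laplace (ω : X) {φ : Dom → ℝ} (hφ : IsTest φ) :
    ∫ p, streamX ω p * laplace φ p = ∫ p, fluct ω p * φ p :=
  (exists_stream.choose_spec ω φ hφ).1

theorem integral_nonlocal_mul (ω : X) {φ : Dom → ℝ} (hφ : IsTest φ) :
    ∫ p, nonlocal ω p * φ p = -2 * ∫ p, streamX ω p * dx φ p := by
  have h : nonlocal ω = (2 : ℝ) • (exists_stream.choose ω).snd := rfl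
  have e : ∫ p, nonlocal ω p * φ p = 2 * ∫ p, (exists_stream.choose ω).snd p * φ p := by
    rw [← integral_const_mul]
    refine integral_congr_ae ?_
    rw [h]
    filter_upwards [coeFn_smul_X 2 (exists_stream.choose ω).snd] with p hp
    rw [hp]; ring
  rw [e, (exists_stream.choose_spec ω φ hφ).2, streamX]
  ring

/-- The modes of the equation `Δ F = ω - ⟨ω⟩`, where `⟨ω⟩` is the average in `x`. -/
theorem isWeakSecondDeriv_mode_stream {F : Dom → ℝ} {ω : X} (hF : MemLp F 2 volume)
    (h : ∀ φ, IsTest φ → ∫ p, F p * laplace φ p = ∫ p, fluct ω p * φ p) (k : ℤ) :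
    IsWeakSecondDeriv (mode F k) fun y =>
      (k : ℂ) ^ 2 * mode F k y + if k = 0 then 0 else mode ω k y := by
  have hw := isWeakSecondDeriv_mode (.of_memLp (memLp_fluct (memLp_X ω))) .zero (.of_memLp hF)
    (fun φ hφ => by simpa using h φ hφ) k
  have hm : ∀ y, mode (fun _ => 0) k y = 0 := fun y => by simp [mode_eq]
  intro η hη hs
  rw [hw η hη hs]
  refine integral_congr_ae ((mode_fluct (memLp_X ω) k).mono fun y hy => ?_)
  simp only [hy, hm, mul_zero, add_zero]

theorem mode_zero_of_weak {F : Dom → ℝ} {ω : X} (hF : MemLp F 2 volume)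
    (h : ∀ φ, IsTest φ → ∫ p, F p * laplace φ p = ∫ p, fluct ω p * φ p) :
    mode F 0 =ᵐ[volume] 0 := by
  refine ae_eq_zero_of_weak_eq le_rfl (a := 0) ?_ (memLp_mode hF 0)
  simpa using isWeakSecondDeriv_mode_stream hF h 0

theorem ae_integral_eq_zero_iff (F : Dom → ℝ) :
    (∀ᵐ y : ℝ, ∫ x : Torus, F (x, y) = 0) ↔ mode F 0 =ᵐ[volume] 0 := by
  refine eventually_congr (Eventually.of_forall fun y => ?_)
  simp only [mode_zero_eq_xMean, xMean, Pi.zero_apply, Complex.ofReal_eq_zero, mul_eq_zero,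
    inv_eq_zero, Real.two_pi_pos.ne', false_or]

/-- The stream function of `ω` is the element `streamX ω` of `X`. -/
theorem isStreamFunction_iff {ψ : Lp ℝ 2 (volume : Measure Dom)} {ω : X} :
    IsStreamFunction ψ ω ↔ ψ =ᵐ[volume] streamX ω := by
  have hs := memLp_X (streamX ω)
  constructor
  · rintro ⟨-, h⟩
    have hψ := Lp.memLp ψ
    have key := ae_eq_zero_of_mode (hψ.sub hs) fun k => by
      have h1 : mode (⇑ψ - ⇑(streamX ω)) k =ᵐ[volume] fun y => mode ψ k y - mode (streamX ω) k y :=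
        (IsTempered.of_memLp hψ).mode_sub (.of_memLp hs) k
      have w1 := isWeakSecondDeriv_mode_stream hψ h k
      have w2 := isWeakSecondDeriv_mode_stream hs (fun φ hφ => integral_streamX_mul_laplace ω hφ) k
      refine h1.trans (ae_eq_zero_of_weak_eq (sq_nonneg (k : ℝ)) ?_
        ((memLp_mode hψ k).sub (memLp_mode hs k)))
      have l1 := (memLp_mode hψ k).locallyIntegrable (by norm_num)
      have l2 := (memLp_mode hs k).locallyIntegrable (by norm_num)
      have l0 : LocallyIntegrable (fun y => if k = 0 then 0 else mode ω k y) volume := by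
        by_cases hk : k = 0
        · simp only [hk, if_true]; exact locallyIntegrable_zero
        · simp only [hk, if_false]
          exact (memLp_mode_X ω k).locallyIntegrable (by norm_num)
      have r1 : LocallyIntegrable (fun y => (k : ℂ) ^ 2 * mode ψ k y +
          if k = 0 then 0 else mode ω k y) volume := (l1.smul ((k : ℂ) ^ 2)).add l0
      have r2 : LocallyIntegrable (fun y => (k : ℂ) ^ 2 * mode (streamX ω) k y +
          if k = 0 then 0 else mode ω k y) volume := (l2.smul ((k : ℂ) ^ 2)).add l0
      intro η hη hη'
      have cη2 := (contDiff_deriv (contDiff_deriv hη)).continuous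
      have e1 : ∫ y, deriv (deriv η) y • (mode ψ k y - mode (streamX ω) k y) =
          (∫ y, deriv (deriv η) y • mode ψ k y) -
            ∫ y, deriv (deriv η) y • mode (streamX ω) k y := by
        simp only [smul_sub]
        exact integral_sub (integrable_test_smul l1 cη2 hη'.deriv.deriv)
          (integrable_test_smul l2 cη2 hη'.deriv.deriv)
      rw [e1, w1 η hη hη', w2 η hη hη']
      refine (integral_sub (integrable_test_smul r1 hη.continuous hη')
        (integrable_test_smul r2 hη.continuous hη')).symm.trans ?_
      refine integral_congr_ae (Eventually.of_forall fun y => ?_)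
      simp only [← smul_sub]
      congr 1
      push_cast; ring
    exact key.mono fun p hp => sub_eq_zero.1 hp
  · intro h
    refine ⟨(ae_integral_eq_zero_iff _).2 ((mode_congr_ae h 0).trans
      (mode_zero_of_weak hs fun φ hφ => integral_streamX_mul_laplace ω hφ)), fun φ hφ => ?_⟩
    refine (integral_congr_ae ?_).trans (integral_streamX_mul_laplace ω hφ)
    exact h.mono fun p hp => by simp only [hp]

/-- The stream function in the definition of the graph can be eliminated in favour of the bounded operator
`nonlocal`. -/
theorem linearizedGraph_iff {ν : ℝ} {ω f : X} : LinearizedGraph ν ω f ↔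
    ∀ φ : Dom → ℝ, IsTest φ → ∫ p : Dom, f p * φ p =
      (∫ p : Dom, ω p * (p.2 ^ 2 * dx φ p)) + (∫ p : Dom, nonlocal ω p * φ p)
        + ν * ∫ p : Dom, ω p * laplace φ p := by
  have key : ∀ {ψ : Lp ℝ 2 (volume : Measure Dom)} {φ : Dom → ℝ}, ψ =ᵐ[volume] streamX ω →
      IsTest φ → ∫ p : Dom, nonlocal ω p * φ p = -2 * ∫ p : Dom, ψ p * dx φ p := by
    intro ψ φ hψ hφ
    rw [integral_nonlocal_mul ω hφ]
    congr 1
    exact integral_congr_ae (hψ.mono fun p hp => by simp only [hp])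
  constructor
  · rintro ⟨ψ, hψ, h⟩ φ hφ
    rw [h φ hφ, key (isStreamFunction_iff.1 hψ) hφ]; ring
  · intro h
    have hψ := (memLp_X (streamX ω)).coeFn_toLp
    refine ⟨(memLp_X (streamX ω)).toLp _, isStreamFunction_iff.2 hψ, fun φ hφ => ?_⟩
    rw [h φ hφ, key hψ hφ]; ring

/-- The nonlocal term acts on frequencies as `2ik` times the stream function. -/
theorem mode_nonlocal (ω : X) (k : ℤ) :
    mode (nonlocal ω) k =ᵐ[volume] fun y => 2 * Complex.I * k * mode (streamX ω) k y := by
  have hw := isWeakSecondDeriv_mode (F₀ := nonlocal ω) (F₁ := fun p => -2 * streamX ω p)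
    (F₂ := fun _ => 0) (isTempered_X _) ((isTempered_X _).const_mul _) .zero (fun φ hφ => by
      rw [integral_nonlocal_mul ω hφ, ← integral_const_mul]
      simp [mul_assoc]) k
  have hm : ∀ y, mode (fun _ => 0) k y = 0 := fun y => by simp [mode_eq]
  have hl : LocallyIntegrable (fun y => mode (nonlocal ω) k y -
      2 * Complex.I * k * mode (streamX ω) k y) volume :=
    ((memLp_mode_X _ k).sub ((memLp_mode_X _ k).const_mul _)).locallyIntegrable (by norm_num)
  have := ae_eq_zero_of_integral_contDiff_smul_eq_zero hl fun η hη hs => by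
    have := hw η hη hs
    simp only [hm, smul_zero, integral_zero, mul_zero, zero_add, IsTempered.mode_const_mul] at this
    rw [this]
    refine integral_congr_ae (Eventually.of_forall fun y => ?_)
    simp only
    congr 1
    push_cast; ring
  exact this.mono fun y hy => sub_eq_zero.1 hy

/-! ### The graph of the operator -/

theorem linearizedGraph_iff_inner {ν : ℝ} {ω f : X} : LinearizedGraph ν ω f ↔
    ∀ φ : Dom → ℝ, IsTest φ → inner ℝ (f - nonlocal ω) (toX φ) =
      inner ℝ ω (toX fun p => p.2 ^ 2 * dx φ p) + ν * inner ℝ ω (toX (laplace φ)) := by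
  rw [linearizedGraph_iff]
  refine forall_congr' fun φ => forall_congr' fun hφ => ?_
  have h2 : IsTest fun p => p.2 ^ 2 * dx φ p :=
    IsTest.mul_y (a := fun y => y ^ 2) (contDiff_id.pow 2) hφ.dx
  rw [inner_sub_left, inner_toX _ hφ.memLp, inner_toX _ hφ.memLp, inner_toX _ h2.memLp,
    inner_toX _ hφ.laplace.memLp, sub_eq_iff_eq_add]
  constructor <;> intro h <;> rw [h] <;> ring

/-- The graph of `𝓛` as a subspace of `X × X`. -/
def graph (ν : ℝ) : Submodule ℝ (X × X) where
  carrier := {p | LinearizedGraph ν p.1 p.2}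
  add_mem' {p q} hp hq := by
    simp only [Set.mem_ofPred_eq, linearizedGraph_iff_inner] at hp hq ⊢
    intro φ hφ
    have e : (p + q).2 - nonlocal (p + q).1 = (p.2 - nonlocal p.1) + (q.2 - nonlocal q.1) := by
      rw [Prod.fst_add, Prod.snd_add, map_add]; abel
    rw [e, inner_add_left, hp φ hφ, hq φ hφ, Prod.fst_add, inner_add_left, inner_add_left]
    ring
  zero_mem' := by
    simp only [Set.mem_ofPred_eq, linearizedGraph_iff_inner]
    intro φ hφ
    simp
  smul_mem' c p hp := by
    simp only [Set.mem_ofPred_eq, linearizedGraph_iff_inner] at hp ⊢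
    intro φ hφ
    have e : (c • p).2 - nonlocal (c • p).1 = c • (p.2 - nonlocal p.1) := by
      rw [Prod.smul_fst, Prod.smul_snd, map_smul, smul_sub]
    rw [e, real_inner_smul_left, hp φ hφ, Prod.smul_fst, real_inner_smul_left,
      real_inner_smul_left]
    ring

theorem mem_graph {ν : ℝ} {p : X × X} : p ∈ graph ν ↔ LinearizedGraph ν p.1 p.2 := Iff.rfl

theorem isClosed_graph (ν : ℝ) : IsClosed (graph ν : Set (X × X)) := by
  have e : (graph ν : Set (X × X)) = ⋂ φ : Dom → ℝ, ⋂ _ : IsTest φ,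
      {p | inner ℝ (p.2 - nonlocal p.1) (toX φ) =
        inner ℝ p.1 (toX fun p => p.2 ^ 2 * dx φ p) + ν * inner ℝ p.1 (toX (laplace φ))} := by
    ext p
    simp only [SetLike.mem_coe, mem_graph, linearizedGraph_iff_inner, Set.mem_iInter,
      Set.mem_ofPred_eq]
  rw [e]
  refine isClosed_iInter fun φ => isClosed_iInter fun _ => isClosed_eq ?_ ?_ <;> fun_prop

/-- The `k`-th mode of the equation `F = -y² ∂ₓω + ν Δω`. -/
theorem isWeakSecondDeriv_of_mem_graph {ν : ℝ} (hν : 0 < ν) {p : X × X} (hp : p ∈ graph ν) (k : ℤ) :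
    IsWeakSecondDeriv (mode p.1 k) fun y => (k : ℂ) ^ 2 * mode p.1 k y +
      Complex.I * k * ((ν⁻¹ * y ^ 2 : ℝ) * mode p.1 k y) +
        (ν⁻¹ : ℝ) * mode (p.2 - nonlocal p.1 : X) k y := by
  have hp' := linearizedGraph_iff_inner.1 hp
  have hw := isWeakSecondDeriv_mode (F₀ := fun q => ν⁻¹ * (p.2 - nonlocal p.1 : X) q)
    (F₁ := fun q => ν⁻¹ * (q.2 ^ 2 * p.1 q)) (F₂ := p.1) ((isTempered_X _).const_mul _)
    ((isTempered_mul_X p.1 (a := fun y => y ^ 2) (by fun_prop) fun y => by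
      rw [abs_of_nonneg (sq_nonneg y)]; nlinarith [sq_nonneg y, sq_nonneg (y ^ 2)]).const_mul _)
    (isTempered_X _) (fun φ hφ => by
      have h2 : IsTest fun p => p.2 ^ 2 * dx φ p :=
        IsTest.mul_y (a := fun y => y ^ 2) (contDiff_id.pow 2) hφ.dx
      have h := hp' φ hφ
      rw [inner_toX _ hφ.memLp, inner_toX _ h2.memLp, inner_toX _ hφ.laplace.memLp] at h
      have e1 : ∫ q, ν⁻¹ * (q.2 ^ 2 * p.1 q) * dx φ q =
          ν⁻¹ * ∫ q, p.1 q * (q.2 ^ 2 * dx φ q) := by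
        rw [← integral_const_mul]
        exact integral_congr_ae (Eventually.of_forall fun q => by ring)
      have e2 : ∫ q, ν⁻¹ * (p.2 - nonlocal p.1 : X) q * φ q =
          ν⁻¹ * ∫ q, (p.2 - nonlocal p.1 : X) q * φ q := by
        rw [← integral_const_mul]
        exact integral_congr_ae (Eventually.of_forall fun q => by ring)
      rw [e1, e2, h]
      field_simp; ring) k
  intro η hη hs
  rw [hw η hη hs]
  refine integral_congr_ae (Eventually.of_forall fun y => ?_)
  have e3 : mode (fun q : Dom => ν⁻¹ * (q.2 ^ 2 * p.1 q)) k y = (ν⁻¹ * y ^ 2 : ℝ) * mode p.1 k y := by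
    rw [IsTempered.mode_const_mul, mode_mul (fun y => y ^ 2) p.1 k y]
    push_cast; ring
  simp only [e3, IsTempered.mode_const_mul]

/-- The resolvent estimate for the local part of the operator, frequency by frequency. -/
theorem modeNorm_le_of_mem_graph {ν l : ℝ} (hν : 0 < ν) (hl : ν < l) {p : X × X}
    (hp : p ∈ graph ν) (k : ℤ) : (l - ν) ^ 2 * modeNorm (mode p.1 k) ≤
      modeNorm (mode (l • p.1 - (p.2 - nonlocal p.1) : X) k) := by
  set g : X := l • p.1 - (p.2 - nonlocal p.1) with hg
  have hw := isWeakSecondDeriv_of_mem_graph hν hp k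
  have hgk : mode g k =ᵐ[volume] fun y => l * mode p.1 k y - mode (p.2 - nonlocal p.1 : X) k y := by
    filter_upwards [mode_sub_X (l • p.1) (p.2 - nonlocal p.1) k, mode_smul_X l p.1 k] with y h1 h2
    rw [hg, h1, h2]
  have hu := memLp_mode_X p.1 k
  have hu' := memLp_y_mode_X p.1 k
  have hR : MemLp (fun y => (ν⁻¹ : ℝ) * mode g k y) 2 volume := (memLp_mode_X g k).const_mul _
  have hR' : MemLp (fun y : ℝ => (y : ℂ) * ((ν⁻¹ : ℝ) * mode g k y)) 2 volume :=
    ((memLp_y_mode_X g k).const_mul ((ν⁻¹ : ℝ) : ℂ)).ae_eq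
      (Eventually.of_forall fun y => by ring)
  have hk := sq_nonneg (k : ℝ)
  have hl1 : 1 < l / ν := (one_lt_div hν).2 hl
  have hmain := weighted_resolvent_one_add_sq (u := mode p.1 k)
    (R := fun y => (ν⁻¹ : ℝ) * mode g k y) (q := fun y => k * (ν⁻¹ * y ^ 2))
    (a := (k : ℝ) ^ 2 + l / ν) (by
      intro η hη hs
      rw [hw η hη hs]
      refine integral_congr_ae (hgk.mono fun y hy => ?_)
      simp only [hy]
      congr 1
      push_cast; ring) (hu.locallyIntegrable (by norm_num)) (by fun_prop)
    (hR.locallyIntegrable (by norm_num)) (by linarith) (integrable_weight hu hu')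
    (integrable_weight hR hR')
  have e : ∫ y, (1 + y ^ 2) * ‖(ν⁻¹ : ℝ) * mode g k y‖ ^ 2 = (ν⁻¹) ^ 2 * modeNorm (mode g k) := by
    rw [modeNorm_eq (memLp_mode_X g k) (memLp_y_mode_X g k), ← integral_const_mul]
    refine integral_congr_ae (Eventually.of_forall fun y => ?_)
    simp only [norm_mul, Complex.norm_real, mul_pow, Real.norm_eq_abs, sq_abs]
    ring
  rw [e, ← modeNorm_eq hu hu'] at hmain
  have h1 : (l / ν - 1) ^ 2 ≤ ((k : ℝ) ^ 2 + l / ν - 1) ^ 2 :=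
    pow_le_pow_left₀ (by linarith) (by linarith) 2
  have h2 := (mul_le_mul_of_nonneg_right h1 (modeNorm_nonneg (mode p.1 k))).trans hmain
  have h3 := mul_le_mul_of_nonneg_left h2 (sq_nonneg ν)
  have e1 : ν ^ 2 * ((l / ν - 1) ^ 2 * modeNorm (mode p.1 k)) =
      (l - ν) ^ 2 * modeNorm (mode p.1 k) := by field_simp
  have e2 : ν ^ 2 * (ν⁻¹ ^ 2 * modeNorm (mode g k)) = modeNorm (mode g k) := by field_simp
  rwa [e1, e2] at h3

theorem norm_le_of_mem_graph {ν l : ℝ} (hν : 0 < ν) (hl : ν < l) {p : X × X}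
    (hp : p ∈ graph ν) : (l - ν) ^ 2 * ‖p.1‖ ^ 2 ≤ ‖l • p.1 - (p.2 - nonlocal p.1)‖ ^ 2 := by
  refine hasSum_le (fun k => ?_) ((hasSum_modeNorm p.1).mul_left _) (hasSum_modeNorm _)
  have := modeNorm_le_of_mem_graph hν hl hp k
  have h2 := mul_le_mul_of_nonneg_left this Real.two_pi_pos.le
  linarith

/-- The local part `-y² ∂ₓ + ν Δ` is quasi-dissipative with constant `ν`, which is the cost of the weight
`1 + y²`. -/
theorem inner_sub_nonlocal_le {ν : ℝ} (hν : 0 < ν) {p : X × X} (hp : p ∈ graph ν) :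
    inner ℝ (p.2 - nonlocal p.1) p.1 ≤ ν * ‖p.1‖ ^ 2 := by
  set F := p.2 - nonlocal p.1
  -- The resolvent estimate for all large `l` is equivalent to a one-sided bound.
  have h : ∀ l > ν, 2 * l * (inner ℝ F p.1 - ν * ‖p.1‖ ^ 2) ≤ ‖F‖ ^ 2 := fun l hl => by
    have h1 := norm_le_of_mem_graph hν hl hp
    rw [norm_sub_sq_real, norm_smul, mul_pow, Real.norm_eq_abs, sq_abs, real_inner_smul_left,
      real_inner_comm] at h1
    have h2 : 0 ≤ ν ^ 2 * ‖p.1‖ ^ 2 := by positivity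
    linarith
  by_contra hc
  have hd : 0 < inner ℝ F p.1 - ν * ‖p.1‖ ^ 2 := by linarith
  set d := inner ℝ F p.1 - ν * ‖p.1‖ ^ 2
  have h1 := h (ν + (‖F‖ ^ 2 + 1) / d) (lt_add_of_pos_right _ (by positivity))
  have e : 2 * (ν + (‖F‖ ^ 2 + 1) / d) * d = 2 * ν * d + 2 * (‖F‖ ^ 2 + 1) := by field_simp
  rw [e] at h1
  have := sq_nonneg ‖F‖
  have := mul_pos hν hd
  linarith

theorem inner_le_of_mem_graph {ν : ℝ} (hν : 0 < ν) {p : X × X} (hp : p ∈ graph ν) :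
    inner ℝ p.2 p.1 ≤ (ν + ‖nonlocal‖) * ‖p.1‖ ^ 2 := by
  have h1 := inner_sub_nonlocal_le hν hp
  rw [inner_sub_left] at h1
  have h2 : inner ℝ (nonlocal p.1) p.1 ≤ ‖nonlocal‖ * ‖p.1‖ * ‖p.1‖ :=
    (real_inner_le_norm _ _).trans
      (mul_le_mul_of_nonneg_right (nonlocal.le_opNorm _) (norm_nonneg _))
  linarith

/-- Test functions `ζ` lie in the domain. As an element of `X` the function `ζ` is
`toX ((1 + y²) ζ)`, because `toX` divides by the weight. -/
theorem mem_graph_of_isTest (ν : ℝ) {ζ : Dom → ℝ} (hζ : IsTest ζ) :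
    (toX (fun p => (1 + p.2 ^ 2) * ζ p), nonlocal (toX fun p => (1 + p.2 ^ 2) * ζ p) +
      toX fun p => (1 + p.2 ^ 2) * (ν * laplace ζ p - p.2 ^ 2 * dx ζ p)) ∈ graph ν := by
  have sq : ∀ {φ : Dom → ℝ}, IsTest φ → IsTest fun p => p.2 ^ 2 * φ p := fun hφ =>
    IsTest.mul_y (a := fun y => y ^ 2) (contDiff_id.pow 2) hφ
  have wt : ∀ {φ : Dom → ℝ}, IsTest φ → IsTest fun p => (1 + p.2 ^ 2) * φ p := fun hφ =>
    IsTest.mul_y (a := fun y => 1 + y ^ 2) (contDiff_const.add (contDiff_id.pow 2)) hφ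
  have hξ : IsTest fun p => ν * laplace ζ p - p.2 ^ 2 * dx ζ p := by
    simpa [sub_eq_add_neg] using (hζ.laplace.const_mul ν).add ((sq hζ.dx).const_mul (-1))
  have cf : ∀ {φ : Dom → ℝ}, IsTest φ → ∀ {χ : Dom → ℝ}, IsTest χ →
      inner ℝ (toX fun p => (1 + p.2 ^ 2) * φ p) (toX χ) = ∫ p, φ p * χ p := fun {φ} hφ {χ} hχ => by
    rw [inner_toX _ hχ.memLp]
    refine integral_congr_ae ((coeFn_toX (wt hφ).memLp).mono fun p hp => ?_)
    have h : (0 : ℝ) < 1 + p.2 ^ 2 := by positivity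
    simp only [hp]
    field_simp
  refine linearizedGraph_iff_inner.2 fun φ hφ => ?_
  rw [add_sub_cancel_left, cf hξ hφ, cf hζ (sq hφ.dx), cf hζ hφ.laplace,
    hζ.integral_mul_laplace hφ]
  have e1 : ∫ p, ζ p * (p.2 ^ 2 * dx φ p) = -∫ p, p.2 ^ 2 * dx ζ p * φ p := by
    have h := hζ.dx
    have := hφ.integral_mul_dx (sq hζ)
    have e : ∀ p, dx (fun p => p.2 ^ 2 * ζ p) p = p.2 ^ 2 * dx ζ p := fun p => by
      obtain ⟨x, y⟩ := p
      induction x using QuotientAddGroup.induction_on with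
      | H a => exact ((sq hζ).hasDerivAt_x a y).unique ((hζ.hasDerivAt_x a y).const_mul (y ^ 2))
    simp only [e] at this
    rw [eq_comm, neg_eq_iff_eq_neg]
    refine Eq.trans (integral_congr_ae (Eventually.of_forall fun p => ?_))
      (this.trans (congrArg _ (integral_congr_ae (Eventually.of_forall fun p => ?_))))
    · exact mul_comm _ _
    · simp only; ring
  rw [e1, ← integral_const_mul]
  have i1 := ((hζ.laplace.mul hφ).const_mul ν).integrable
  have i2 := ((sq hζ.dx).mul hφ).integrable
  rw [neg_add_eq_sub, ← integral_sub i1 i2]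
  refine integral_congr_ae (Eventually.of_forall fun p => ?_)
  simp only; ring

theorem dense_domain (ν : ℝ) : Dense {x : X | ∃ f, (x, f) ∈ graph ν} := by
  have e : {x : X | ∃ f, (x, f) ∈ graph ν} = ((graph ν).map (LinearMap.fst ℝ X X) : Set X) := by
    ext x
    simp
  rw [e, Submodule.dense_iff_topologicalClosure_eq_top,
    Submodule.topologicalClosure_eq_top_iff, Submodule.eq_bot_iff]
  intro g hg
  refine X_eq_zero_of_inner_test fun φ hφ => ?_
  have hζ : IsTest fun p => (1 + p.2 ^ 2)⁻¹ * φ p :=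
    IsTest.mul_y (a := fun y => (1 + y ^ 2)⁻¹)
      ((contDiff_const.add (contDiff_id.pow 2)).inv fun y => by positivity) hφ
  have e : (fun p : Dom => (1 + p.2 ^ 2) * ((1 + p.2 ^ 2)⁻¹ * φ p)) = φ := by
    funext p
    have h : (1 : ℝ) + p.2 ^ 2 ≠ 0 := by positivity
    field_simp
  have hm := mem_graph_of_isTest ν hζ
  rw [e] at hm
  exact (Submodule.mem_orthogonal' _ _).1 hg _ ⟨_, hm, rfl⟩

/-- The adjoint resolvent equation has only the trivial solution. This is the density of the range
of `l - 𝓛`. -/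
theorem eq_zero_of_orthogonal {ν l : ℝ} (hν : 0 < ν) (hl : ν + ‖nonlocal‖ < l) {g : X}
    (hg : ∀ p ∈ graph ν, inner ℝ g (l • p.1 - p.2) = 0) : g = 0 := by
  have hB := norm_nonneg nonlocal
  set b : X := nonlocal.adjoint g with hb
  have hνl : ν < l := by linarith
  -- `(1 + y²) g` solves the adjoint equation in the dual weighted space.
  have hu : IsTempered fun q : Dom => (1 + q.2 ^ 2) * g q :=
    isTempered_mul_X g (a := fun y => 1 + y ^ 2) (by fun_prop) fun y => by
      rw [abs_of_nonneg (by positivity)]; nlinarith [sq_nonneg y, sq_nonneg (y ^ 2)]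
  have hu2 : IsTempered fun q : Dom => (q.2 ^ 2 * (1 + q.2 ^ 2)) * g q :=
    isTempered_mul_X g (a := fun y => y ^ 2 * (1 + y ^ 2)) (by fun_prop) fun y => by
      rw [abs_of_nonneg (by positivity)]; nlinarith [sq_nonneg y, sq_nonneg (y ^ 2)]
  have hr : IsTempered fun q : Dom => (1 + q.2 ^ 2) * (l • g - b : X) q :=
    isTempered_mul_X _ (a := fun y => 1 + y ^ 2) (by fun_prop) fun y => by
      rw [abs_of_nonneg (by positivity)]; nlinarith [sq_nonneg y, sq_nonneg (y ^ 2)]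
  have sq : ∀ {φ : Dom → ℝ}, IsTest φ → IsTest fun p => p.2 ^ 2 * φ p := fun hφ =>
    IsTest.mul_y (a := fun y => y ^ 2) (contDiff_id.pow 2) hφ
  have wt : ∀ {φ : Dom → ℝ}, IsTest φ → IsTest fun p => (1 + p.2 ^ 2) * φ p := fun hφ =>
    IsTest.mul_y (a := fun y => 1 + y ^ 2) (contDiff_const.add (contDiff_id.pow 2)) hφ
  have hweak : ∀ φ, IsTest φ → (∫ q : Dom, (1 + q.2 ^ 2) * g q * laplace φ q) +
      (∫ q : Dom, -ν⁻¹ * ((q.2 ^ 2 * (1 + q.2 ^ 2)) * g q) * dx φ q) =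
        ∫ q : Dom, ν⁻¹ * ((1 + q.2 ^ 2) * (l • g - b : X) q) * φ q := fun φ hφ => by
    have h := hg _ (mem_graph_of_isTest ν hφ)
    have hξ : IsTest fun p => ν * laplace φ p - p.2 ^ 2 * dx φ p := by
      simpa [sub_eq_add_neg] using (hφ.laplace.const_mul ν).add ((sq hφ.dx).const_mul (-1))
    simp only at h
    rw [← sub_sub, inner_sub_right, inner_sub_right, real_inner_smul_right,
      ← ContinuousLinearMap.adjoint_inner_left, ← real_inner_smul_left, ← inner_sub_left,
      inner_toX _ (wt hφ).memLp, inner_toX _ (wt hξ).memLp, sub_eq_zero] at h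
    have e1 : ∫ q : Dom, ν⁻¹ * ((1 + q.2 ^ 2) * (l • g - b : X) q) * φ q =
        ν⁻¹ * ∫ q : Dom, (l • g - b : X) q * ((1 + q.2 ^ 2) * φ q) := by
      rw [← integral_const_mul]
      exact integral_congr_ae (Eventually.of_forall fun q => by ring)
    rw [e1, h, ← integral_const_mul]
    have i1 : Integrable fun q : Dom => (1 + q.2 ^ 2) * g q * laplace φ q :=
      ((memLp_X g).integrable_mul (wt hφ.laplace).memLp).congr
        (Eventually.of_forall fun q => by simp only [Pi.mul_apply]; ring)
    have i2 : Integrable fun q : Dom => -ν⁻¹ * ((q.2 ^ 2 * (1 + q.2 ^ 2)) * g q) * dx φ q :=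
      (((memLp_X g).integrable_mul (sq (wt hφ.dx)).memLp).const_mul (-ν⁻¹)).congr
        (Eventually.of_forall fun q => by simp only [Pi.mul_apply]; ring)
    rw [← integral_add i1 i2]
    refine integral_congr_ae (Eventually.of_forall fun q => ?_)
    simp only
    field_simp
    ring
  have key : ∀ k : ℤ, (l - ν) ^ 2 * modeNorm (mode g k) ≤ modeNorm (mode b k) := fun k => by
    have hw := isWeakSecondDeriv_mode (hr.const_mul ν⁻¹) (hu2.const_mul (-ν⁻¹)) hu hweak k
    have hgk := memLp_mode_X g k
    have hgk' := memLp_y_mode_X g k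
    have hbk := memLp_mode_X b k
    have hbk' := memLp_y_mode_X b k
    have m1 : ∀ y, mode (fun q : Dom => (1 + q.2 ^ 2) * g q) k y =
        (1 + y ^ 2 : ℝ) * mode g k y := fun y => mode_mul (fun y => 1 + y ^ 2) g k y
    have m2 : ∀ y, mode (fun q : Dom => -ν⁻¹ * ((q.2 ^ 2 * (1 + q.2 ^ 2)) * g q)) k y =
        (-ν⁻¹ : ℝ) * ((y ^ 2 * (1 + y ^ 2) : ℝ) * mode g k y) := fun y => by
      rw [IsTempered.mode_const_mul, mode_mul (fun y => y ^ 2 * (1 + y ^ 2)) g k y]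
    have m3 : ∀ᵐ y, mode (fun q : Dom => ν⁻¹ * ((1 + q.2 ^ 2) * (l • g - b : X) q)) k y =
        (ν⁻¹ : ℝ) * ((1 + y ^ 2 : ℝ) * (l * mode g k y - mode b k y)) := by
      filter_upwards [mode_sub_X (l • g) b k, mode_smul_X l g k] with y h1 h2
      rw [IsTempered.mode_const_mul, mode_mul (fun y => 1 + y ^ 2) _ k y, h1, h2]
    have iw : ∀ {u : ℝ → ℂ} (c : ℝ), MemLp u 2 volume →
        MemLp (fun y : ℝ => (y : ℂ) * u y) 2 volume →
        (Integrable fun y => (1 + y ^ 2)⁻¹ * ‖(c : ℂ) * ((1 + y ^ 2 : ℝ) * u y)‖ ^ 2) ∧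
        ∫ y, (1 + y ^ 2)⁻¹ * ‖(c : ℂ) * ((1 + y ^ 2 : ℝ) * u y)‖ ^ 2 = c ^ 2 * modeNorm u := by
      intro u c h h'
      have e : (fun y => (1 + y ^ 2)⁻¹ * ‖(c : ℂ) * ((1 + y ^ 2 : ℝ) * u y)‖ ^ 2) =
          fun y => c ^ 2 * ((1 + y ^ 2) * ‖u y‖ ^ 2) := by
        funext y
        have hp : (0 : ℝ) < 1 + y ^ 2 := by positivity
        rw [norm_mul, norm_mul, Complex.norm_real, Complex.norm_real, Real.norm_of_nonneg hp.le,
          mul_pow, mul_pow, Real.norm_eq_abs, sq_abs]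
        field_simp
      rw [e, modeNorm_eq h h', ← integral_const_mul]
      exact ⟨(integrable_weight h h').const_mul _, rfl⟩
    obtain ⟨i1, e1⟩ := iw 1 hgk hgk'
    obtain ⟨i2, e2⟩ := iw ν⁻¹ hbk hbk'
    have ll : ∀ {u : ℝ → ℂ} (c : ℝ), MemLp u 2 volume →
        LocallyIntegrable (fun y => (c : ℂ) * ((1 + y ^ 2 : ℝ) * u y)) volume := fun {u} c h => by
      have h1 := (h.locallyIntegrable (by norm_num)).mul_continuous
        (by fun_prop : Continuous fun y : ℝ => (c : ℂ) * (1 + y ^ 2 : ℝ))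
      refine h1.congr (Eventually.of_forall fun y => ?_)
      ring
    have hk := sq_nonneg (k : ℝ)
    have hl1 : 1 < l / ν := (one_lt_div hν).2 hνl
    have hmain := weighted_resolvent_inv (u := fun y => ((1 : ℝ) : ℂ) * ((1 + y ^ 2 : ℝ) * mode g k y))
      (R := fun y => (ν⁻¹ : ℝ) * ((1 + y ^ 2 : ℝ) * mode b k y)) (q := fun y => -k * (ν⁻¹ * y ^ 2))
      (a := (k : ℝ) ^ 2 + l / ν) (by
        intro η hη hs
        have := hw η hη hs
        simp only [m1] at this
        simp only [Complex.ofReal_one, one_mul]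
        rw [this]
        refine integral_congr_ae (m3.mono fun y hy => ?_)
        simp only [hy, m2]
        congr 1
        push_cast; ring) (ll 1 hgk) (by fun_prop) (ll _ hbk) (by linarith) i1 i2
    rw [e1, e2] at hmain
    have h1 : (l / ν - 1) ^ 2 ≤ ((k : ℝ) ^ 2 + l / ν - 9 / 16) ^ 2 :=
      pow_le_pow_left₀ (by linarith) (by linarith) 2
    have h2 := (mul_le_mul_of_nonneg_right h1 (by
      have := modeNorm_nonneg (mode g k); positivity)).trans hmain
    have h3 := mul_le_mul_of_nonneg_left h2 (sq_nonneg ν)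
    have e1 : ν ^ 2 * ((l / ν - 1) ^ 2 * (1 ^ 2 * modeNorm (mode g k))) =
        (l - ν) ^ 2 * modeNorm (mode g k) := by field_simp
    have e2 : ν ^ 2 * (ν⁻¹ ^ 2 * modeNorm (mode b k)) = modeNorm (mode b k) := by field_simp
    rwa [e1, e2] at h3
  have hsum : (l - ν) ^ 2 * ‖g‖ ^ 2 ≤ ‖b‖ ^ 2 := by
    refine hasSum_le (fun k => ?_) ((hasSum_modeNorm g).mul_left _) (hasSum_modeNorm b)
    have h2 := mul_le_mul_of_nonneg_left (key k) Real.two_pi_pos.le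
    linarith
  rw [← mul_pow] at hsum
  have h1 := le_of_sq_le_sq hsum (norm_nonneg b)
  have h2 : ‖b‖ ≤ ‖nonlocal‖ * ‖g‖ := by
    have := nonlocal.adjoint.le_opNorm g
    rwa [LinearIsometryEquiv.norm_map] at this
  have h3 : 0 ≤ ‖g‖ := norm_nonneg g
  by_contra hne
  have h4 : 0 < ‖g‖ := norm_pos_iff.2 hne
  have := mul_pos (by linarith : 0 < l - ν - ‖nonlocal‖) h4
  linarith

theorem isQuasiMDissipative_graph {ν : ℝ} (hν : 0 < ν) :
    C0Semigroup.IsQuasiMDissipative (graph ν) (ν + ‖nonlocal‖) where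
  nonneg := add_nonneg hν.le (norm_nonneg _)
  inner_le p hp := inner_le_of_mem_graph hν hp
  dense := dense_domain ν
  range l hl v := by
    have hl0 : 0 < l := (add_pos_of_pos_of_nonneg hν (norm_nonneg _)).trans hl
    let T : graph ν →L[ℝ] X :=
      (l • ContinuousLinearMap.fst ℝ X X - ContinuousLinearMap.snd ℝ X X).comp (graph ν).subtypeL
    have hT : ∀ p : graph ν, T p = l • (p : X × X).1 - (p : X × X).2 := fun p => rfl
    have hd : 0 < l - (ν + ‖nonlocal‖) := sub_pos.2 hl
    set d := l - (ν + ‖nonlocal‖)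
    have hbd : ∀ p : graph ν, d * ‖(p : X × X).1‖ ≤ ‖T p‖ := fun p => by
      have h1 := inner_le_of_mem_graph hν p.2
      have h2 : inner ℝ (T p) (p : X × X).1 =
          l * ‖(p : X × X).1‖ ^ 2 - inner ℝ (p : X × X).2 (p : X × X).1 := by
        rw [hT, inner_sub_left, real_inner_smul_left, real_inner_self_eq_norm_sq]
      have h3 := real_inner_le_norm (T p) (p : X × X).1
      rcases (norm_nonneg (p : X × X).1).eq_or_lt with h0 | h0
      · rw [← h0, mul_zero]; exact norm_nonneg _
      · refine le_of_mul_le_mul_right ?_ h0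
        calc d * ‖(p : X × X).1‖ * ‖(p : X × X).1‖ =
            l * ‖(p : X × X).1‖ ^ 2 - (ν + ‖nonlocal‖) * ‖(p : X × X).1‖ ^ 2 := by ring
          _ ≤ _ := by linarith
    have hanti : ∀ p : graph ν, ‖p‖ ≤ (d⁻¹ + l * d⁻¹ + 1) * ‖T p‖ := fun p => by
      have h1 : ‖(p : X × X).1‖ ≤ d⁻¹ * ‖T p‖ := by
        rw [inv_mul_eq_div, le_div_iff₀' hd]; exact hbd p
      have h2 : ‖(p : X × X).2‖ ≤ l * ‖(p : X × X).1‖ + ‖T p‖ := by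
        have e : (p : X × X).2 = l • (p : X × X).1 - T p := by rw [hT]; abel
        rw [e]
        refine (norm_sub_le _ _).trans ?_
        rw [norm_smul, Real.norm_of_nonneg hl0.le]
      have h0 := norm_nonneg (T p)
      have h3 : 0 ≤ d⁻¹ * ‖T p‖ := by positivity
      have h4 := mul_le_mul_of_nonneg_left h1 hl0.le
      have h5 : 0 ≤ l * (d⁻¹ * ‖T p‖) := by positivity
      have : ‖(p : X × X)‖ ≤ _ := max_le (a := ‖(p : X × X).1‖) (b := ‖(p : X × X).2‖)
        (c := (d⁻¹ + l * d⁻¹ + 1) * ‖T p‖) (by linarith) (by linarith)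
      exact this
    have : CompleteSpace (graph ν) := (isClosed_graph ν).completeSpace_coe
    have hcl : IsClosed (LinearMap.range (T : graph ν →ₗ[ℝ] X) : Set X) := by
      have hK : AntilipschitzWith (Real.toNNReal (d⁻¹ + l * d⁻¹ + 1)) T :=
        T.antilipschitz_of_bound fun p => by
          rw [Real.coe_toNNReal _ (by positivity)]; exact hanti p
      exact hK.isClosed_range T.uniformContinuous
    have htop : LinearMap.range (T : graph ν →ₗ[ℝ] X) = ⊤ := by
      rw [← hcl.submodule_topologicalClosure_eq, Submodule.topologicalClosure_eq_top_iff,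
        Submodule.eq_bot_iff]
      intro g hg
      refine eq_zero_of_orthogonal hν hl fun p hp => ?_
      exact (Submodule.mem_orthogonal' _ _).1 hg _ ⟨⟨p, hp⟩, rfl⟩
    obtain ⟨p, hp⟩ := (htop ▸ Submodule.mem_top : v ∈ LinearMap.range (T : graph ν →ₗ[ℝ] X))
    exact ⟨p, p.2, hp⟩

/-! ### Decay of the implicit Euler iterates in `X` -/

/-- The stream function of a mode solves `Φ'' = k² Φ - U` in the classical sense; `Φ` has the opposite
sign to the stream function. -/
theorem exists_isStreamMode (ω : X) {k : ℤ} (hk : k ≠ 0) {U : ℝ → ℂ}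
    (hU : mode ω k =ᵐ[volume] U) : ∃ Φ Φ' : ℝ → ℂ, IsStreamMode k U Φ Φ' ∧
      Φ =ᵐ[volume] fun y => -mode (streamX ω) k y := by
  have hs := memLp_X (streamX ω)
  have hw := isWeakSecondDeriv_mode_stream hs (fun φ hφ => integral_streamX_mul_laplace ω hφ) k
  simp only [hk, if_false] at hw
  have l1 := (memLp_mode hs k).locallyIntegrable (by norm_num)
  have l2 := (memLp_mode_X ω k).locallyIntegrable (by norm_num)
  obtain ⟨P, P', hP, h1, h2⟩ := hw.exists_isPrim l1 ((l1.smul ((k : ℂ) ^ 2)).add l2)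
  have hΦ : (fun y => -mode (streamX ω) k y) =ᵐ[volume] fun y => (-1 : ℂ) * P y :=
    hP.mono fun y hy => by simp only [hy, neg_one_mul]
  refine ⟨fun y => (-1) * P y, fun y => (-1) * P' y, ⟨(memLp_mode_X ω k).ae_eq hU,
    (memLp_y_mode_X ω k).ae_eq (hU.mono fun y hy => by simp only [hy]),
    (memLp_mode hs k).neg.ae_eq hΦ, ?_, h1.const_mul _, (h2.const_mul (-1)).congr_ae ?_⟩, hΦ.symm⟩
  · exact (memLp_y_mode_X (streamX ω) k).neg.ae_eq (hP.mono fun y hy => by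
      simp only [Pi.neg_apply, hy]; ring)
  · filter_upwards [hU, hP] with y e1 e2
    rw [← e1, ← e2]
    push_cast; ring

/-- The modes of implicit Euler iterates are implicit Euler iterates in the sense of `modeNorm_le`, once
their continuously differentiable representatives are chosen. -/
theorem modeNorm_iterate_le {ν l : ℝ} (hν : 0 < ν) (hν1 : ν < 1) (hl : 1 ≤ l) {x : ℕ → X}
    (hx : ∀ m, (x (m + 1), l • (x (m + 1) - x m)) ∈ graph ν) {k : ℤ} (hk : k ≠ 0) (n : ℕ) :
    modeNorm (mode (x n) k) ≤ 3 * modeNorm (mode (x 0) k) ∧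
      modeNorm (mode (x n) k) * (1 + 2 * l⁻¹ * (√ν / 14)) ^ n ≤
        15 / √ν * modeNorm (mode (x 0) k) := by
  have hl0 : 0 < l := by linarith
  have hk1 : (1 : ℝ) ≤ (k : ℝ) ^ 2 := by
    have : (1 : ℤ) ≤ k ^ 2 := by
      have := sq_nonneg k
      have h0 : k ^ 2 ≠ 0 := pow_ne_zero 2 hk
      omega
    exact_mod_cast this
  have hreg : ∀ m, ∃ U V : ℝ → ℂ, mode (x (m + 1)) k =ᵐ[volume] U ∧ IsPrim U V ∧
      IsPrim V fun y => (k : ℂ) ^ 2 * mode (x (m + 1)) k y +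
        Complex.I * k * ((ν⁻¹ * y ^ 2 : ℝ) * mode (x (m + 1)) k y) +
          (ν⁻¹ : ℝ) * mode (l • (x (m + 1) - x m) - nonlocal (x (m + 1)) : X) k y := fun m => by
    have l1 := (memLp_mode_X (x (m + 1)) k).locallyIntegrable (by norm_num)
    have l2 := (memLp_mode_X (l • (x (m + 1) - x m) - nonlocal (x (m + 1)) : X) k).locallyIntegrable
      (by norm_num)
    have l3 : LocallyIntegrable (fun y : ℝ => Complex.I * k *
        ((ν⁻¹ * y ^ 2 : ℝ) * mode (x (m + 1)) k y)) volume :=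
      (l1.mul_continuous (by fun_prop : Continuous fun y : ℝ =>
        Complex.I * k * ((ν⁻¹ * y ^ 2 : ℝ) : ℂ))).congr (Eventually.of_forall fun y => by ring)
    exact (isWeakSecondDeriv_of_mem_graph hν (hx m) k).exists_isPrim l1
      (((l1.smul ((k : ℂ) ^ 2)).add l3).add (l2.smul ((ν⁻¹ : ℝ) : ℂ)))
  choose U' V' hU' hV' hW' using hreg
  let U : ℕ → ℝ → ℂ := fun n => Nat.casesOn n (mode (x 0) k) U'
  have hU : ∀ m, mode (x m) k =ᵐ[volume] U m := fun m => by
    cases m with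
    | zero => exact EventuallyEq.rfl
    | succ m => exact hU' m
  choose Φ Φ' hΦ hΦ' using fun m => exists_isStreamMode (x m) hk (hU m)
  have hmod : ∀ m, modeNorm (mode (x m) k) = modeNorm (U m) := fun m =>
    modeNorm_congr (hU m) (memLp_mode_X _ k) (memLp_y_mode_X _ k)
  let f : ℕ → ℝ → ℂ := fun m y => (U (m + 1) y - U m y) / (l⁻¹ : ℝ)
  let S : ℕ → ℝ → ℂ := fun m y => (ν : ℂ)⁻¹ * ((f (m - 1) y + ((ν : ℂ) * (k : ℝ) ^ 2) * U m y +
    (2 * Complex.I * (k : ℝ)) * Φ m y) + (Complex.I * (k : ℝ)) * ((y : ℂ) ^ 2 * U m y))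
  have hνc : (ν : ℂ) ≠ 0 := by exact_mod_cast hν.ne'
  have hlc : (l : ℂ) ≠ 0 := by exact_mod_cast hl0.ne'
  have hdom : ∀ m, IsDomainMode ν k (U (m + 1)) (V' m) (S (m + 1)) (Φ (m + 1)) (Φ' (m + 1))
      fun y => (U (m + 1) y - U m y) / (l⁻¹ : ℝ) := fun m =>
    { toIsStreamMode := hΦ (m + 1)
      prim := hV' m
      prim' := by
        refine (hW' m).congr_ae ?_
        filter_upwards [hU m, hU (m + 1), hΦ' (m + 1), mode_nonlocal (x (m + 1)) k,
          mode_sub_X (l • (x (m + 1) - x m)) (nonlocal (x (m + 1))) k,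
          mode_smul_X l (x (m + 1) - x m) k, mode_sub_X (x (m + 1)) (x m) k]
          with y e1 e2 e3 e4 e5 e6 e7
        rw [e5, e6, e7, e4, e1, e2]
        simp only [S, f, Nat.add_sub_cancel, e3]
        push_cast
        field_simp
        ring
      memLp_f := (((hΦ (m + 1)).memLp.sub (hΦ m).memLp).const_mul (l : ℂ)).ae_eq
        (Eventually.of_forall fun y => by simp only [Pi.sub_apply]; push_cast; field_simp)
      memLp_y_f := (((hΦ (m + 1)).memLp_y.sub (hΦ m).memLp_y).const_mul (l : ℂ)).ae_eq
        (Eventually.of_forall fun y => by simp only [Pi.sub_apply]; push_cast; field_simp)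
      eqn := fun y => by
        simp only [S, f, Nat.add_sub_cancel]
        field_simp }
  have := modeNorm_le hν hν1 hk1 (inv_pos.2 hl0) (inv_le_one_of_one_le₀ hl)
    (V := fun n => V' (n - 1)) (hΦ 0) hdom n
  rwa [hmod, hmod]

theorem ae_eq_zero_of_modeNorm {U : ℝ → ℂ} (hU : MemLp U 2) (h : modeNorm U = 0) :
    U =ᵐ[volume] 0 := by
  have h1 : ‖toL2 U‖ ^ 2 = 0 := by
    rw [modeNorm] at h
    nlinarith [sq_nonneg ‖toL2 U‖, sq_nonneg ‖toL2 fun y : ℝ => (y : ℂ) * U y‖]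
  have h2 : toL2 U = 0 := norm_eq_zero.1 (pow_eq_zero_iff two_ne_zero |>.1 h1)
  rw [toL2_eq hU] at h2
  exact hU.coeFn_toLp.symm.trans ((Lp.eq_zero_iff_ae_eq_zero).1 h2)

/-- The zero frequency is invariant under the implicit Euler scheme. -/
theorem modeNorm_zero_iterate {ν l : ℝ} (hν : 0 < ν) (hl : ν < l) {x : ℕ → X}
    (hx : ∀ m, (x (m + 1), l • (x (m + 1) - x m)) ∈ graph ν) (h0 : modeNorm (mode (x 0) 0) = 0)
    (n : ℕ) : modeNorm (mode (x n) 0) = 0 := by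
  induction n with
  | zero => exact h0
  | succ n ih =>
    have h := modeNorm_le_of_mem_graph hν hl (hx n) 0
    set g : X := l • x (n + 1) - (l • (x (n + 1) - x n) - nonlocal (x (n + 1))) with hg
    have e : g = l • x n - (-1 : ℝ) • nonlocal (x (n + 1)) := by rw [hg, smul_sub]; module
    have hgz : mode g 0 =ᵐ[volume] 0 := by
      rw [e]
      filter_upwards [mode_sub_X (l • x n) ((-1 : ℝ) • nonlocal (x (n + 1))) 0,
        mode_smul_X l (x n) 0, mode_smul_X (-1) (nonlocal (x (n + 1))) 0,
        mode_nonlocal (x (n + 1)) 0, ae_eq_zero_of_modeNorm (memLp_mode_X _ _) ih]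
        with y e1 e2 e3 e4 e5
      rw [e1, e2, e3, e4, e5]
      simp
    have hgn : modeNorm (mode g 0) = 0 := by
      rw [modeNorm_congr hgz (memLp_mode_X _ _) (memLp_y_mode_X _ _),
        modeNorm_eq MemLp.zero (by simp)]
      simp
    rw [hgn] at h
    have h1 : 0 < (l - ν) ^ 2 := pow_pos (sub_pos.2 hl) 2
    have h2 := modeNorm_nonneg (mode (x (n + 1)) 0)
    nlinarith

theorem norm_iterate_sq_le {ν l : ℝ} (hν : 0 < ν) (hν1 : ν < 1) (hl : 1 ≤ l) {x : ℕ → X}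
    (hx : ∀ m, (x (m + 1), l • (x (m + 1) - x m)) ∈ graph ν)
    (h0 : modeNorm (mode (x 0) 0) = 0) (n : ℕ) :
    ‖x n‖ ^ 2 ≤ 3 * ‖x 0‖ ^ 2 ∧
      ‖x n‖ ^ 2 * (1 + 2 * l⁻¹ * (√ν / 14)) ^ n ≤ 15 / √ν * ‖x 0‖ ^ 2 := by
  have key : ∀ k : ℤ, modeNorm (mode (x n) k) ≤ 3 * modeNorm (mode (x 0) k) ∧
      modeNorm (mode (x n) k) * (1 + 2 * l⁻¹ * (√ν / 14)) ^ n ≤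
        15 / √ν * modeNorm (mode (x 0) k) := fun k => by
    by_cases hk : k = 0
    · rw [hk, h0, modeNorm_zero_iterate hν (by linarith) hx h0 n]; simp
    · exact modeNorm_iterate_le hν hν1 hl hx hk n
  have hp := Real.two_pi_pos.le
  constructor
  · refine hasSum_le (fun k => ?_) (hasSum_modeNorm (x n)) ((hasSum_modeNorm (x 0)).mul_left 3)
    have := mul_le_mul_of_nonneg_left (key k).1 hp
    linarith
  · refine hasSum_le (fun k => ?_) ((hasSum_modeNorm (x n)).mul_right _)
      ((hasSum_modeNorm (x 0)).mul_left _)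
    have := mul_le_mul_of_nonneg_left (key k).2 hp
    linarith

/-- The exponent which converts the loss `ν^{-1/2}` into a constant factor. -/
noncomputable def interpExponent (ν : ℝ) : ℝ := 7 / 10 / (1 + |Real.log ν|)

theorem interpExponent_pos (ν : ℝ) : 0 < interpExponent ν := by
  have := abs_nonneg (Real.log ν)
  unfold interpExponent; positivity

theorem interpExponent_le_one (ν : ℝ) : interpExponent ν ≤ 1 := by
  have := abs_nonneg (Real.log ν)
  unfold interpExponent
  rw [div_le_one (by linarith)]; linarith

theorem inv_sqrt_rpow_le {ν : ℝ} (hν : 0 < ν) : ((√ν)⁻¹) ^ interpExponent ν ≤ 5 / 3 := by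
  have h := abs_nonneg (Real.log ν)
  have hs : 0 < √ν := Real.sqrt_pos.2 hν
  rw [Real.rpow_def_of_pos (inv_pos.2 hs), Real.log_inv, Real.log_sqrt hν.le]
  have h1 : -(Real.log ν / 2) * interpExponent ν ≤ 7 / 20 := by
    have h2 : -(Real.log ν / 2) ≤ (1 + |Real.log ν|) / 2 := by
      have := neg_le_abs (Real.log ν); linarith
    refine (mul_le_mul_of_nonneg_right h2 (interpExponent_pos ν).le).trans (le_of_eq ?_)
    unfold interpExponent
    field_simp; norm_num
  refine (Real.exp_le_exp.2 h1).trans ?_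
  have h3 := Real.exp_one_lt_d9
  -- `e^{7/20} ≤ 5/3` because `e^7 ≤ (5/3)^20`.
  refine le_of_pow_le_pow_left₀ (n := 20) (by norm_num) (by norm_num) ?_
  rw [← Real.exp_nat_mul]
  have e : ((20 : ℕ) : ℝ) * (7 / 20) = (7 : ℕ) * 1 := by norm_num
  rw [e, Real.exp_nat_mul]
  refine (pow_le_pow_left₀ (Real.exp_pos 1).le h3.le 7).trans ?_
  norm_num

/-- The two bounds of `norm_iterate_sq_le`, interpolated with the exponent `interpExponent ν`: this
removes the factor `ν^{-1/2}` at the price of the logarithm in the rate. -/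
theorem norm_iterate_le {ν l : ℝ} (hν : 0 < ν) (hν1 : ν < 1) (hl : 1 ≤ l) {x : ℕ → X}
    (hx : ∀ m, (x (m + 1), l • (x (m + 1) - x m)) ∈ graph ν)
    (h0 : modeNorm (mode (x 0) 0) = 0) (n : ℕ) :
    ‖x n‖ ≤ 5 * ‖x 0‖ * ((1 + √ν / 7 * l⁻¹) ^ (-(interpExponent ν / 2))) ^ n := by
  obtain ⟨h1, h2⟩ := norm_iterate_sq_le hν hν1 hl hx h0 n
  set θ := interpExponent ν with hθ
  have hθ0 : 0 < θ := interpExponent_pos ν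
  have hθ1 : θ ≤ 1 := interpExponent_le_one ν
  have hl0 : 0 < l⁻¹ := inv_pos.2 (by linarith)
  have hs : 0 < √ν := Real.sqrt_pos.2 hν
  have e : 1 + 2 * l⁻¹ * (√ν / 14) = 1 + √ν / 7 * l⁻¹ := by ring
  rw [e] at h2
  set R := 1 + √ν / 7 * l⁻¹ with hR
  have hR0 : 0 < R := by positivity
  set z := (√ν)⁻¹ * (R ^ n)⁻¹ with hz
  have hz0 : 0 < z := by positivity
  have hv := sq_nonneg ‖x 0‖
  have h3 : ‖x n‖ ^ 2 ≤ 15 * ‖x 0‖ ^ 2 * z := by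
    have := mul_le_mul_of_nonneg_right h2 (inv_nonneg.2 (pow_pos hR0 n).le)
    rw [mul_assoc, mul_inv_cancel₀ (pow_pos hR0 n).ne', mul_one] at this
    refine this.trans (le_of_eq ?_)
    rw [hz]; ring
  -- `min 1 z ≤ z ^ θ`
  have h4 : ‖x n‖ ^ 2 ≤ 15 * ‖x 0‖ ^ 2 * z ^ θ := by
    rcases le_total z 1 with hz1 | hz1
    · refine h3.trans (mul_le_mul_of_nonneg_left ?_ (by positivity))
      simpa using Real.rpow_le_rpow_of_exponent_ge hz0 hz1 hθ1
    · have := mul_le_mul_of_nonneg_left (Real.one_le_rpow hz1 hθ0.le)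
        (by positivity : 0 ≤ 15 * ‖x 0‖ ^ 2)
      linarith
  have h5 : z ^ θ ≤ 5 / 3 * ((R ^ (-(θ / 2))) ^ n) ^ 2 := by
    rw [hz, Real.mul_rpow (by positivity) (by positivity)]
    refine (mul_le_mul_of_nonneg_right (inv_sqrt_rpow_le hν) (by positivity)).trans (le_of_eq ?_)
    congr 1
    rw [← pow_mul, ← Real.rpow_natCast (R ^ (-(θ / 2))), ← Real.rpow_mul hR0.le,
      ← Real.rpow_natCast R, ← Real.rpow_neg hR0.le, ← Real.rpow_mul hR0.le]
    congr 1
    push_cast; ring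
  refine le_of_sq_le_sq ?_ (by positivity)
  have h6 := mul_le_mul_of_nonneg_left h5 (by positivity : 0 ≤ 15 * ‖x 0‖ ^ 2)
  refine (h4.trans h6).trans (le_of_eq ?_)
  ring

theorem tendsto_decay_rate (ν : ℝ) :
    Tendsto (fun l : ℝ => l * ((1 + √ν / 7 * l⁻¹) ^ (-(interpExponent ν / 2)) - 1)) atTop
      (𝓝 (-(1 / 20 * rate ν))) := by
  have h1 : HasDerivAt (fun s : ℝ => 1 + √ν / 7 * s) (√ν / 7) 0 := by
    simpa using ((hasDerivAt_id (0 : ℝ)).const_mul (√ν / 7)).const_add 1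
  have h2 := h1.rpow_const (p := -(interpExponent ν / 2)) (Or.inl (by norm_num))
  have h3 := (hasDerivAt_iff_tendsto_slope_zero.1 h2).comp
    (tendsto_inv_atTop_nhdsGT_zero.mono_right (nhdsWithin_mono _ fun s hs => ne_of_gt hs))
  have e : √ν / 7 * -(interpExponent ν / 2) *
      (1 + √ν / 7 * 0) ^ (-(interpExponent ν / 2) - 1) = -(1 / 20 * rate ν) := by
    have := abs_nonneg (Real.log ν)
    rw [mul_zero, add_zero, Real.one_rpow, interpExponent, rate]
    field_simp; ring
  rw [e] at h3
  refine h3.congr fun l => ?_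
  simp

end Poiseuille

theorem corollary1p2 :
    ∃ ε₀ C₀ : ℝ, 1 / 20 ≤ ε₀ ∧ 1 < C₀ ∧ C₀ < 10 ∧
      ∀ ν : ℝ, 0 < ν → ν < 1 →
        (∃! S : C0Semigroup Poiseuille.X, Poiseuille.IsLinearizedSemigroup ν S) ∧
        ∀ S : C0Semigroup Poiseuille.X, Poiseuille.IsLinearizedSemigroup ν S →
          ∀ ωin : Poiseuille.X,
            (∀ᵐ y : ℝ, ∫ x : Poiseuille.Torus, ωin (x, y) = 0) →
            ∀ t : ℝ≥0, ‖S.op t ωin‖ ≤ C₀ * Real.exp (-ε₀ * Poiseuille.rate ν * t) * ‖ωin‖ := by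
  refine ⟨1 / 20, 5, le_rfl, by norm_num, by norm_num, fun ν hν hν1 => ?_⟩
  have hG := Poiseuille.isQuasiMDissipative_graph hν
  obtain ⟨S, hS, hdecay⟩ := hG.exists_semigroup
  have huniq : ∀ T : C0Semigroup Poiseuille.X, Poiseuille.IsLinearizedSemigroup ν T → T = S :=
    fun T hT => C0Semigroup.eq_of_generatorGraph hG hT hS
  refine ⟨⟨S, hS, huniq⟩, fun T hT ωin hω t => ?_⟩
  rw [huniq T hT]
  have hz := (Poiseuille.ae_integral_eq_zero_iff _).1 hω
  have h := hdecay ωin (5 * ‖ωin‖) (1 / 20 * Poiseuille.rate ν) _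
    (Poiseuille.tendsto_decay_rate ν) ?_ t
  · refine h.trans (le_of_eq ?_)
    rw [show -(1 / 20) * Poiseuille.rate ν * (t : ℝ) = -(1 / 20 * Poiseuille.rate ν) * t by ring]
    ring
  · filter_upwards [eventually_ge_atTop 1] with l hl x hx0 hx m
    have hx00 : Poiseuille.modeNorm (Poiseuille.mode (x 0) 0) = 0 := by
      rw [hx0, Poiseuille.modeNorm_congr hz (Poiseuille.memLp_mode_X _ _)
        (Poiseuille.memLp_y_mode_X _ _), Poiseuille.modeNorm_eq MemLp.zero
        (by simp)]
      simp
    rw [← hx0]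
    exact Poiseuille.norm_iterate_le hν hν1 hl hx hx00 m
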